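/- Conventions. Let $\mathbb C^{\mathbb Z}_{cpt}$ be the space with orthonormal basis $(e_i)_{i\in\mathbb Z}$, $\mathbb C_{-\infty}^p=\mathrm{span}\{e_i: i<p\}$ and $\mathbb C_p^q=\mathrm{span}\{e_i:p\le i<q\}$, and let $I_0$ be the orthogonal projection onto $\mathbb C_{-\infty}^0$. $U$ is the group of unitary operators $A$ of $\mathbb C^{\mathbb Z}_{cpt}$ with $A-\mathrm{Id}$ of finite rank, and $U_p^q\subset U$ the subgroup of unitary operators of $\mathbb C_p^q$, extended by the identity. $BU\times\mathbb Z$ is the set of Hermitian operators $P$ of $\mathbb C^{\mathbb Z}_{cpt}$ with spectrum in $\{0,1\}$ and $P-I_0$ of finite rank, and $(BU\times\mathbb Z)_p^q$ is the set of those with $\mathbb C_{-\infty}^p\subset \mathrm{Im}(P)\subset\mathbb C_{-\infty}^q$. A map to one of these spaces is smooth if locally it is a smooth map into some $U_{-n}^n$, respectively $(BU\times \mathbb Z)_{-n}^n$. For smooth maps $P$ into $BU\times\mathbb Z$ and $u$ into $U$ put $$Ch(P)=\mathrm{Tr}\sum_{n\ge0}\frac{1}{(2\pi i)^n\,n!}P(dP)^{2n},\qquad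 Ch(u)=\mathrm{Tr}\sum_{n\ge 0}\frac{(-1)^n}{(2\pi i)^{n+1}}\frac{n!}{(2n+1)!}(u^{-1}du)^{2n+1},$$ and for a connection $\nabla$ with curvature $R$ put $Ch(\nabla)=\mathrm{Tr}\exp(R/2\pi i)$. Parametrize $S^1$ by $t\mapsto e^{2\pi it}$, $t\in[0,1]$; fibre integration over $S^1$ is normalized by $\int_{S^1}dt\wedge\beta=\int_0^1\beta\,dt$. Let $M$ be a compact smooth manifold, possibly with corners, and let $P_t:M\times S^1\to BU\times\mathbb Z$ be smooth. There are $p,q$ such that $P_t$ takes values in $(BU\times\mathbb Z)_p^q$; fix any such $p,q$. Let $E=\mathrm{Im}(P_t|_{\mathbb C_p^q})$ and $E^\perp$ be the sub-bundle of $(M\times S^1)\times\mathbb C_p^q$ defined by $P_t$ and its orthogonal complement, with the connections $\nabla=P_t\circ d$ and $\nabla^\perp=(\mathrm{Id}-P_t)\circ d$, and let $\nabla_t,\nabla_t^\perp$ be their restrictions to $M\times\{e^{2\pi i t}\}$. Let $g_t:E_0\to E_t$ be the parallel transport of $\nabla$ in the $S^1$-direction, where $E_t=E|_{M\times\{e^{2\pi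 it}\}}$, so that $g_1:E_0\to E_0$ is the holonomy, and let $h_*(P_t)=g_1\oplus \mathrm{id}:M\to U$, with $\mathrm{id}$ the identity of the orthogonal complement of $E_0$. Write $\nabla_0\oplus\nabla_0^\perp=d+A$ on $M\times\mathbb C_p^q$, and $t\nabla_0\oplus t\nabla_0^\perp=d+tA$. On $M\times[0,1]^2$, with coordinates $(r,t)$ on the square, put $$\eta_{P_t}=\iint_{dt\wedge dr}Ch\big((1-r)\nabla_0+r\,g_t^*\nabla_t\big)+\iint_{dr\wedge dt}Ch\big((1-r)(t\nabla_0\oplus t\nabla_0^\perp)+r\,(g_1\oplus \mathrm{id})^*(t\nabla_0\oplus t\nabla_0^\perp)\big),$$ where the two families of connections are regarded as connections over $M\times[0,1]^2$ without components in the directions of $r,t$, and the index is the orientation of the square: the first integral sends $dt\wedge dr\wedge\beta$, the second $dr\wedge dt\wedge\beta$, to $\int_0^1\!\int_0^1\beta\,dr\,dt$. Then $h_*(P_t)$ is a smooth map from $M$ to $U$, with values in $U_p^q$; $\eta_{P_t}$ is a smooth real differential form of even degree on $M$; and $$d\,\eta_{P_t}=\int_{S^1}Ch(P_t)-Ch(h_*(P_t)).$$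 In particular $\int_{S^1}Ch(P_t)$ and $Ch(h_*(P_t))$ differ by an exact form. -/

import Mathlib

open Set Filter MeasureTheory
open scoped Topology Manifold ContDiff

noncomputable section

namespace HolChern

/-! ### Differential forms on manifolds (possibly with boundary and corners) -/

section Forms

variable {E : Type*} [NormedAddCommGroup E] [NormedSpace ℝ E]
  {F : Type*} [NormedAddCommGroup F] [NormedSpace ℝ F]
  {H : Type*} [TopologicalSpace H] {N : Type*}

/-- `F`-valued differential forms of degree `k` (no regularity imposed) on a manifold `N` modelled
on `E`; the tangent space `TangentSpace I x` of Mathlib is `E` for every `x`. -/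
abbrev DForm (E : Type*) [NormedAddCommGroup E] [NormedSpace ℝ E] (N : Type*) (k : ℕ)
    (F : Type*) [NormedAddCommGroup F] [NormedSpace ℝ F] : Type _ :=
  N → E [⋀^Fin k]→L[ℝ] F

variable [TopologicalSpace N] [ChartedSpace H N]

/-- The form `θ` in the chart at `x₀`: its pullback along the inverse of the extended chart. -/
def inChart (I : ModelWithCorners ℝ E H) {k : ℕ} (θ : DForm E N k F) (x₀ : N) :
    E → E [⋀^Fin k]→L[ℝ] F := fun y =>
  (θ ((extChartAt I x₀).symm y)).compContinuousLinearMap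
    (mfderivWithin 𝓘(ℝ, E) I (extChartAt I x₀).symm (range I) y : E →L[ℝ] E)

/-- Smoothness of a form: its expression in every chart is `C^∞` (up to the boundary). -/
def SmoothForm (I : ModelWithCorners ℝ E H) {k : ℕ} (θ : DForm E N k F) : Prop :=
  ∀ x₀ : N, ContDiffOn ℝ ∞ (inChart I θ x₀) (extChartAt I x₀).target

/-- The exterior derivative, computed at `x` in the chart at `x`. -/
def extD (I : ModelWithCorners ℝ E H) {k : ℕ} (θ : DForm E N k F) : DForm E N (k + 1) F := fun x =>
  (extDerivWithin (inChart I θ x) (range I) (extChartAt I x x)).compContinuousLinearMap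
    (mfderiv I 𝓘(ℝ, E) (extChartAt I x) x : E →L[ℝ] E)

/-- The differential of a vector-valued function, as a family of linear maps. -/
def dFun (I : ModelWithCorners ℝ E H) (f : N → F) (x : N) : E →L[ℝ] F :=
  mfderiv I 𝓘(ℝ, F) f x

/-- A linear map seen as an alternating map of degree one. -/
def oneForm (T : E →L[ℝ] F) : E [⋀^Fin 1]→L[ℝ] F :=
  ContinuousAlternatingMap.ofSubsingleton ℝ E F (0 : Fin 1) T

end Forms

/-! ### Products of forms with values in an algebra -/

section Wedge

variable {E : Type*} [NormedAddCommGroup E] [NormedSpace ℝ E]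
  {A : Type*} [NormedRing A] [NormedAlgebra ℝ A]

/-- `(v₁, …, v_{k+l}) ↦ α(v₁, …, v_k) β(v_{k+1}, …, v_{k+l})`. -/
def tensorMul {k l : ℕ} (α : E [⋀^Fin k]→L[ℝ] A) (β : E [⋀^Fin l]→L[ℝ] A) :
    ContinuousMultilinearMap ℝ (fun _ : Fin (k + l) => E) A where
  toMultilinearMap := (LinearMap.mul' ℝ A).compMultilinearMap
    ((α.toMultilinearMap.domCoprod β.toMultilinearMap).domDomCongr finSumFinEquiv)
  cont := by
    have h : Continuous fun v : Fin (k + l) → E =>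
        α (fun i => v (finSumFinEquiv (Sum.inl i))) *
          β (fun i => v (finSumFinEquiv (Sum.inr i))) :=
      (α.cont.comp (by fun_prop)).mul (β.cont.comp (by fun_prop))
    exact h

theorem tensorMul_apply {k l : ℕ} (α : E [⋀^Fin k]→L[ℝ] A) (β : E [⋀^Fin l]→L[ℝ] A)
    (v : Fin (k + l) → E) :
    tensorMul α β v = α (fun i => v (Fin.castAdd l i)) * β (fun i => v (Fin.natAdd k i)) := rfl

/-- The wedge product `α ∧ β = (1 / (k! l!)) ∑_σ sgn(σ) σ(α ⊗ β)` of `A`-valued forms; for one-forms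
`(α ∧ β)(v, w) = α(v) β(w) - α(w) β(v)`. -/
def wedge {k l : ℕ} (α : E [⋀^Fin k]→L[ℝ] A) (β : E [⋀^Fin l]→L[ℝ] A) :
    E [⋀^Fin (k + l)]→L[ℝ] A :=
  ((k.factorial * l.factorial : ℝ)⁻¹) • ContinuousMultilinearMap.alternatization (tensorMul α β)

/-- The `n`-th wedge power of a two-form. -/
def wpow (R : E [⋀^Fin 2]→L[ℝ] A) : (n : ℕ) → E [⋀^Fin (2 * n)]→L[ℝ] A
  | 0 => haveI : IsEmpty (Fin (2 * 0)) := inferInstanceAs (IsEmpty (Fin 0))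
    ContinuousAlternatingMap.constOfIsEmpty ℝ E (Fin (2 * 0)) 1
  | n + 1 => wedge (wpow R n) R

/-- Left multiplication of an `A`-valued linear map by an element of `A`. -/
def lmul (a : A) (T : E →L[ℝ] A) : E →L[ℝ] A := (ContinuousLinearMap.mul ℝ A a).comp T

/-- Right multiplication of an `A`-valued linear map by an element of `A`. -/
def rmul (T : E →L[ℝ] A) (a : A) : E →L[ℝ] A := ((ContinuousLinearMap.mul ℝ A).flip a).comp T

/-- The curvature `dC + C ∧ C` of the connection `d + C` on a trivial bundle. -/
def curvature {H : Type*} [TopologicalSpace H] {N : Type*} [TopologicalSpace N] [ChartedSpace H N]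
    (I : ModelWithCorners ℝ E H) (C : DForm E N 1 A) : DForm E N 2 A :=
  fun x => extD I C x + wedge (C x) (C x)

end Wedge

/-! ### The stable spaces `U` and `BU × ℤ` -/

/-- The space `ℂ^ℤ_cpt` with basis `e_i`, `i ∈ ℤ`. -/
abbrev CZ : Type := ℤ →₀ ℂ

/-- Linear operators on `ℂ^ℤ_cpt`. -/
abbrev Op : Type := Module.End ℂ CZ

/-- The basis vector `e_i`. -/
def basisVec (i : ℤ) : CZ := Finsupp.single i 1

/-- The matrix entries of an operator. -/
def entry (T : Op) (i j : ℤ) : ℂ := T (basisVec j) i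

/-- The inner product with `⟨e_i, e_j⟩ = δ_ij`. -/
def ip (x y : CZ) : ℂ := x.sum fun i a => (starRingEnd ℂ) a * y i

/-- The subspace spanned by the `e_i` with `i < q`. -/
def below (q : ℤ) : Submodule ℂ CZ := Submodule.span ℂ (basisVec '' Iio q)

/-- The orthogonal projection `I_k` onto the span of the `e_i` with `i < k`. -/
def stdProj (k : ℤ) : Op :=
  Finsupp.linearCombination ℂ fun i : ℤ => if i < k then basisVec i else 0

/-- `BU × ℤ`: Hermitian operators with spectrum in `{0, 1}` that differ from `I_0` by an operator of
finite rank. -/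
def BUZ : Set Op :=
  {P | (∀ x y, ip (P x) y = ip x (P y)) ∧ spectrum ℂ P ⊆ {0, 1} ∧
    FiniteDimensional ℂ (LinearMap.range (P - stdProj 0))}

/-- `(BU × ℤ)_p^q`: those `P` whose image lies between the span of the `e_i`, `i < p`, and the span of
the `e_i`, `i < q`. -/
def BUZWindow (p q : ℤ) : Set Op :=
  {P | P ∈ BUZ ∧ below p ≤ LinearMap.range P ∧ LinearMap.range P ≤ below q}

/-- The stable unitary group: unitary operators that differ from the identity by an operator of
finite rank. -/
def StableU : Set Op :=
  {A | Function.Bijective A ∧ (∀ x y, ip (A x) (A y) = ip x y) ∧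
    FiniteDimensional ℂ (LinearMap.range (A - 1))}

/-- `U_p^q`: unitary operators of the span of the `e_i`, `p ≤ i < q`, extended by the identity. -/
def UWindow (p q : ℤ) : Set Op :=
  {A | A ∈ StableU ∧ ∀ i, i ∉ Ico p q → A (basisVec i) = basisVec i}

section Smooth

variable {E : Type*} [NormedAddCommGroup E] [NormedSpace ℝ E] {H : Type*} [TopologicalSpace H]
  {N : Type*} [TopologicalSpace N] [ChartedSpace H N]

/-- Smooth maps into `BU × ℤ`: locally they are smooth maps into some finite stage
`(BU × ℤ)_{-n}^n`. -/
def SmoothBUZ (I : ModelWithCorners ℝ E H) (f : N → Op) : Prop :=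
  (∀ x, f x ∈ BUZ) ∧ (∀ x, ∃ n : ℕ, ∀ᶠ y in 𝓝 x, f y ∈ BUZWindow (-n) n) ∧
    ∀ i j, ContMDiff I 𝓘(ℝ, ℂ) ∞ fun x => entry (f x) i j

/-- Smooth maps into `U`: locally they are smooth maps into some finite stage `U_{-n}^n`. -/
def SmoothU (I : ModelWithCorners ℝ E H) (f : N → Op) : Prop :=
  (∀ x, f x ∈ StableU) ∧ (∀ x, ∃ n : ℕ, ∀ᶠ y in 𝓝 x, f y ∈ UWindow (-n) n) ∧
    ∀ i j, ContMDiff I 𝓘(ℝ, ℂ) ∞ fun x => entry (f x) i j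

end Smooth

/-! ### Chern forms -/

/-- Operators on the span of the `e_i`, `p ≤ i < q`, as matrices; they form a finite-dimensional
normed algebra (the choice of the norm plays no role). -/
def Mat (p q : ℤ) : Type := Matrix (Finset.Ico p q) (Finset.Ico p q) ℂ

open scoped Matrix.Norms.Operator in
instance (p q : ℤ) : NormedRing (Mat p q) :=
  (inferInstance : NormedRing (Matrix (Finset.Ico p q) (Finset.Ico p q) ℂ))

open scoped Matrix.Norms.Operator in
instance (p q : ℤ) : NormedAlgebra ℝ (Mat p q) :=
  (inferInstance : NormedAlgebra ℝ (Matrix (Finset.Ico p q) (Finset.Ico p q) ℂ))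

instance (p q : ℤ) : FiniteDimensional ℝ (Mat p q) := by
  have h : Module.Finite ℝ (Matrix (Finset.Ico p q) (Finset.Ico p q) ℂ) := inferInstance
  exact h

/-- The adjoint (conjugate transpose). -/
def Mat.adj {p q : ℤ} (m : Mat p q) : Mat p q := Matrix.conjTranspose m

/-- The inverse matrix. -/
def Mat.inv {p q : ℤ} (m : Mat p q) : Mat p q :=
  (Inv.inv (m : Matrix (Finset.Ico p q) (Finset.Ico p q) ℂ) :
    Matrix (Finset.Ico p q) (Finset.Ico p q) ℂ)

/-- The compression of an operator to the span of the `e_i`, `p ≤ i < q`. -/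
def block (p q : ℤ) (T : Op) : Mat p q :=
  (Matrix.of fun i j => entry T i j : Matrix (Finset.Ico p q) (Finset.Ico p q) ℂ)

/-- The trace, as a continuous linear map. -/
def trL (p q : ℤ) : Mat p q →L[ℝ] ℂ :=
  LinearMap.toContinuousLinearMap
    { toFun := fun m : Mat p q => ∑ i, m i i
      map_add' := fun a b => (Matrix.traceLinearMap (Finset.Ico p q) ℝ ℂ).map_add a b
      map_smul' := fun c a => (Matrix.traceLinearMap (Finset.Ico p q) ℝ ℂ).map_smul c a }

section Chern

variable {E : Type*} [NormedAddCommGroup E] [NormedSpace ℝ E] {H : Type*} [TopologicalSpace H]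
  {N : Type*} [TopologicalSpace N] [ChartedSpace H N]

/-- The scalar form `Tr (Q θ)`. -/
def traceForm {p q : ℤ} {k : ℕ} (Q : Mat p q) (θ : E [⋀^Fin k]→L[ℝ] Mat p q) :
    E [⋀^Fin k]→L[ℝ] ℂ :=
  ((trL p q).comp (ContinuousLinearMap.mul ℝ (Mat p q) Q)).compContinuousAlternatingMap θ

/-- The component of degree `2n` of `Ch(P) = Tr ∑ (1 / (2πi)^n) (1 / n!) P (dP)^{2n}`, for a map `P`
into `(BU × ℤ)_p^q`; in degree `0` this is the rank `p + dim (Im P / span {e_i | i < p})`. -/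
def chernEven (I : ModelWithCorners ℝ E H) (p q : ℤ) (P : N → Op) : (n : ℕ) → DForm E N (2 * n) ℂ
  | 0 => fun x => haveI : IsEmpty (Fin (2 * 0)) := inferInstanceAs (IsEmpty (Fin 0))
    ContinuousAlternatingMap.constOfIsEmpty ℝ E (Fin (2 * 0)) ((p : ℂ) + trL p q (block p q (P x)))
  | n + 1 => fun x =>
    let dP : E [⋀^Fin 1]→L[ℝ] Mat p q := oneForm (dFun I (fun y => block p q (P y)) x)
    (((2 * Real.pi * Complex.I) ^ (n + 1) * ((n + 1).factorial : ℂ))⁻¹ : ℂ) •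
      traceForm (block p q (P x)) (wpow (wedge dP dP) (n + 1))

/-- The component of degree `2n+1` of
`Ch(u) = Tr ∑ ((-1)^n / (2πi)^{n+1}) (n! / (2n+1)!) (u⁻¹ du)^{2n+1}`, for a map `u` into `U_p^q`. -/
def chernOdd (I : ModelWithCorners ℝ E H) (p q : ℤ) (u : N → Op) (n : ℕ) :
    DForm E N (2 * n + 1) ℂ := fun x =>
  let θ : E [⋀^Fin 1]→L[ℝ] Mat p q :=
    oneForm (lmul (block p q (u x)).inv (dFun I (fun y => block p q (u y)) x))
  ((-1) ^ n / (2 * Real.pi * Complex.I) ^ (n + 1) *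
      ((n.factorial : ℂ) / ((2 * n + 1).factorial : ℂ)) : ℂ) •
    traceForm 1 (wedge (wpow (wedge θ θ) n) θ)

/-- The component of degree `2n` of the Chern form `Tr exp (R / 2πi)` of the connection that `d + C`
induces on the sub-bundle `Im Q`, where `Q` is a field of projections and `d + C` preserves
`Im Q` and `Ker Q`: the curvature on `Im Q` is then the restriction of the curvature `R` of `d + C`. -/
def chernConn (I : ModelWithCorners ℝ E H) {p q : ℤ} (Q : N → Mat p q) (C : DForm E N 1 (Mat p q))
    (n : ℕ) : DForm E N (2 * n) ℂ := fun x =>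
  (((2 * Real.pi * Complex.I) ^ n * (n.factorial : ℂ))⁻¹ : ℂ) •
    traceForm (Q x) (wpow (curvature I C x) n)

end Chern

/-! ### Integration over the fibre -/

section Integration

variable {E : Type*} [NormedAddCommGroup E] [NormedSpace ℝ E] {M : Type*}

/-- The point `e^{2πit}` of the circle. -/
def circlePt (t : ℝ) : Circle := Circle.exp (2 * Real.pi * t)

/-- The velocity of `t ↦ e^{2πit}`. -/
def circleVel (t : ℝ) : EuclideanSpace ℝ (Fin 1) := mfderiv 𝓘(ℝ, ℝ) (𝓡 1) circlePt t (1 : ℝ)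

/-- Integration over the fibre of `M × S¹ → M`, with `∫_{S¹} dt ∧ β = ∫₀¹ β dt`. -/
def circleInt {k : ℕ} (α : DForm (E × EuclideanSpace ℝ (Fin 1)) (M × Circle) (k + 1) ℂ) :
    DForm E M k ℂ := fun x =>
  ∫ t in (0 : ℝ)..1, ((α (x, circlePt t)).curryLeft (0, circleVel t)).compContinuousLinearMap
    (ContinuousLinearMap.inl ℝ E (EuclideanSpace ℝ (Fin 1)))

/-- Integration over the square of a form on `M × ℝ²` with coordinates `(r, t)` on `ℝ²`, with
`∬ dt ∧ dr ∧ β = ∫₀¹ ∫₀¹ β dr dt`. -/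
def squareInt {k : ℕ} (α : DForm (E × (ℝ × ℝ)) (M × (ℝ × ℝ)) (k + 2) ℂ) :
    DForm E M k ℂ := fun x =>
  ∫ t in (0 : ℝ)..1, ∫ r in (0 : ℝ)..1,
    (((α (x, (r, t))).curryLeft (0, (0, 1))).curryLeft (0, (1, 0))).compContinuousLinearMap
      (ContinuousLinearMap.inl ℝ E (ℝ × ℝ))

end Integration

/-! ### Parallel transport and holonomy -/

/-- `g` is the parallel transport along a path of projections `γ`, for the connection `γ ∘ d` on the
bundle with fibres `E_t = Im γ(t)`; `g t` maps `E_0` to `E_t` and is extended by zero on the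
orthogonal complement of `E_0`. The sections `t ↦ g t v` satisfy `γ(t) (d/dt) (g t v) = 0`. -/
structure IsParallelTransport (γ g : ℝ → Op) : Prop where
  start : g 0 = γ 0
  mem : ∀ t, γ t * g t = g t
  parallel : ∃ g' : ℝ → Op,
    (∀ t i j, HasDerivAt (fun s => entry (g s) i j) (entry (g' t) i j) t) ∧ ∀ t, γ t * g' t = 0

/-- The parallel transport along a path of projections (which is unique). -/
def parallelTransport (γ : ℝ → Op) : ℝ → Op := Classical.epsilon (IsParallelTransport γ)

section Holonomy

variable {M : Type*}

/-- The parallel transport `g_t` in the direction of `S¹`, from the fibre over `(x, 1)` to the fibre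
over `(x, e^{2πit})`. -/
def transport (P : M × Circle → Op) (x : M) : ℝ → Op :=
  parallelTransport fun t => P (x, circlePt t)

/-- The holonomy map `h_*(P) = hol_{S¹}(∇_P) ⊕ id`. -/
def hStar (P : M × Circle → Op) (x : M) : Op := transport P x 1 + (1 - P (x, 1))

variable {E : Type*} [NormedAddCommGroup E] [NormedSpace ℝ E] {H : Type*} [TopologicalSpace H]
  [TopologicalSpace M] [ChartedSpace H M]

/-- The projection onto the fibre at `t = 0` of the bundle. -/
def P₀ (p q : ℤ) (P : M × Circle → Op) (x : M) : Mat p q := block p q (P (x, 1))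

/-- The connection form of `∇_0^⊥ = P₀^⊥ ∘ d` on `Im P₀^⊥`, where `P₀^⊥ = 1 - P₀`:
`P₀^⊥ d(P₀^⊥ s) = P₀^⊥ ds + P₀^⊥ (dP₀^⊥) s`. -/
def perpForm (I : ModelWithCorners ℝ E H) (p q : ℤ) (P : M × Circle → Op) (x : M) :
    E →L[ℝ] Mat p q :=
  lmul (1 - P₀ p q P x) (dFun I (fun y => 1 - P₀ p q P y) x)

/-- The connection form of `∇_0 ⊕ ∇_0^⊥` with respect to `d`. -/
def sumForm (I : ModelWithCorners ℝ E H) (p q : ℤ) (P : M × Circle → Op) (x : M) :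
    E →L[ℝ] Mat p q :=
  lmul (P₀ p q P x) (dFun I (P₀ p q P) x) + perpForm I p q P x

/-- The connection form of `g_t^*∇_t ⊕ ∇_0^⊥`. On `Im P₀` the connection is
`s ↦ g_t⁻¹ (P_t d(g_t s)) = P₀ ds + g_t⁻¹ P_t (dg_t) s`. Since `g_t` maps `Im P₀` unitarily onto
`Im P_t` and is zero on the complement, its inverse, extended by zero, is the adjoint. -/
def pullForm (I : ModelWithCorners ℝ E H) (p q : ℤ) (P : M × Circle → Op) (t : ℝ) (x : M) :
    E →L[ℝ] Mat p q :=
  lmul ((block p q (transport P x t)).adj * block p q (P (x, circlePt t)))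
    (dFun I (fun y => block p q (transport P y t)) x) + perpForm I p q P x

/-- The first square: `((1 - r) ∇_0 + r g_t^*∇_t) ⊕ ∇_0^⊥` over `M × ℝ²`, with coordinates
`(r, t)` on `ℝ²`. -/
def squareOne (I : ModelWithCorners ℝ E H) (p q : ℤ) (P : M × Circle → Op) :
    DForm (E × (ℝ × ℝ)) (M × (ℝ × ℝ)) 1 (Mat p q) := fun z =>
  oneForm (((1 - z.2.1) • sumForm I p q P z.1 + z.2.1 • pullForm I p q P z.2.2 z.1).comp
    (ContinuousLinearMap.fst ℝ E (ℝ × ℝ)))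

/-- The second square:
`(1 - r) (t∇_0 ⊕ t∇_0^⊥) + r (g_1 ⊕ id)^*(t∇_0 ⊕ t∇_0^⊥)` over `M × ℝ²`, where
`t∇_0 ⊕ t∇_0^⊥` has connection form `t` times that of `∇_0 ⊕ ∇_0^⊥`, and
`h^*(d + C) = d + h⁻¹ dh + h⁻¹ C h`. -/
def squareTwo (I : ModelWithCorners ℝ E H) (p q : ℤ) (P : M × Circle → Op) :
    DForm (E × (ℝ × ℝ)) (M × (ℝ × ℝ)) 1 (Mat p q) := fun z =>
  let h : M → Mat p q := fun y => block p q (hStar P y)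
  let C : E →L[ℝ] Mat p q := z.2.2 • sumForm I p q P z.1
  oneForm (((1 - z.2.1) • C +
      z.2.1 • (lmul (h z.1).inv (dFun I h z.1) + rmul (lmul (h z.1).inv C) (h z.1))).comp
    (ContinuousLinearMap.fst ℝ E (ℝ × ℝ)))

/-- The component of degree `2n` of the form `η_P`: the integrals over the two squares of the Chern
forms of the two families of connections. The squares carry opposite orientations: the first is
oriented by `dt ∧ dr` and the second by `dr ∧ dt` (it is drawn with `t` decreasing from left to right),
whence the minus sign. The bundle is `Im P₀` for the first and the trivial bundle for the second. -/
def eta (I : ModelWithCorners ℝ E H) (p q : ℤ) (P : M × Circle → Op) (n : ℕ) :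
    DForm E M (2 * n) ℂ :=
  squareInt (k := 2 * n) (chernConn (I.prod 𝓘(ℝ, ℝ × ℝ)) (fun z => P₀ p q P z.1)
      (squareOne I p q P) (n + 1)) -
    squareInt (k := 2 * n) (chernConn (I.prod 𝓘(ℝ, ℝ × ℝ)) (fun _ => 1)
      (squareTwo I p q P) (n + 1))

end Holonomy

end HolChern

end

noncomputable section

set_option linter.unusedSectionVars false

namespace HolChern

/-! ### Forms evaluated on lists of vectors

A form of mixed degree is represented by its values on all finite lists of vectors; the wedge
product is then determined by the rule that contractions are antiderivations. -/

/-- A (not necessarily alternating) form of mixed degree, evaluated on lists of vectors. -/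
structure LForm (V A : Type*) where
  /-- The value on a list of vectors. -/
  toFun : List V → A

namespace LForm

variable {V W A B : Type*}

instance : CoeFun (LForm V A) fun _ => List V → A := ⟨toFun⟩

theorem toFun_injective : Function.Injective (toFun : LForm V A → List V → A) := by
  rintro ⟨f⟩ ⟨g⟩ h; simpa using h

@[ext] theorem ext {f g : LForm V A} (h : ∀ l, f l = g l) : f = g :=
  toFun_injective (funext h)

/-- Contraction with a vector, in the first slot. -/
def contr (v : V) (f : LForm V A) : LForm V A := ⟨fun l => f (v :: l)⟩

@[simp] theorem contr_apply (v : V) (f : LForm V A) (l : List V) : contr v f l = f (v :: l) := rfl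

/-- Pullback along a map of vectors. -/
def pull (j : W → V) (f : LForm V A) : LForm W A := ⟨fun l => f (l.map j)⟩

@[simp] theorem pull_apply (j : W → V) (f : LForm V A) (l : List W) : pull j f l = f (l.map j) := rfl
@[simp] theorem contr_pull (j : W → V) (f : LForm V A) (w : W) :
    contr w (pull j f) = pull j (contr (j w) f) := rfl

section AddGroup
variable [AddCommGroup A]

instance : Zero (LForm V A) := ⟨⟨0⟩⟩
instance : Add (LForm V A) := ⟨fun f g => ⟨f.toFun + g.toFun⟩⟩
instance : Neg (LForm V A) := ⟨fun f => ⟨-f.toFun⟩⟩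
instance : Sub (LForm V A) := ⟨fun f g => ⟨f.toFun - g.toFun⟩⟩
instance : SMul ℕ (LForm V A) := ⟨fun n f => ⟨n • f.toFun⟩⟩
instance : SMul ℤ (LForm V A) := ⟨fun n f => ⟨n • f.toFun⟩⟩

instance : AddCommGroup (LForm V A) :=
  toFun_injective.addCommGroup toFun rfl (fun _ _ => rfl) (fun _ => rfl) (fun _ _ => rfl)
    (fun _ _ => rfl) (fun _ _ => rfl)

@[simp] theorem add_apply (f g : LForm V A) (l : List V) : (f + g) l = f l + g l := rfl
@[simp] theorem sub_apply (f g : LForm V A) (l : List V) : (f - g) l = f l - g l := rfl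
@[simp] theorem neg_apply (f : LForm V A) (l : List V) : (-f) l = -f l := rfl
@[simp] theorem zsmul_apply (n : ℤ) (f : LForm V A) (l : List V) : (n • f) l = n • f l := rfl
@[simp] theorem zero_apply (l : List V) : (0 : LForm V A) l = 0 := rfl

@[simp] theorem contr_add (v : V) (f g : LForm V A) : contr v (f + g) = contr v f + contr v g := rfl
@[simp] theorem contr_sub (v : V) (f g : LForm V A) : contr v (f - g) = contr v f - contr v g := rfl
@[simp] theorem contr_neg (v : V) (f : LForm V A) : contr v (-f) = -contr v f := rfl
@[simp] theorem contr_zero (v : V) : contr v (0 : LForm V A) = 0 := rfl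

/-- The grading involution: the sign `(-1)^k` in degree `k`. -/
def sgn (f : LForm V A) : LForm V A := ⟨fun l => (-1 : ℤ) ^ l.length • f l⟩

theorem sgn_apply (f : LForm V A) (l : List V) : sgn f l = (-1 : ℤ) ^ l.length • f l := rfl
@[simp] theorem sgn_nil (f : LForm V A) : sgn f [] = f [] := by simp [sgn]
@[simp] theorem sgn_add (f g : LForm V A) : sgn (f + g) = sgn f + sgn g := by
  ext l; simp [sgn]
@[simp] theorem sgn_sub (f g : LForm V A) : sgn (f - g) = sgn f - sgn g := by
  ext l; simp [sgn, smul_sub]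
@[simp] theorem sgn_neg (f : LForm V A) : sgn (-f) = -sgn f := by
  ext l; simp [sgn]
@[simp] theorem sgn_zero : sgn (0 : LForm V A) = 0 := by
  ext l; simp [sgn]
@[simp] theorem sgn_sgn (f : LForm V A) : sgn (sgn f) = f := by
  ext l; simp [sgn, smul_smul, ← mul_pow]
@[simp] theorem contr_sgn (v : V) (f : LForm V A) : contr v (sgn f) = -sgn (contr v f) := by
  ext l; simp [sgn, pow_succ]

@[simp] theorem pull_sgn (j : W → V) (f : LForm V A) : pull j (sgn f) = sgn (pull j f) := by
  ext l; simp [sgn]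

/-- Application of an additive map to the values. -/
def mapVal [AddCommGroup B] (τ : A →+ B) (f : LForm V A) : LForm V B := ⟨fun l => τ (f l)⟩

@[simp] theorem mapVal_apply [AddCommGroup B] (τ : A →+ B) (f : LForm V A) (l : List V) :
    mapVal τ f l = τ (f l) := rfl
@[simp] theorem mapVal_add [AddCommGroup B] (τ : A →+ B) (f g : LForm V A) :
    mapVal τ (f + g) = mapVal τ f + mapVal τ g := by ext l; simp
@[simp] theorem mapVal_sub [AddCommGroup B] (τ : A →+ B) (f g : LForm V A) :
    mapVal τ (f - g) = mapVal τ f - mapVal τ g := by ext l; simp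
theorem contr_mapVal [AddCommGroup B] (τ : A →+ B) (v : V) (f : LForm V A) :
    contr v (mapVal τ f) = mapVal τ (contr v f) := rfl

end AddGroup

section Ring
variable [Ring A]

/-- The wedge product. -/
def mulAux : LForm V A → LForm V A → List V → A
  | f, g, [] => f [] * g []
  | f, g, v :: l => mulAux (contr v f) g l + mulAux (sgn f) (contr v g) l

instance : Mul (LForm V A) := ⟨fun f g => ⟨mulAux f g⟩⟩

@[simp] theorem mul_nil (f g : LForm V A) : (f * g) [] = f [] * g [] := rfl
theorem mul_cons (f g : LForm V A) (v : V) (l : List V) :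
    (f * g) (v :: l) = (contr v f * g) l + (sgn f * contr v g) l := rfl
@[simp] theorem contr_mul (v : V) (f g : LForm V A) :
    contr v (f * g) = contr v f * g + sgn f * contr v g := rfl

/-- The form of degree zero with a given value. -/
def const (a : A) : LForm V A where
  toFun
  | [] => a
  | _ :: _ => 0

@[simp] theorem const_nil (a : A) : (const a : LForm V A) [] = a := rfl
@[simp] theorem const_cons (a : A) (v : V) (l : List V) : (const a : LForm V A) (v :: l) = 0 := rfl
@[simp] theorem contr_const (a : A) (v : V) : contr v (const a : LForm V A) = 0 := rfl
@[simp] theorem sgn_const (a : A) : sgn (const a : LForm V A) = const a := by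
  ext (_ | ⟨v, l⟩) <;> simp [sgn]

instance : One (LForm V A) := ⟨const 1⟩

theorem one_def : (1 : LForm V A) = const 1 := rfl
@[simp] theorem contr_one (v : V) : contr v (1 : LForm V A) = 0 := rfl
@[simp] theorem sgn_one : sgn (1 : LForm V A) = 1 := sgn_const 1
@[simp] theorem one_nil : (1 : LForm V A) [] = 1 := rfl

protected theorem zero_mul' (g : LForm V A) : 0 * g = 0 := by
  ext l
  induction l generalizing g with
  | nil => simp
  | cons v l ih => rw [mul_cons, contr_zero, sgn_zero, ih, ih]; simp

protected theorem mul_zero' (f : LForm V A) : f * 0 = 0 := by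
  ext l
  induction l generalizing f with
  | nil => simp
  | cons v l ih => rw [mul_cons, contr_zero, ih, ih]; simp

protected theorem add_mul' (f g h : LForm V A) : (f + g) * h = f * h + g * h := by
  ext l
  induction l generalizing f g h with
  | nil => simp [add_mul]
  | cons v l ih =>
    simp only [mul_cons, contr_add, sgn_add, add_apply, ih]; abel

protected theorem mul_add' (f g h : LForm V A) : f * (g + h) = f * g + f * h := by
  ext l
  induction l generalizing f g h with
  | nil => simp [mul_add]
  | cons v l ih =>
    simp only [mul_cons, contr_add, add_apply, ih]; abel

protected theorem neg_mul' (f g : LForm V A) : -f * g = -(f * g) := by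
  rw [eq_neg_iff_add_eq_zero, ← LForm.add_mul', neg_add_cancel, LForm.zero_mul']

protected theorem mul_neg' (f g : LForm V A) : f * -g = -(f * g) := by
  rw [eq_neg_iff_add_eq_zero, ← LForm.mul_add', neg_add_cancel, LForm.mul_zero']

@[simp] theorem sgn_mul (f g : LForm V A) : sgn (f * g) = sgn f * sgn g := by
  ext l
  induction l generalizing f g with
  | nil => simp
  | cons v l ih =>
    have h : sgn (f * g) (v :: l) = -(sgn (contr v (f * g)) l) := by
      rw [← contr_apply, contr_sgn]; rfl
    rw [h, contr_mul, sgn_add, add_apply, ih, ih, mul_cons, contr_sgn, contr_sgn,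
      LForm.neg_mul', LForm.mul_neg', neg_apply, neg_apply]
    abel

protected theorem mul_assoc' (f g h : LForm V A) : f * g * h = f * (g * h) := by
  ext l
  induction l generalizing f g h with
  | nil => simp [mul_assoc]
  | cons v l ih =>
    simp only [mul_cons, contr_mul, sgn_mul, LForm.add_mul', LForm.mul_add', add_apply, ih]; abel

protected theorem const_mul (a : A) (g : LForm V A) (l : List V) : ((const a : LForm V A) * g) l = a * g l := by
  induction l generalizing g with
  | nil => simp
  | cons v l ih => rw [mul_cons, contr_const, LForm.zero_mul', sgn_const, ih]; simp

protected theorem mul_const (f : LForm V A) (a : A) (l : List V) : (f * (const a : LForm V A)) l = f l * a := by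
  induction l generalizing f with
  | nil => simp
  | cons v l ih => rw [mul_cons, contr_const, LForm.mul_zero', ih]; simp

instance : Ring (LForm V A) where
  __ := (inferInstance : AddCommGroup (LForm V A))
  mul := (· * ·)
  one := 1
  left_distrib := LForm.mul_add'
  right_distrib := LForm.add_mul'
  zero_mul := LForm.zero_mul'
  mul_zero := LForm.mul_zero'
  mul_assoc := LForm.mul_assoc'
  one_mul f := by ext l; rw [one_def, LForm.const_mul, one_mul]
  mul_one f := by ext l; rw [one_def, LForm.mul_const, mul_one]

@[simp] theorem pull_mul (j : W → V) (f g : LForm V A) : pull j (f * g) = pull j f * pull j g := by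
  ext l
  induction l generalizing f g with
  | nil => simp
  | cons w l ih =>
    rw [mul_cons, contr_pull, contr_pull, ← pull_sgn, ← ih, ← ih]; rfl

@[simp] theorem pull_const (j : W → V) (a : A) : pull j (const a : LForm V A) = const a := by
  ext (_ | ⟨v, l⟩) <;> simp

theorem pull_pow (j : W → V) (f : LForm V A) (n : ℕ) : pull j (f ^ n) = pull j f ^ n := by
  induction n with
  | zero => exact pull_const j 1
  | succ n ih => rw [pow_succ, pull_mul, ih, pow_succ]

/-- The trace of a product is cyclic, up to the sign of the degrees. -/
theorem mapVal_mul_comm_aux [AddCommGroup B] (τ : A →+ B) (hτ : ∀ a b, τ (a * b) = τ (b * a))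
    (f g : LForm V A) :
    (sgn f = f → mapVal τ (f * g) = mapVal τ (g * f)) ∧
      (sgn f = -f → mapVal τ (f * g) = mapVal τ (sgn g * f)) := by
  suffices h : ∀ (l : List V) (f g : LForm V A),
      (sgn f = f → mapVal τ (f * g) l = mapVal τ (g * f) l) ∧
      (sgn f = -f → mapVal τ (f * g) l = mapVal τ (sgn g * f) l) from
    ⟨fun hf => LForm.ext fun l => (h l f g).1 hf, fun hf => LForm.ext fun l => (h l f g).2 hf⟩
  intro l
  induction l with
  | nil => exact fun f g => ⟨fun _ => hτ _ _, fun _ => by simpa using hτ _ _⟩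
  | cons v l ih =>
    intro f g
    constructor
    · intro hf
      have h1 : sgn (contr v f) = -contr v f := by
        rw [← neg_eq_iff_eq_neg, ← contr_sgn, hf]
      have e1 := (ih (contr v f) g).2 h1
      have e2 := (ih f (contr v g)).1 hf
      simp only [mapVal_apply] at e1 e2 ⊢
      rw [mul_cons, mul_cons, hf, map_add, map_add, e1, e2, add_comm]
    · intro hf
      have h1 : sgn (contr v f) = contr v f := by
        rw [← neg_inj, ← contr_sgn, hf, contr_neg]
      have e1 := (ih (contr v f) g).1 h1
      have e2 := (ih f (contr v g)).2 hf
      simp only [mapVal_apply] at e1 e2 ⊢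
      rw [mul_cons, mul_cons, hf, sgn_sgn, contr_sgn, neg_mul, neg_mul, neg_apply, neg_apply,
        map_add, map_add, map_neg, map_neg, e1, e2, add_comm]

theorem mapVal_mul_comm [AddCommGroup B] (τ : A →+ B) (hτ : ∀ a b, τ (a * b) = τ (b * a))
    {f : LForm V A} (hf : sgn f = f) (g : LForm V A) : mapVal τ (f * g) = mapVal τ (g * f) :=
  (mapVal_mul_comm_aux τ hτ f g).1 hf

section Star
variable [StarRing A]

/-- The adjoint of a form: `star (α (v₁, …, v_k))` with the sign `(-1)^{k (k - 1) / 2}` of the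
reversal of the arguments, defined recursively. -/
def adjAux : List V → LForm V A → A
  | [], f => star (f [])
  | v :: l, f => (-1 : ℤ) ^ l.length • adjAux l (contr v f)

instance : Star (LForm V A) := ⟨fun f => ⟨fun l => adjAux l f⟩⟩

@[simp] theorem star_nil (f : LForm V A) : (star f) [] = star (f []) := rfl
@[simp] theorem contr_star (v : V) (f : LForm V A) :
    contr v (star f) = sgn (star (contr v f)) := rfl
theorem star_cons (v : V) (f : LForm V A) (l : List V) :
    (star f) (v :: l) = sgn (star (contr v f)) l := rfl

theorem star_apply (f : LForm V A) (l : List V) :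
    (star f) l = (-1 : ℤ) ^ (l.length * (l.length - 1) / 2) • star (f l) := by
  induction l generalizing f with
  | nil => simp
  | cons v l ih =>
    rw [star_cons, sgn_apply, ih, contr_apply, smul_smul, ← pow_add]
    rw [List.length_cons, Nat.triangle_succ, add_comm]

@[simp] theorem star_sgn (f : LForm V A) : star (sgn f) = sgn (star f) := by
  ext l; simp only [star_apply, sgn_apply, star_smul, smul_smul]; simp [mul_comm]

protected theorem star_add' (f g : LForm V A) : star (f + g) = star f + star g := by
  ext l; simp [star_apply]

@[simp] theorem star_const (a : A) : star (const a : LForm V A) = const (star a) := by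
  ext (_ | ⟨v, l⟩) <;> simp [star_apply]

protected theorem star_mul' (f g : LForm V A) : star (f * g) = star g * star f := by
  ext l
  induction l generalizing f g with
  | nil => simp
  | cons v l ih =>
    rw [star_cons, contr_mul, LForm.star_add', sgn_add, add_apply, sgn_apply, ih, sgn_apply, ih,
      ← sgn_apply, ← sgn_apply, mul_cons, contr_star, contr_star, sgn_mul, sgn_mul, star_sgn,
      sgn_sgn, add_comm]

instance : StarRing (LForm V A) where
  star_involutive f := by
    ext l
    simp only [star_apply]
    rw [star_smul]
    simp [← mul_assoc, ← pow_add, ← two_mul]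
  star_mul := LForm.star_mul'
  star_add := LForm.star_add'

end Star

end Ring

end LForm

end HolChern

namespace HolChern

namespace LForm

section Alternate

variable {V A : Type*} [Ring A]

/-- The signed sum `∑ i, (-1)^i F(v_i)(v_0, …, v̂_i, …)`. -/
def deltaAux : List V → (V → LForm V A) → A
  | [], _ => 0
  | v :: l, F => F v l - deltaAux l fun w => contr v (F w)

/-- The signed sum `∑ i, (-1)^i F(v_i)(v_0, …, v̂_i, …)`. -/
def delta (F : V → LForm V A) : LForm V A := ⟨fun l => deltaAux l F⟩

@[simp] theorem delta_nil (F : V → LForm V A) : delta F [] = 0 := rfl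
@[simp] theorem contr_delta (v : V) (F : V → LForm V A) :
    contr v (delta F) = F v - delta fun w => contr v (F w) := rfl
theorem delta_cons (F : V → LForm V A) (v : V) (l : List V) :
    delta F (v :: l) = F v l - delta (fun w => contr v (F w)) l := rfl

theorem delta_add (F G : V → LForm V A) : delta (fun v => F v + G v) = delta F + delta G := by
  ext l
  induction l generalizing F G with
  | nil => simp
  | cons v l ih =>
    simp only [delta_cons, contr_add, add_apply, ih]; abel

theorem delta_neg (F : V → LForm V A) : delta (fun v => -F v) = -delta F := by
  ext l
  induction l generalizing F with
  | nil => simp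
  | cons v l ih => simp only [delta_cons, contr_neg, neg_apply, ih]; abel

theorem sgn_delta (F : V → LForm V A) : sgn (delta F) = -delta fun v => sgn (F v) := by
  ext l
  induction l generalizing F with
  | nil => simp
  | cons v l ih =>
    have h : sgn (delta F) (v :: l) = -sgn (contr v (delta F)) l := by
      rw [← contr_apply, contr_sgn, neg_apply]
    rw [h, contr_delta, sgn_sub, sub_apply, ih, neg_apply, neg_apply, delta_cons]
    simp only [contr_sgn, delta_neg, neg_apply]

theorem delta_mul_right (F : V → LForm V A) (g : LForm V A) :
    delta (fun v => F v * g) = delta F * g := by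
  ext l
  induction l generalizing F g with
  | nil => simp
  | cons v l ih =>
    rw [delta_cons, mul_cons, contr_delta, sub_mul, sgn_delta, neg_mul, sub_apply, neg_apply,
      ← ih, ← ih]
    simp only [contr_mul, delta_add, add_apply]
    abel

theorem delta_mul_left (f : LForm V A) (G : V → LForm V A) :
    delta (fun v => f * G v) = sgn f * delta G := by
  ext l
  induction l generalizing f G with
  | nil => simp
  | cons v l ih =>
    rw [delta_cons, mul_cons, contr_delta, mul_sub, contr_sgn, sub_apply, neg_mul, neg_apply,
      ← ih, sgn_sgn]
    simp only [contr_mul, delta_add, add_apply, ih, sgn_sgn]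
    abel

theorem delta_apply_ofFn (F : V → LForm V A) {n : ℕ} (v : Fin (n + 1) → V) :
    delta F (List.ofFn v) = ∑ i : Fin (n + 1), (-1 : ℤ) ^ (i : ℕ) • F (v i) (List.ofFn (i.removeNth v)) := by
  induction n generalizing F with
  | zero => simp [List.ofFn_succ, delta_cons]
  | succ n ih =>
    rw [List.ofFn_succ, delta_cons, ih, sub_eq_add_neg, ← Finset.sum_neg_distrib,
      Fin.sum_univ_succ (n := n + 1)]
    congr 1
    · rw [Fin.val_zero, pow_zero, one_smul]; rfl
    refine Finset.sum_congr rfl fun (i : Fin (n + 1)) _ => ?_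
    rw [Fin.val_succ, pow_succ, mul_neg_one, neg_smul, contr_apply]
    congr 3
    rw [List.ofFn_succ]
    simp [Fin.removeNth]
    rfl

end Alternate

end LForm

/-- Two forms concentrated in the same degree agree if they agree on tuples. -/
theorem LForm.ext_ofFn {V B : Type*} [AddCommGroup B] {f g : LForm V B} {k : ℕ}
    (hf : ∀ l : List V, l.length ≠ k → f l = 0) (hg : ∀ l : List V, l.length ≠ k → g l = 0)
    (h : ∀ v : Fin k → V, f (List.ofFn v) = g (List.ofFn v)) : f = g := by
  ext l
  by_cases hl : l.length = k
  · subst hl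
    simpa using h l.get
  · rw [hf l hl, hg l hl]

/-- The signed sum over all permutations, by the choice of the first argument. -/
theorem sum_perm_succ {V A : Type*} [AddCommGroup A] {n : ℕ} (F : (Fin (n + 1) → V) → A) (v : Fin (n + 1) → V) :
    ∑ σ : Equiv.Perm (Fin (n + 1)), Equiv.Perm.sign σ • F (fun i => v (σ i)) =
      ∑ j : Fin (n + 1), (-1 : ℤ) ^ (j : ℕ) • ∑ τ : Equiv.Perm (Fin n), Equiv.Perm.sign τ •
        F (Fin.cons (v j) fun i => j.removeNth v (τ i)) := by
  let e : Fin (n + 1) × Equiv.Perm (Fin n) → Equiv.Perm (Fin (n + 1)) := fun p =>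
    p.1.cycleRange.symm * Equiv.Perm.decomposeFin.symm (0, p.2)
  have e0 : ∀ p, e p 0 = p.1 := fun p => by
    simp [e, Fin.cycleRange_symm_zero]
  have es : ∀ p i, e p (Fin.succ i) = p.1.succAbove (p.2 i) := fun p i => by
    simp [e, Fin.cycleRange_symm_succ]
  have he : Function.Bijective e := by
    rw [Fintype.bijective_iff_injective_and_card]
    refine ⟨fun p p' h => ?_, by simp [Fintype.card_perm, Nat.factorial_succ]⟩
    have h1 : p.1 = p'.1 := by rw [← e0 p, ← e0 p', h]
    refine Prod.ext h1 (Equiv.ext fun i => ?_)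
    have h2 := es p i
    rw [h, es p' i, h1] at h2
    exact (Fin.succAbove_right_injective h2).symm
  rw [← (Equiv.ofBijective e he).sum_comp, Fintype.sum_prod_type]
  refine Finset.sum_congr rfl fun j _ => ?_
  rw [Finset.smul_sum]
  refine Finset.sum_congr rfl fun τ _ => ?_
  have hs : Equiv.Perm.sign (e (j, τ)) = (-1) ^ (j : ℕ) * Equiv.Perm.sign τ := by
    simp [e, Fin.sign_cycleRange, Equiv.Perm.decomposeFin.symm_sign]
  have hv : (fun i => v (e (j, τ) i)) = Fin.cons (v j) fun i => j.removeNth v (τ i) := by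
    funext i
    refine Fin.cases ?_ (fun i => ?_) i
    · rw [e0]; rfl
    · rw [es]; rfl
  rw [Equiv.ofBijective_apply, hs, hv, mul_smul]
  rcases neg_one_pow_eq_or ℤˣ (j : ℕ) with h | h <;>
  rcases neg_one_pow_eq_or ℤ (j : ℕ) with h' | h' <;> simp [h, h'] <;>
  · exfalso
    have := congrArg (fun u : ℤˣ => (u : ℤ)) h
    simp [h'] at this

section Bridge

variable {V W A B : Type*} [NormedAddCommGroup V] [NormedSpace ℝ V]
  [NormedAddCommGroup W] [NormedSpace ℝ W]
  [NormedRing A] [NormedAlgebra ℝ A] [NormedAddCommGroup B] [NormedSpace ℝ B]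

/-- An alternating form as a form on lists, concentrated in one degree. -/
def toL {k : ℕ} (α : V [⋀^Fin k]→L[ℝ] B) : LForm V B where
  toFun l := if h : l.length = k then α fun i => l.get (i.cast h.symm) else 0

theorem toL_apply {k : ℕ} (α : V [⋀^Fin k]→L[ℝ] B) (l : List V) (h : l.length = k) :
    toL α l = α fun i => l.get (i.cast h.symm) := dif_pos h

theorem toL_of_length_ne {k : ℕ} (α : V [⋀^Fin k]→L[ℝ] B) (l : List V) (h : l.length ≠ k) :
    toL α l = 0 := dif_neg h

@[simp] theorem toL_ofFn {k : ℕ} (α : V [⋀^Fin k]→L[ℝ] B) (v : Fin k → V) :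
    toL α (List.ofFn v) = α v := by
  rw [toL_apply α _ (List.length_ofFn)]
  congr 1; ext i; simp

theorem contr_toL {k : ℕ} (α : V [⋀^Fin (k + 1)]→L[ℝ] B) (v : V) :
    LForm.contr v (toL α) = toL (α.curryLeft v) := by
  refine LForm.ext_ofFn (k := k) (fun l hl => ?_) (fun l hl => toL_of_length_ne _ _ hl) fun w => ?_
  · rw [LForm.contr_apply, toL_of_length_ne]; simpa using hl
  · rw [LForm.contr_apply, toL_ofFn]
    have : v :: List.ofFn w = List.ofFn (Fin.cons v w : Fin (k + 1) → V) := by simp [List.ofFn_succ]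
    rw [this, toL_ofFn]
    simp [Matrix.vecCons]

theorem contr_toL_zero (α : V [⋀^Fin 0]→L[ℝ] B) (v : V) : LForm.contr v (toL α) = 0 := by
  ext l; rw [LForm.contr_apply, toL_of_length_ne]; rfl; simp

theorem sgn_toL {k : ℕ} (α : V [⋀^Fin k]→L[ℝ] B) :
    LForm.sgn (toL α) = (-1 : ℤ) ^ k • toL α := by
  ext l
  by_cases hl : l.length = k
  · rw [LForm.sgn_apply, hl, LForm.zsmul_apply]
  · rw [LForm.sgn_apply, LForm.zsmul_apply, toL_of_length_ne _ _ hl, smul_zero, smul_zero]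

theorem toL_mul_degree {k l : ℕ} (α : V [⋀^Fin k]→L[ℝ] A) (β : V [⋀^Fin l]→L[ℝ] A) (L : List V)
    (h : L.length ≠ k + l) : (toL α * toL β) L = 0 := by
  induction L generalizing k l with
  | nil =>
    rw [LForm.mul_nil]
    by_cases hk : k = 0
    · rw [toL_of_length_ne β, mul_zero]
      rintro rfl; exact h (by simp [hk])
    · rw [toL_of_length_ne α, zero_mul]
      exact fun h => hk h.symm
  | cons v L ih =>
    rw [LForm.mul_cons, sgn_toL]
    have h1 : (LForm.contr v (toL α) * toL β) L = 0 := by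
      cases k with
      | zero => rw [contr_toL_zero, zero_mul]; rfl
      | succ k => rw [contr_toL]; exact ih _ _ (fun h' => h (by simp [h']; omega))
    have h2 : (toL α * LForm.contr v (toL β)) L = 0 := by
      cases l with
      | zero => rw [contr_toL_zero, mul_zero]; rfl
      | succ l => rw [contr_toL]; exact ih _ _ (fun h' => h (by simp [h']; omega))
    rw [h1, smul_mul_assoc, zero_add, LForm.zsmul_apply, h2, smul_zero]

/-- The tensor product of a form of degree `k` with a form. -/
def tens (f : LForm V A) (k : ℕ) (g : LForm V A) : LForm V A := ⟨fun l => f (l.take k) * g (l.drop k)⟩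

theorem map_perm_cam {k : ℕ} (α : V [⋀^Fin k]→L[ℝ] B) (v : Fin k → V)
    (σ : Equiv.Perm (Fin k)) : α (v ∘ σ) = Equiv.Perm.sign σ • α v :=
  α.toAlternatingMap.map_perm v σ

/-- Euler's identity for the degree of an alternating form. -/
theorem delta_contr_toL {k : ℕ} (α : V [⋀^Fin (k + 1)]→L[ℝ] A) :
    LForm.delta (fun w => LForm.contr w (toL α)) = ((k + 1 : ℕ) : ℤ) • toL α := by
  refine LForm.ext_ofFn (k := k + 1) (fun l hl => ?_) (fun l hl => ?_) fun v => ?_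
  · rcases l with _ | ⟨v, l⟩
    · rfl
    · obtain ⟨n, w, hw⟩ : ∃ (n : ℕ) (w : Fin (n + 1) → V), v :: l = List.ofFn w :=
        ⟨l.length, (v :: l).get, (List.ofFn_get _).symm⟩
      rw [hw] at hl ⊢
      rw [LForm.delta_apply_ofFn]
      refine Finset.sum_eq_zero fun i _ => ?_
      rw [LForm.contr_apply, toL_of_length_ne, smul_zero]
      simpa using hl
  · rw [LForm.zsmul_apply, toL_of_length_ne _ _ hl, smul_zero]
  · rw [LForm.delta_apply_ofFn, LForm.zsmul_apply, toL_ofFn]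
    have : ∀ j : Fin (k + 1), (-1 : ℤ) ^ (j : ℕ) •
        (LForm.contr (v j) (toL α)) (List.ofFn (j.removeNth v)) = α v := by
      intro j
      have h : v j :: List.ofFn (j.removeNth v) =
          List.ofFn (Fin.cons (v j) (j.removeNth v) : Fin (k + 1) → V) := by
        simp [List.ofFn_succ]
      rw [LForm.contr_apply, h, toL_ofFn, Fin.cons_removeNth_eq_comp_cycleRange_symm,
        map_perm_cam, Equiv.Perm.sign_symm, Fin.sign_cycleRange]
      rcases neg_one_pow_eq_or ℤˣ (j : ℕ) with h | h <;>
      rcases neg_one_pow_eq_or ℤ (j : ℕ) with h' | h' <;> simp [h, h'] <;>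
      · exfalso
        have := congrArg (fun u : ℤˣ => (u : ℤ)) h
        simp [h'] at this
    rw [Finset.sum_congr rfl fun j _ => this j]
    simp

theorem sum_perm_tens {k l n : ℕ} (hn : n = k + l) (α : V [⋀^Fin k]→L[ℝ] A)
    (β : V [⋀^Fin l]→L[ℝ] A) (v : Fin n → V) :
    ∑ σ : Equiv.Perm (Fin n), Equiv.Perm.sign σ •
        tens (toL α) k (toL β) (List.ofFn fun i => v (σ i)) =
      (k.factorial * l.factorial) • (toL α * toL β) (List.ofFn v) := by
  induction k generalizing n with
  | zero =>
    obtain rfl : n = l := by omega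
    have h0 : toL α = LForm.const (toL α []) := by
      ext (_ | ⟨w, L⟩)
      · rfl
      · rw [LForm.const_cons, toL_of_length_ne]; simp
    have h1 : ∀ σ : Equiv.Perm (Fin n), Equiv.Perm.sign σ •
        tens (toL α) 0 (toL β) (List.ofFn fun i => v (σ i)) = toL α [] * β v := by
      intro σ
      have : (fun i => v (σ i)) = v ∘ σ := rfl
      simp only [tens, List.take_zero, List.drop_zero]
      rw [toL_ofFn, this, map_perm_cam, mul_smul_comm, smul_smul, Int.units_mul_self, one_smul]
    rw [Finset.sum_congr rfl fun σ _ => h1 σ, h0, LForm.const_mul, toL_ofFn]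
    simp [Fintype.card_perm]
  | succ k ih =>
    obtain ⟨m, rfl⟩ : ∃ m, n = m + 1 := ⟨k + l, by omega⟩
    rw [sum_perm_succ (fun w => tens (toL α) (k + 1) (toL β) (List.ofFn w))]
    have h1 : ∀ j : Fin (m + 1), ∑ τ : Equiv.Perm (Fin m), Equiv.Perm.sign τ •
        tens (toL α) (k + 1) (toL β) (List.ofFn (Fin.cons (v j) fun i => j.removeNth v (τ i) :
          Fin (m + 1) → V)) =
        (k.factorial * l.factorial) •
          (LForm.contr (v j) (toL α) * toL β) (List.ofFn (j.removeNth v)) := by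
      intro j
      rw [contr_toL, ← ih (by omega)]
      refine Finset.sum_congr rfl fun τ _ => ?_
      rw [← contr_toL]
      simp [tens, List.ofFn_succ]
    rw [Finset.sum_congr rfl fun j _ => congrArg _ (h1 j)]
    have h2 := LForm.delta_apply_ofFn (fun w => LForm.contr w (toL α) * toL β) v
    rw [LForm.delta_mul_right, delta_contr_toL, smul_mul_assoc, LForm.zsmul_apply] at h2
    simp only [smul_comm _ (k.factorial * l.factorial), ← Finset.smul_sum]
    rw [← h2, natCast_zsmul, smul_smul, Nat.factorial_succ]
    congr 1
    ring

theorem toL_wedge {k l : ℕ} (α : V [⋀^Fin k]→L[ℝ] A) (β : V [⋀^Fin l]→L[ℝ] A) :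
    toL (wedge α β) = toL α * toL β := by
  refine LForm.ext_ofFn (k := k + l) (fun L hL => toL_of_length_ne _ _ hL)
    (fun L hL => toL_mul_degree _ _ _ hL) fun v => ?_
  have h := sum_perm_tens rfl α β v
  have h1 : ∀ σ : Equiv.Perm (Fin (k + l)),
      tens (toL α) k (toL β) (List.ofFn fun i => v (σ i)) = tensorMul α β (fun i => v (σ i)) := by
    intro σ
    rw [tensorMul_apply, tens]
    simp only
    rw [List.ofFn_add]
    rw [List.take_left' (by simp), List.drop_left' (by simp)]
    simp only [toL_ofFn]
    rfl
  rw [toL_ofFn, wedge, ContinuousAlternatingMap.smul_apply,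
    ContinuousMultilinearMap.alternatization_apply_apply]
  simp only [h1] at h
  have hne : (k.factorial * l.factorial : ℝ) ≠ 0 := by positivity
  rw [inv_smul_eq_iff₀ hne]
  refine h.trans ?_
  rw [← Nat.cast_smul_eq_nsmul ℝ]
  push_cast
  rfl

theorem toL_constOfIsEmpty {k : ℕ} [IsEmpty (Fin k)] (a : B) :
    toL (ContinuousAlternatingMap.constOfIsEmpty ℝ V (Fin k) a) =
      ⟨fun l => if l = [] then a else 0⟩ := by
  have hk : k = 0 := by
    by_contra h
    exact IsEmpty.false (⟨0, Nat.pos_of_ne_zero h⟩ : Fin k)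
  ext (_ | ⟨v, l⟩)
  · rw [toL_apply _ _ (by simp [hk])]; simp
  · rw [toL_of_length_ne _ _ (by simp [hk])]; simp

theorem toL_wpow (R : V [⋀^Fin 2]→L[ℝ] A) (n : ℕ) : toL (wpow R n) = toL R ^ n := by
  induction n with
  | zero =>
    have : IsEmpty (Fin (2 * 0)) := inferInstanceAs (IsEmpty (Fin 0))
    rw [pow_zero, wpow, toL_constOfIsEmpty, LForm.one_def]
    ext (_ | ⟨v, l⟩) <;> rfl
  | succ n ih => rw [wpow, toL_wedge, ih, pow_succ]

theorem toL_add {k : ℕ} (α β : V [⋀^Fin k]→L[ℝ] B) : toL (α + β) = toL α + toL β := by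
  ext l
  by_cases hl : l.length = k
  · simp [toL_apply _ _ hl]
  · simp [toL_of_length_ne _ _ hl]

theorem toL_compContinuousLinearMap {k : ℕ} (α : V [⋀^Fin k]→L[ℝ] B) (j : W →L[ℝ] V) :
    toL (α.compContinuousLinearMap j) = LForm.pull j (toL α) := by
  ext l
  by_cases hl : l.length = k
  · rw [LForm.pull_apply, toL_apply _ _ hl, toL_apply _ _ (by simpa using hl)]
    simp [Function.comp_def]
  · rw [LForm.pull_apply, toL_of_length_ne _ _ hl, toL_of_length_ne _ _ (by simpa using hl)]

theorem toL_mul_left_comp {k : ℕ} (τ : A →L[ℝ] B) (Q : A) (θ : V [⋀^Fin k]→L[ℝ] A) :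
    toL ((τ.comp (ContinuousLinearMap.mul ℝ A Q)).compContinuousAlternatingMap θ) =
      LForm.mapVal (τ : A →+ B) (LForm.const Q * toL θ) := by
  ext l
  rw [LForm.mapVal_apply, LForm.const_mul]
  by_cases hl : l.length = k
  · rw [toL_apply _ _ hl, toL_apply _ _ hl]; rfl
  · rw [toL_of_length_ne _ _ hl, toL_of_length_ne _ _ hl, mul_zero, map_zero]

theorem toL_oneForm_cons (T : V →L[ℝ] B) (v : V) (l : List V) :
    toL (oneForm T) (v :: l) = if l = [] then T v else 0 := by
  rcases l with _ | ⟨w, l⟩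
  · rw [toL_apply _ _ (by simp)]; simp [oneForm]
  · rw [toL_of_length_ne _ _ (by simp)]; simp

/-- Forms with values in a normed algebra. -/
abbrev AForm (V A : Type*) [NormedAddCommGroup V] [NormedSpace ℝ V] [NormedRing A]
    [NormedAlgebra ℝ A] (k : ℕ) : Type _ := V [⋀^Fin k]→L[ℝ] A

theorem toL_traceForm {p q : ℤ} {k : ℕ} (Q : Mat p q) (θ : AForm V (Mat p q) k) :
    toL (traceForm Q θ) = LForm.mapVal (trL p q : Mat p q →+ ℂ) (LForm.const Q * toL θ) :=
  toL_mul_left_comp (trL p q) Q θ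

end Bridge

end HolChern

namespace HolChern

/-! ### The differential graded algebra of smooth forms on a domain -/

theorem two_le_infty : (2 : WithTop ℕ∞) ≤ ∞ :=
  WithTop.coe_le_coe.2 (le_top : (2 : ℕ∞) ≤ ⊤)

/-- A set on which derivatives of all orders within the set are well behaved. -/
structure Dom (V : Type*) [NormedAddCommGroup V] [NormedSpace ℝ V] where
  /-- The underlying set. -/
  carrier : Set V
  uniqueDiff : UniqueDiffOn ℝ carrier
  subset_closure : carrier ⊆ closure (interior carrier)

section SForm

variable {V W A B : Type*} [NormedAddCommGroup V] [NormedSpace ℝ V]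
  [NormedAddCommGroup W] [NormedSpace ℝ W]
  [NormedRing A] [NormedAlgebra ℝ A] [NormedRing B] [NormedAlgebra ℝ B]

/-- The coefficient of a family of forms, extended by zero. -/
def coeffOn {S : Dom V} (f : S.carrier → LForm V A) (l : List V) (y : V) : A :=
  open Classical in if h : y ∈ S.carrier then f ⟨y, h⟩ l else 0

theorem coeffOn_of_mem {S : Dom V} (f : S.carrier → LForm V A) (l : List V) {y : V}
    (h : y ∈ S.carrier) : coeffOn f l y = f ⟨y, h⟩ l := dif_pos h

/-- Smoothness of a family of forms. -/
def SmoothFam {S : Dom V} (f : S.carrier → LForm V A) : Prop :=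
  ∀ l, ContDiffOn ℝ ∞ (coeffOn f l) S.carrier

variable {S : Dom V} {T : Dom W}

theorem SmoothFam.of_eq {f : S.carrier → LForm V A} {F : List V → V → A}
    (hF : ∀ l, ContDiffOn ℝ ∞ (F l) S.carrier) (h : ∀ l (y : S.carrier), f y l = F l y) :
    SmoothFam f := fun l => (hF l).congr fun y hy => by rw [coeffOn_of_mem f l hy, h]

theorem SmoothFam.add {f g : S.carrier → LForm V A} (hf : SmoothFam f) (hg : SmoothFam g) :
    SmoothFam (f + g) :=
  .of_eq (fun l => (hf l).add (hg l)) fun l y => by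
    rw [coeffOn_of_mem f l y.2, coeffOn_of_mem g l y.2]; rfl

theorem SmoothFam.neg {f : S.carrier → LForm V A} (hf : SmoothFam f) : SmoothFam (-f) :=
  .of_eq (fun l => (hf l).neg) fun l y => by rw [coeffOn_of_mem f l y.2]; rfl

theorem SmoothFam.sgn {f : S.carrier → LForm V A} (hf : SmoothFam f) :
    SmoothFam fun y => LForm.sgn (f y) :=
  .of_eq (F := fun l y => (-1 : ℤ) ^ l.length • coeffOn f l y)
    (fun l => by
      rcases neg_one_pow_eq_or ℤ l.length with h | h <;> simp only [h, one_smul, neg_smul]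
      · exact hf l
      · exact (hf l).neg) fun l y => by rw [coeffOn_of_mem f l y.2]; rfl

theorem SmoothFam.contr {f : S.carrier → LForm V A} (hf : SmoothFam f) (v : V) :
    SmoothFam fun y => LForm.contr v (f y) :=
  .of_eq (fun l => hf (v :: l)) fun l y => by rw [coeffOn_of_mem f _ y.2]; rfl

theorem SmoothFam.mul {f g : S.carrier → LForm V A} (hf : SmoothFam f) (hg : SmoothFam g) :
    SmoothFam (f * g) := by
  intro l
  induction l generalizing f g with
  | nil =>
    refine ((hf []).mul (hg [])).congr fun y hy => ?_
    rw [coeffOn_of_mem _ _ hy, coeffOn_of_mem _ _ hy, coeffOn_of_mem _ _ hy]; rfl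
  | cons v l ih =>
    refine ((ih (hf.contr v) hg).add (ih hf.sgn (hg.contr v))).congr fun y hy => ?_
    rw [coeffOn_of_mem _ _ hy, coeffOn_of_mem _ _ hy, coeffOn_of_mem _ _ hy]; rfl

theorem SmoothFam.const {a : V → A} (ha : ContDiffOn ℝ ∞ a S.carrier) :
    SmoothFam fun y : S.carrier => (LForm.const (a y) : LForm V A) := by
  rintro (_ | ⟨v, l⟩)
  · refine ha.congr fun y hy => ?_
    rw [coeffOn_of_mem _ _ hy]; rfl
  · refine (contDiffOn_const (c := (0 : A))).congr fun y hy => ?_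
    rw [coeffOn_of_mem _ _ hy]; rfl

/-- The ring of smooth forms of mixed degree. -/
def SForm (S : Dom V) (A : Type*) [NormedRing A] [NormedAlgebra ℝ A] : Subring (S.carrier → LForm V A) where
  carrier := {f | SmoothFam f}
  mul_mem' := SmoothFam.mul
  one_mem' := SmoothFam.const (a := fun _ => (1 : A)) contDiffOn_const
  add_mem' := SmoothFam.add
  zero_mem' := fun l => (contDiffOn_const (c := (0 : A))).congr fun y hy => by
    rw [coeffOn_of_mem _ _ hy]; rfl
  neg_mem' := SmoothFam.neg

namespace SForm

/-- The function given by the values on a list of vectors. -/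
def ev (f : SForm S A) (l : List V) : V → A := coeffOn f.1 l

theorem ev_of_mem (f : SForm S A) (l : List V) {y : V} (h : y ∈ S.carrier) :
    ev f l y = f.1 ⟨y, h⟩ l := dif_pos h

theorem ev_coe (f : SForm S A) (l : List V) (y : S.carrier) : ev f l y = f.1 y l :=
  ev_of_mem f l y.2

theorem contDiffOn_ev (f : SForm S A) (l : List V) : ContDiffOn ℝ ∞ (ev f l) S.carrier := f.2 l

theorem differentiableOn_ev (f : SForm S A) (l : List V) : DifferentiableOn ℝ (ev f l) S.carrier :=
  (f.2 l).differentiableOn (by simp)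

@[ext] theorem ext {f g : SForm S A} (h : ∀ (y : S.carrier) l, f.1 y l = g.1 y l) : f = g :=
  Subtype.ext (funext fun y => LForm.ext (h y))

@[simp] theorem mul_val (f g : SForm S A) (y : S.carrier) : (f * g).1 y = f.1 y * g.1 y := rfl
@[simp] theorem add_val (f g : SForm S A) (y : S.carrier) : (f + g).1 y = f.1 y + g.1 y := rfl
@[simp] theorem sub_val (f g : SForm S A) (y : S.carrier) : (f - g).1 y = f.1 y - g.1 y := rfl
@[simp] theorem neg_val (f : SForm S A) (y : S.carrier) : (-f).1 y = -f.1 y := rfl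
@[simp] theorem one_val (y : S.carrier) : (1 : SForm S A).1 y = 1 := rfl
@[simp] theorem zero_val (y : S.carrier) : (0 : SForm S A).1 y = 0 := rfl
@[simp] theorem pow_val (f : SForm S A) (n : ℕ) (y : S.carrier) : (f ^ n).1 y = f.1 y ^ n := by
  induction n with
  | zero => simp
  | succ n ih => rw [pow_succ, mul_val, ih, pow_succ]

/-- The smooth form of degree zero given by a smooth function. -/
def ofFun (a : V → A) (ha : ContDiffOn ℝ ∞ a S.carrier) : SForm S A :=
  ⟨fun y => LForm.const (a y), SmoothFam.const ha⟩

@[simp] theorem ofFun_val (a : V → A) (ha : ContDiffOn ℝ ∞ a S.carrier) (y : S.carrier) :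
    (ofFun a ha).1 y = LForm.const (a y) := rfl

/-- Contraction with a constant vector field. -/
def contr (v : V) (f : SForm S A) : SForm S A := ⟨fun y => LForm.contr v (f.1 y), f.2.contr v⟩

@[simp] theorem contr_val (v : V) (f : SForm S A) (y : S.carrier) :
    (contr v f).1 y = LForm.contr v (f.1 y) := rfl

/-- The grading involution. -/
def sgn : SForm S A →+* SForm S A where
  toFun f := ⟨fun y => LForm.sgn (f.1 y), f.2.sgn⟩
  map_one' := by ext y l; simp
  map_zero' := by ext y l; simp
  map_add' f g := by ext y l; simp
  map_mul' f g := by ext y l; simp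

@[simp] theorem sgn_val (f : SForm S A) (y : S.carrier) : (sgn f).1 y = LForm.sgn (f.1 y) := rfl
@[simp] theorem sgn_sgn (f : SForm S A) : sgn (sgn f) = f := by ext y l; simp
@[simp] theorem sgn_ofFun (a : V → A) (ha : ContDiffOn ℝ ∞ a S.carrier) :
    sgn (ofFun a ha) = ofFun a ha := by ext y l; simp
@[simp] theorem contr_sgn (v : V) (f : SForm S A) : contr v (sgn f) = -sgn (contr v f) := by
  ext y l; simp
@[simp] theorem contr_mul (v : V) (f g : SForm S A) :
    contr v (f * g) = contr v f * g + sgn f * contr v g := by ext y l; simp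
@[simp] theorem contr_add (v : V) (f g : SForm S A) :
    contr v (f + g) = contr v f + contr v g := by ext y l; simp
@[simp] theorem contr_sub (v : V) (f g : SForm S A) :
    contr v (f - g) = contr v f - contr v g := by ext y l; simp
@[simp] theorem contr_neg (v : V) (f : SForm S A) : contr v (-f) = -contr v f := by ext y l; simp
@[simp] theorem contr_zero (v : V) : contr v (0 : SForm S A) = 0 := by ext y l; simp
@[simp] theorem contr_one (v : V) : contr v (1 : SForm S A) = 0 := by ext y l; simp
@[simp] theorem contr_ofFun (v : V) (a : V → A) (ha : ContDiffOn ℝ ∞ a S.carrier) :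
    contr v (ofFun a ha) = 0 := by ext y l; simp

/-- The derivative of the coefficients in a constant direction. -/
def ld (w : V) (f : SForm S A) : SForm S A :=
  ⟨fun y => ⟨fun l => fderivWithin ℝ (ev f l) S.carrier y w⟩,
    .of_eq (F := fun l y => fderivWithin ℝ (ev f l) S.carrier y w)
      (fun l => ((contDiffOn_ev f l).fderivWithin S.uniqueDiff (by simp)).clm_apply
        contDiffOn_const) fun _ _ => rfl⟩

theorem ld_val (w : V) (f : SForm S A) (y : S.carrier) (l : List V) :
    (ld w f).1 y l = fderivWithin ℝ (ev f l) S.carrier y w := rfl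

theorem ld_congr {w : V} {f : SForm S A} {l : List V} {F : V → A} {y : S.carrier}
    (h : EqOn (ev f l) F S.carrier) : (ld w f).1 y l = fderivWithin ℝ F S.carrier y w := by
  rw [ld_val, fderivWithin_congr h (h y.2)]

theorem ev_ld (w : V) (f : SForm S A) (l : List V) {y : V} (hy : y ∈ S.carrier) :
    ev (ld w f) l y = fderivWithin ℝ (ev f l) S.carrier y w := ev_of_mem _ _ hy

theorem ld_contr (v w : V) (f : SForm S A) : ld w (contr v f) = contr v (ld w f) := rfl

theorem ld_add (w : V) (f g : SForm S A) : ld w (f + g) = ld w f + ld w g := by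
  ext y l
  have h : EqOn (ev (f + g) l) (fun y => ev f l y + ev g l y) S.carrier := fun y hy => by
    simp only [ev_of_mem _ _ hy]; rfl
  rw [ld_congr h, fderivWithin_fun_add (S.uniqueDiff y y.2) (differentiableOn_ev f l y y.2)
    (differentiableOn_ev g l y y.2)]
  rfl

theorem ld_neg (w : V) (f : SForm S A) : ld w (-f) = -ld w f := by
  ext y l
  have h : EqOn (ev (-f) l) (fun y => -ev f l y) S.carrier := fun y hy => by
    simp only [ev_of_mem _ _ hy]; rfl
  rw [ld_congr h, fderivWithin_fun_neg (S.uniqueDiff y y.2)]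
  rfl

theorem ld_sub (w : V) (f g : SForm S A) : ld w (f - g) = ld w f - ld w g := by
  rw [sub_eq_add_neg, ld_add, ld_neg, sub_eq_add_neg]

theorem ld_sgn (w : V) (f : SForm S A) : ld w (sgn f) = sgn (ld w f) := by
  ext y l
  have h : EqOn (ev (sgn f) l) (fun y => (-1 : ℤ) ^ l.length • ev f l y) S.carrier :=
    fun y hy => by simp only [ev_of_mem _ _ hy]; rfl
  rw [ld_congr h, sgn_val, LForm.sgn_apply, ld_val]
  rcases neg_one_pow_eq_or ℤ l.length with h | h <;> simp only [h, one_smul, neg_smul]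
  rw [fderivWithin_fun_neg (S.uniqueDiff y y.2)]
  rfl

theorem ld_mul (w : V) (f g : SForm S A) : ld w (f * g) = ld w f * g + f * ld w g := by
  ext y l
  induction l generalizing f g with
  | nil =>
    have h : EqOn (ev (f * g) []) (fun y => ev f [] y * ev g [] y) S.carrier := fun y hy => by
      simp only [ev_of_mem _ _ hy]; rfl
    rw [ld_congr h, fderivWithin_fun_mul' (S.uniqueDiff y y.2) (differentiableOn_ev f [] y y.2)
      (differentiableOn_ev g [] y y.2)]
    simp [ld_val, ev_coe, add_comm]
  | cons v l ih =>
    have h : (ld w (f * g)).1 y (v :: l) =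
        (ld w (contr v f * g)).1 y l + (ld w (sgn f * contr v g)).1 y l := by
      have : (ld w (f * g)).1 y (v :: l) = (contr v (ld w (f * g))).1 y l := rfl
      rw [this, ← ld_contr, contr_mul, ld_add]; rfl
    rw [h, ih, ih]
    simp only [add_val, mul_val, LForm.add_apply, LForm.mul_cons, ld_sgn, sgn_val, ld_contr,
      contr_val]
    abel

theorem ld_comm (v w : V) (f : SForm S A) : ld v (ld w f) = ld w (ld v f) := by
  ext y l
  have key : ∀ v w : V, (ld v (ld w f)).1 y l =
      fderivWithin ℝ (fderivWithin ℝ (ev f l) S.carrier) S.carrier y v w := by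
    intro v w
    have h : EqOn (ev (ld w f) l) (fun y => fderivWithin ℝ (ev f l) S.carrier y w) S.carrier :=
      fun y hy => ev_ld w f l hy
    have hd : DifferentiableWithinAt ℝ (fderivWithin ℝ (ev f l) S.carrier) S.carrier y :=
      ((contDiffOn_ev f l).fderivWithin S.uniqueDiff (m := 1)
        (one_add_one_eq_two.trans_le two_le_infty)).differentiableOn
        (by simp) y y.2
    rw [ld_congr h, fderivWithin_clm_apply (S.uniqueDiff y y.2) hd
      (differentiableWithinAt_const w)]
    simp
  rw [key, key]
  refine ContDiffWithinAt.isSymmSndFDerivWithinAt (n := ∞) (contDiffOn_ev f l y y.2) ?_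
    S.uniqueDiff (S.subset_closure y.2) y.2 v w
  simp only [minSmoothness_of_isRCLikeNormedField]
  exact two_le_infty

/-- The exterior derivative. -/
def d (f : SForm S A) : SForm S A :=
  ⟨fun y => LForm.delta fun w => (ld w f).1 y, by
    intro l
    induction l generalizing f with
    | nil =>
      refine (contDiffOn_const (c := (0 : A))).congr fun y hy => ?_
      rw [coeffOn_of_mem _ _ hy]; rfl
    | cons v l ih =>
      refine ((contDiffOn_ev (ld v f) l).sub (ih (contr v f))).congr fun y hy => ?_
      rw [coeffOn_of_mem _ _ hy, coeffOn_of_mem _ _ hy, ev_of_mem _ _ hy]; rfl⟩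

theorem d_val (f : SForm S A) (y : S.carrier) :
    (d f).1 y = LForm.delta fun w => (ld w f).1 y := rfl

@[simp] theorem d_nil (f : SForm S A) (y : S.carrier) : (d f).1 y [] = 0 := rfl

theorem contr_d (v : V) (f : SForm S A) : contr v (d f) = ld v f - d (contr v f) := rfl

theorem d_cons (f : SForm S A) (y : S.carrier) (v : V) (l : List V) :
    (d f).1 y (v :: l) = (ld v f).1 y l - (d (contr v f)).1 y l := rfl

@[simp] theorem d_add (f g : SForm S A) : d (f + g) = d f + d g := by
  refine Subtype.ext (funext fun y => ?_)
  simp only [d_val, ld_add, add_val, LForm.delta_add]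

@[simp] theorem d_neg (f : SForm S A) : d (-f) = -d f := by
  refine Subtype.ext (funext fun y => ?_)
  simp only [d_val, ld_neg, neg_val, LForm.delta_neg]

@[simp] theorem d_sub (f g : SForm S A) : d (f - g) = d f - d g := by
  rw [sub_eq_add_neg, d_add, d_neg, sub_eq_add_neg]

theorem d_mul (f g : SForm S A) : d (f * g) = d f * g + sgn f * d g := by
  refine Subtype.ext (funext fun y => ?_)
  simp only [d_val, ld_mul, add_val, mul_val, LForm.delta_add, LForm.delta_mul_right,
    LForm.delta_mul_left, sgn_val]

@[simp] theorem sgn_d (f : SForm S A) : sgn (d f) = -d (sgn f) := by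
  refine Subtype.ext (funext fun y => ?_)
  simp only [d_val, sgn_val, neg_val, LForm.sgn_delta, ld_sgn]

@[simp] theorem d_zero : d (0 : SForm S A) = 0 := by
  have := d_add (0 : SForm S A) 0
  simpa using this

@[simp] theorem d_one : d (1 : SForm S A) = 0 := by
  have := d_mul (1 : SForm S A) 1
  simpa using this

theorem ld_d (v : V) (f : SForm S A) : ld v (d f) = d (ld v f) := by
  ext y l
  induction l generalizing f with
  | nil =>
    have h : EqOn (ev (d f) []) (fun _ => 0) S.carrier := fun y hy => by rw [ev_of_mem _ _ hy]; rfl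
    rw [ld_congr h, d_nil]
    simp
  | cons w l ih =>
    have : (ld v (d f)).1 y (w :: l) = (ld v (contr w (d f))).1 y l := rfl
    rw [this, contr_d, ld_sub, sub_val, LForm.sub_apply, ih, d_cons, ld_comm, ld_contr]

@[simp] theorem d_d (f : SForm S A) : d (d f) = 0 := by
  ext y l
  induction l generalizing f with
  | nil => rfl
  | cons w l ih =>
    rw [d_cons, contr_d, d_sub, sub_val, LForm.sub_apply, ih, ld_d]
    simp

theorem d_ofFun_cons (a : V → A) (ha : ContDiffOn ℝ ∞ a S.carrier) (y : S.carrier) (v : V)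
    (l : List V) :
    (d (ofFun a ha)).1 y (v :: l) = if l = [] then fderivWithin ℝ a S.carrier y v else 0 := by
  rw [d_cons, contr_ofFun, d_zero, zero_val, LForm.zero_apply, sub_zero]
  split_ifs with hl
  · subst hl
    exact ld_congr fun y hy => by rw [ev_of_mem _ _ hy]; rfl
  · have h : EqOn (ev (ofFun a ha) l) (fun _ => 0) S.carrier := fun y hy => by
      obtain ⟨w, l, rfl⟩ := List.exists_cons_of_ne_nil hl
      rw [ev_of_mem _ _ hy]; rfl
    rw [ld_congr h]
    simp

end SForm

end SForm

end HolChern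

namespace HolChern

namespace LForm

theorem pull_delta {V W A : Type*} [Ring A] (j : W → V) (F : V → LForm V A) :
    pull j (delta F) = delta fun w => pull j (F (j w)) := by
  ext l
  induction l generalizing F with
  | nil => rfl
  | cons w l ih =>
    rw [delta_cons, pull_apply, List.map_cons, delta_cons]
    simp only [contr_pull]
    rw [← ih (fun w' => contr (j w) (F w'))]
    rfl

theorem mapVal_delta {V A B : Type*} [Ring A] [Ring B] (τ : A →+ B) (F : V → LForm V A) :
    mapVal τ (delta F) = delta fun w => mapVal τ (F w) := by
  ext l
  induction l generalizing F with
  | nil => simp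
  | cons w l ih =>
    rw [mapVal_apply, delta_cons, delta_cons, map_sub]
    simp only [contr_mapVal]
    rw [← ih]
    rfl

end LForm

namespace SForm

variable {V W A B : Type*} [NormedAddCommGroup V] [NormedSpace ℝ V]
  [NormedAddCommGroup W] [NormedSpace ℝ W]
  [NormedRing A] [NormedAlgebra ℝ A] [NormedRing B] [NormedAlgebra ℝ B]
  {S : Dom V} {T : Dom W}

/-- Application of a continuous linear map to the coefficients. -/
def mapVal (τ : A →L[ℝ] B) (f : SForm S A) : SForm S B :=
  ⟨fun y => LForm.mapVal (τ : A →+ B) (f.1 y),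
    .of_eq (F := fun l y => τ (ev f l y)) (fun l => τ.contDiff.comp_contDiffOn (contDiffOn_ev f l))
      fun l y => by rw [ev_coe]; rfl⟩

theorem mapVal_val (τ : A →L[ℝ] B) (f : SForm S A) (y : S.carrier) :
    (mapVal τ f).1 y = LForm.mapVal (τ : A →+ B) (f.1 y) := rfl

theorem ld_mapVal (τ : A →L[ℝ] B) (w : V) (f : SForm S A) :
    ld w (mapVal τ f) = mapVal τ (ld w f) := by
  ext y l
  have h : EqOn (ev (mapVal τ f) l) (fun y => τ (ev f l y)) S.carrier := fun y hy => by
    simp only [ev_of_mem _ _ hy]; rfl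
  rw [ld_congr h]
  have := (τ.hasFDerivAt.comp_hasFDerivWithinAt (y : V)
    (differentiableOn_ev f l y y.2).hasFDerivWithinAt).fderivWithin (S.uniqueDiff y y.2)
  exact congrArg (fun L => L w) this

theorem d_mapVal (τ : A →L[ℝ] B) (f : SForm S A) : d (mapVal τ f) = mapVal τ (d f) := by
  refine Subtype.ext (funext fun y => ?_)
  simp only [d_val, ld_mapVal, mapVal_val, LForm.mapVal_delta]

theorem mapVal_sub (τ : A →L[ℝ] B) (f g : SForm S A) :
    mapVal τ (f - g) = mapVal τ f - mapVal τ g := by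
  ext y l; simp [mapVal_val]

/-- The trace is cyclic on products with an even form. -/
theorem mapVal_mul_comm (τ : A →L[ℝ] B) (hτ : ∀ a b, τ (a * b) = τ (b * a)) {f : SForm S A}
    (hf : sgn f = f) (g : SForm S A) : mapVal τ (f * g) = mapVal τ (g * f) := by
  refine Subtype.ext (funext fun y => ?_)
  refine LForm.mapVal_mul_comm (τ : A →+ B) hτ ?_ _
  exact congrFun (congrArg Subtype.val hf) y

section Pull

/-- An affine map between domains. -/
structure AffMap (T : Dom W) (S : Dom V) where
  /-- The value at the origin. -/
  base : V
  /-- The linear part. -/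
  lin : W →L[ℝ] V
  mapsTo : ∀ w ∈ T.carrier, base + lin w ∈ S.carrier

/-- The image of a point under an affine map. -/
def AffMap.app (j : AffMap T S) (w : T.carrier) : S.carrier := ⟨j.base + j.lin w, j.mapsTo w w.2⟩

variable (j : AffMap T S)

theorem AffMap.contDiff (j : AffMap T S) : ContDiff ℝ ∞ fun w => j.base + j.lin w :=
  contDiff_const.add j.lin.contDiff

/-- Pullback of forms along an affine map. -/
def pull : SForm S A →+* SForm T A where
  toFun f := ⟨fun w => LForm.pull j.lin (f.1 (j.app w)),
    .of_eq (F := fun l w => ev f (l.map j.lin) (j.base + j.lin w))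
      (fun l => (contDiffOn_ev f _).comp j.contDiff.contDiffOn j.mapsTo)
      fun l w => by rw [ev_of_mem _ _ (j.mapsTo w w.2)]; rfl⟩
  map_one' := by ext y l; exact congrArg (fun f => f l) (LForm.pull_const j.lin (1 : A))
  map_zero' := by ext y l; rfl
  map_add' f g := by ext y l; rfl
  map_mul' f g := Subtype.ext (funext fun w => LForm.pull_mul _ _ _)

theorem pull_val (f : SForm S A) (w : T.carrier) :
    (pull j f).1 w = LForm.pull j.lin (f.1 (j.app w)) := rfl

theorem pull_ld (w : W) (f : SForm S A) : ld w (pull j f) = pull j (ld (j.lin w) f) := by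
  ext y l
  have h : EqOn (ev (pull j f) l) (fun y => ev f (l.map j.lin) (j.base + j.lin y)) T.carrier :=
    fun y hy => by
      simp only
      rw [ev_of_mem _ _ hy, ev_of_mem _ _ (j.mapsTo y hy)]; rfl
  rw [ld_congr h]
  have h1 : HasFDerivWithinAt (fun y => j.base + j.lin y) j.lin T.carrier y :=
    (j.lin.hasFDerivWithinAt).const_add _
  have h2 := (differentiableOn_ev f (l.map j.lin) _ (j.mapsTo y y.2)).hasFDerivWithinAt
  have := (h2.comp (y : W) h1 j.mapsTo).fderivWithin (T.uniqueDiff y y.2)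
  exact congrArg (fun L => L w) this

theorem pull_d (f : SForm S A) : pull j (d f) = d (pull j f) := by
  refine Subtype.ext (funext fun y => ?_)
  simp only [d_val, pull_ld, pull_val, LForm.pull_delta]

theorem pull_sgn (f : SForm S A) : pull j (sgn f) = sgn (pull j f) :=
  Subtype.ext (funext fun _ => LForm.pull_sgn _ _)

theorem pull_contr (w : W) (f : SForm S A) :
    contr w (pull j f) = pull j (contr (j.lin w) f) := rfl

theorem pull_mapVal (τ : A →L[ℝ] B) (f : SForm S A) :
    pull j (mapVal τ f) = mapVal τ (pull j f) := rfl

theorem pull_ofFun (a : V → A) (ha : ContDiffOn ℝ ∞ a S.carrier) :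
    pull j (ofFun a ha) = ofFun (fun w => a (j.base + j.lin w))
      (ha.comp j.contDiff.contDiffOn j.mapsTo) :=
  Subtype.ext (funext fun _ => LForm.pull_const _ _)

end Pull

theorem ofFun_congr {a b : V → A} {ha : ContDiffOn ℝ ∞ a S.carrier}
    {hb : ContDiffOn ℝ ∞ b S.carrier} (h : EqOn a b S.carrier) : ofFun a ha = ofFun b hb :=
  Subtype.ext (funext fun y => by rw [ofFun_val, ofFun_val, h y.2])

theorem ofFun_mul {a b : V → A} (ha : ContDiffOn ℝ ∞ a S.carrier)
    (hb : ContDiffOn ℝ ∞ b S.carrier) :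
    ofFun a ha * ofFun b hb = ofFun (fun y => a y * b y) (ha.mul hb) := by
  ext y (_ | ⟨v, l⟩)
  · rfl
  · rw [mul_val, ofFun_val, LForm.const_mul]; simp

theorem ofFun_add {a b : V → A} (ha : ContDiffOn ℝ ∞ a S.carrier)
    (hb : ContDiffOn ℝ ∞ b S.carrier) :
    ofFun a ha + ofFun b hb = ofFun (fun y => a y + b y) (ha.add hb) := by
  ext y (_ | ⟨v, l⟩) <;> simp

theorem ofFun_sub {a b : V → A} (ha : ContDiffOn ℝ ∞ a S.carrier)
    (hb : ContDiffOn ℝ ∞ b S.carrier) :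
    ofFun a ha - ofFun b hb = ofFun (fun y => a y - b y) (ha.sub hb) := by
  ext y (_ | ⟨v, l⟩) <;> simp

theorem ofFun_one : ofFun (fun _ => 1) contDiffOn_const = (1 : SForm S A) := by
  ext y l; rfl

theorem ofFun_zero : ofFun (fun _ => 0) contDiffOn_const = (0 : SForm S A) := by
  ext y (_ | ⟨v, l⟩) <;> rfl

/-- Functions with central values are central. -/
theorem ofFun_smul_one_comm (a : V → ℝ) (ha : ContDiffOn ℝ ∞ (fun y => a y • (1 : A)) S.carrier)
    (f : SForm S A) : f * ofFun (fun y => a y • 1) ha = ofFun (fun y => a y • 1) ha * f := by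
  ext y l
  simp [LForm.const_mul, LForm.mul_const]

section Star

variable [StarRing A] [StarModule ℝ A] [ContinuousStar A]

theorem contDiffOn_star {a : V → A} {s : Set V} (ha : ContDiffOn ℝ ∞ a s) :
    ContDiffOn ℝ ∞ (fun y => star (a y)) s :=
  ((starL' ℝ : A ≃L[ℝ] A) : A →L[ℝ] A).contDiff.comp_contDiffOn ha

theorem ev_star_aux (f : SForm S A) (l : List V) (y : S.carrier) :
    star (f.1 y) l = (-1 : ℤ) ^ (l.length * (l.length - 1) / 2) • star (ev f l y) := by
  rw [LForm.star_apply, ev_coe]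

instance : Star (SForm S A) :=
  ⟨fun f => ⟨fun y => star (f.1 y), .of_eq
    (F := fun l y => (-1 : ℤ) ^ (l.length * (l.length - 1) / 2) • star (ev f l y))
    (fun l => by
      rcases neg_one_pow_eq_or ℤ (l.length * (l.length - 1) / 2) with h | h <;>
        simp only [h, one_smul, neg_smul]
      · exact contDiffOn_star (contDiffOn_ev f l)
      · exact (contDiffOn_star (contDiffOn_ev f l)).neg) fun l y => ev_star_aux f l y⟩⟩

@[simp] theorem star_val (f : SForm S A) (y : S.carrier) : (star f).1 y = star (f.1 y) := rfl

instance : StarRing (SForm S A) where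
  star_involutive f := by ext y l; simp
  star_mul f g := by ext y l; simp
  star_add f g := by ext y l; simp

@[simp] theorem star_ofFun (a : V → A) (ha : ContDiffOn ℝ ∞ a S.carrier) :
    star (ofFun a ha) = ofFun (fun y => star (a y)) (contDiffOn_star ha) := by
  ext y l; simp

theorem contr_star (v : V) (f : SForm S A) : contr v (star f) = sgn (star (contr v f)) := by
  ext y l; simp

theorem ld_star (w : V) (f : SForm S A) : ld w (star f) = star (ld w f) := by
  ext y l
  have h : EqOn (ev (star f) l)
      (fun y => (-1 : ℤ) ^ (l.length * (l.length - 1) / 2) • star (ev f l y)) S.carrier :=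
    fun y hy => by rw [ev_of_mem _ _ hy]; exact ev_star_aux f l ⟨y, hy⟩
  have h1 : HasFDerivWithinAt (fun y => star (ev f l y))
      (((starL' ℝ : A ≃L[ℝ] A) : A →L[ℝ] A).comp (fderivWithin ℝ (ev f l) S.carrier y))
      S.carrier y :=
    ((starL' ℝ : A ≃L[ℝ] A) : A →L[ℝ] A).hasFDerivAt.comp_hasFDerivWithinAt (y : V)
      (differentiableOn_ev f l y y.2).hasFDerivWithinAt
  rw [ld_congr h, star_val, LForm.star_apply, ld_val]
  rcases neg_one_pow_eq_or ℤ (l.length * (l.length - 1) / 2) with h | h <;>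
    simp only [h, one_smul, neg_smul]
  · rw [h1.fderivWithin (S.uniqueDiff y y.2)]; rfl
  · rw [fderivWithin_fun_neg (S.uniqueDiff y y.2), h1.fderivWithin (S.uniqueDiff y y.2)]; rfl

theorem star_d (f : SForm S A) : star (d f) = d (sgn (star f)) := by
  ext y l
  induction l generalizing f with
  | nil => rw [star_val, LForm.star_nil, d_nil, d_nil, star_zero]
  | cons v l ih =>
    have h1 : (star (d f)).1 y (v :: l) = (contr v (star (d f))).1 y l := rfl
    have h2 : (sgn (star (d (contr v f)))).1 y l = -(d (star (contr v f))).1 y l := by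
      rw [sgn_val, LForm.sgn_apply, ih, ← LForm.sgn_apply, ← sgn_val, sgn_d, sgn_sgn]; rfl
    rw [h1, contr_star, contr_d, star_sub, map_sub, sub_val, LForm.sub_apply, d_cons, contr_sgn,
      contr_star, sgn_sgn, ← ld_star, ← ld_sgn, d_neg, h2]
    rfl

end Star

section OfForm

/-- A smooth alternating form, as a form on lists. -/
def ofForm {k : ℕ} (θ : V → AForm V A k) (hθ : ContDiffOn ℝ ∞ θ S.carrier) : SForm S A :=
  ⟨fun y => toL (θ y), by
    intro l
    by_cases hl : l.length = k
    · refine (((ContinuousAlternatingMap.apply ℝ V A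
        (fun i : Fin k => l.get (i.cast hl.symm))).contDiff (n := ∞)).comp_contDiffOn hθ).congr
        fun y hy => ?_
      rw [coeffOn_of_mem _ _ hy, toL_apply _ _ hl]; rfl
    · refine (contDiffOn_const (c := (0 : A))).congr fun y hy => ?_
      rw [coeffOn_of_mem _ _ hy, toL_of_length_ne _ _ hl]⟩

theorem ofForm_val {k : ℕ} (θ : V → AForm V A k) (hθ : ContDiffOn ℝ ∞ θ S.carrier)
    (y : S.carrier) : (ofForm θ hθ).1 y = toL (θ y) := rfl

theorem d_apply_eq_zero {k : ℕ} {f : SForm S A} (hf : ∀ y l, l.length ≠ k → f.1 y l = 0)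
    (y : S.carrier) (l : List V) (hl : l.length ≠ k + 1) : (d f).1 y l = 0 := by
  rcases l with _ | ⟨v, l⟩
  · rfl
  · obtain ⟨n, w, hw⟩ : ∃ (n : ℕ) (w : Fin (n + 1) → V), v :: l = List.ofFn w :=
      ⟨l.length, (v :: l).get, (List.ofFn_get _).symm⟩
    rw [hw] at hl ⊢
    rw [d_val, LForm.delta_apply_ofFn]
    refine Finset.sum_eq_zero fun i _ => ?_
    have h : EqOn (ev f (List.ofFn (i.removeNth w))) (fun _ => 0) S.carrier := fun y hy => by
      rw [ev_of_mem _ _ hy, hf]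
      simpa using hl
    rw [ld_congr h]
    simp

theorem d_ofForm {k : ℕ} (θ : V → AForm V A k) (hθ : ContDiffOn ℝ ∞ θ S.carrier)
    (y : S.carrier) : (d (ofForm θ hθ)).1 y = toL (extDerivWithin θ S.carrier y) := by
  refine LForm.ext_ofFn (k := k + 1)
    (d_apply_eq_zero (k := k) (fun y l hl => toL_of_length_ne _ _ hl) y)
    (fun l hl => toL_of_length_ne _ _ hl) fun v => ?_
  rw [toL_ofFn, extDerivWithin_apply (hθ.differentiableOn (by simp) y y.2) (S.uniqueDiff y y.2),
    d_val, LForm.delta_apply_ofFn]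
  refine Finset.sum_congr rfl fun i _ => ?_
  have h : EqOn (ev (ofForm θ hθ) (List.ofFn (i.removeNth v)))
      (fun y => θ y (i.removeNth v)) S.carrier := fun y hy => by
    rw [ev_of_mem _ _ hy, ofForm_val, toL_ofFn]
  rw [ld_congr h]

end OfForm

end SForm

end HolChern

namespace HolChern

namespace SForm

variable {V W A B : Type*} [NormedAddCommGroup V] [NormedSpace ℝ V]
  [NormedAddCommGroup W] [NormedSpace ℝ W]
  [NormedRing A] [NormedAlgebra ℝ A] [NormedRing B] [NormedAlgebra ℝ B]
  {S : Dom V} {T : Dom W}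

/-- The curvature of the connection `d + C`. -/
def curv (C : SForm S A) : SForm S A := d C + C * C

theorem sgn_curv {C : SForm S A} (hC : sgn C = -C) : sgn (curv C) = curv C := by
  rw [curv, map_add, map_mul, sgn_d, hC, d_neg, neg_neg, neg_mul_neg]

theorem pull_curv (j : AffMap T S) (C : SForm S A) : pull j (curv C) = curv (pull j C) := by
  rw [curv, curv, map_add, map_mul, pull_d]

/-- The Bianchi identity. -/
theorem d_curv {C : SForm S A} (hC : sgn C = -C) : d (curv C) = curv C * C - C * curv C := by
  rw [curv, d_add, d_d, d_mul, hC]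
  noncomm_ring

theorem d_mul_curv_pow {C Q : SForm S A} (hC : sgn C = -C) (hQ : sgn Q = Q)
    (hd : d Q = Q * C - C * Q) (n : ℕ) :
    d (Q * curv C ^ n) = Q * curv C ^ n * C - C * (Q * curv C ^ n) := by
  induction n with
  | zero => simpa using hd
  | succ n ih =>
    rw [pow_succ, ← mul_assoc, d_mul, ih, map_mul, map_pow, hQ, sgn_curv hC, d_curv hC]
    noncomm_ring

theorem d_trace_eq_zero (τ : A →L[ℝ] B) (hτ : ∀ a b, τ (a * b) = τ (b * a)) {C Q : SForm S A}
    (hC : sgn C = -C) (hQ : sgn Q = Q) (hd : d Q = Q * C - C * Q) (n : ℕ) :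
    d (mapVal τ (Q * curv C ^ n)) = 0 := by
  rw [d_mapVal, d_mul_curv_pow hC hQ hd, mapVal_sub, mapVal_mul_comm τ hτ, sub_self]
  rw [map_mul, map_pow, hQ, sgn_curv hC]

theorem mul_pow_of_mul_eq {R : Type*} [Ring R] {a b k : R} (h : a * b = k) (hk : k * a = k)
    (n : ℕ) : a * b ^ (n + 1) = k ^ (n + 1) := by
  induction n with
  | zero => simpa using h
  | succ n ih =>
    have h1 : k * b = k * k := by rw [← hk, mul_assoc, h, hk]
    rw [pow_succ b, ← mul_assoc, ih, pow_succ k n, mul_assoc, h1, ← mul_assoc, ← pow_succ,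
      ← pow_succ]

/-- The trace of the contraction of a power of an even form. -/
theorem mapVal_contr_pow (τ : A →L[ℝ] B) (hτ : ∀ a b, τ (a * b) = τ (b * a)) (v : V)
    {R : SForm S A} (hR : sgn R = R) (n : ℕ) :
    mapVal τ (contr v (R ^ (n + 1))) = (n + 1) • mapVal τ (contr v R * R ^ n) := by
  suffices h : ∀ n m : ℕ, mapVal τ (R ^ m * contr v (R ^ (n + 1))) =
      (n + 1) • mapVal τ (contr v R * R ^ (n + m)) by simpa using h n 0
  intro n
  induction n with
  | zero =>
    intro m
    rw [mapVal_mul_comm τ hτ (by rw [map_pow, hR])]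
    simp
  | succ n ih =>
    intro m
    have h1 : R ^ m * contr v (R ^ (n + 1 + 1)) =
        R ^ m * (contr v R * R ^ (n + 1)) + R ^ (m + 1) * contr v (R ^ (n + 1)) := by
      rw [pow_succ' R (n + 1), contr_mul, hR, pow_succ R m]
      noncomm_ring
    have h2 : mapVal τ (R ^ m * (contr v R * R ^ (n + 1))) =
        mapVal τ (contr v R * R ^ (n + 1 + m)) := by
      rw [mapVal_mul_comm τ hτ (by rw [map_pow, hR]), mul_assoc, ← pow_add]
    have h3 : ∀ f g : SForm S A, mapVal τ (f + g) = mapVal τ f + mapVal τ g := fun f g => by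
      ext y l; simp [mapVal_val]
    rw [h1, h3, h2, ih, add_smul (n + 1) 1, one_smul, add_comm, ← add_assoc,
      add_right_comm n m 1]

section Frame

variable {g gs p Q : SForm S A}

/-- The identities between a partial isometry `g`, its adjoint, and its support projections. -/
structure IsFrame (g gs p Q : SForm S A) : Prop where
  gs_g : gs * g = Q
  g_gs : g * gs = p
  g_Q : g * Q = g
  Q_gs : Q * gs = gs
  Q_Q : Q * Q = Q
  sgn_g : sgn g = g
  sgn_gs : sgn gs = gs

namespace IsFrame

theorem sgn_Q (h : IsFrame g gs p Q) : sgn Q = Q := by rw [← h.gs_g, map_mul, h.sgn_g, h.sgn_gs]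
theorem sgn_p (h : IsFrame g gs p Q) : sgn p = p := by rw [← h.g_gs, map_mul, h.sgn_g, h.sgn_gs]

theorem d_Q (h : IsFrame g gs p Q) : d Q = d gs * g + gs * d g := by
  rw [← h.gs_g, d_mul, h.sgn_gs]
theorem d_p (h : IsFrame g gs p Q) : d p = d g * gs + g * d gs := by
  rw [← h.g_gs, d_mul, h.sgn_g]
theorem d_g (h : IsFrame g gs p Q) : d g * Q + g * d Q = d g := by
  conv_rhs => rw [← h.g_Q, d_mul, h.sgn_g]
theorem d_gs (h : IsFrame g gs p Q) : d Q * gs + Q * d gs = d gs := by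
  conv_rhs => rw [← h.Q_gs, d_mul, h.sgn_Q]
theorem d_QQ (h : IsFrame g gs p Q) : d Q * Q + Q * d Q = d Q := by
  conv_rhs => rw [← h.Q_Q, d_mul, h.sgn_Q]
theorem Q_dQ_Q (h : IsFrame g gs p Q) : Q * d Q * Q = 0 := by
  linear_combination (norm := noncomm_ring) Q * h.d_QQ - h.Q_Q * d Q

/-- The connection form induced on `Im Q` by pulling back along the frame `g`, together with the
connection of the complement. -/
def form (g gs Q : SForm S A) : SForm S A := gs * d g - (1 - Q) * d Q

theorem sgn_form (h : IsFrame g gs p Q) : sgn (form g gs Q) = -form g gs Q := by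
  simp only [form, map_sub, map_mul, map_one, sgn_d, h.sgn_g, h.sgn_gs, h.sgn_Q]
  noncomm_ring

theorem Q_form (h : IsFrame g gs p Q) : Q * form g gs Q = gs * d g := by
  unfold form
  linear_combination (norm := noncomm_ring) h.Q_gs * d g + h.Q_Q * d Q

theorem compl_form (h : IsFrame g gs p Q) : (1 - Q) * form g gs Q = -((1 - Q) * d Q) := by
  have h1 := h.Q_form
  have : (1 - Q) * form g gs Q = form g gs Q - Q * form g gs Q := by noncomm_ring
  rw [this, h1, form]
  noncomm_ring

theorem d_Q_eq (h : IsFrame g gs p Q) :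
    d Q = Q * form g gs Q - form g gs Q * Q := by
  rw [h.Q_form]
  unfold form
  have h1 : gs * (d g * Q) = gs * d g - Q * d Q := by
    linear_combination (norm := noncomm_ring) gs * h.d_g - h.gs_g * d Q
  linear_combination (norm := noncomm_ring) h1 - h.d_QQ + h.Q_dQ_Q

/-- The curvature of the pulled back connection. -/
theorem Q_curv_form (h : IsFrame g gs p Q) :
    Q * curv (form g gs Q) = gs * (d p * d p) * g := by
  have e1 : gs * d p = d gs * (1 - p) := by
    rw [h.d_p, ← h.g_gs]
    linear_combination (norm := noncomm_ring) h.gs_g * d gs - h.d_Q * gs + h.d_gs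
  have e2 : d p * g = (1 - p) * d g := by
    rw [h.d_p, ← h.g_gs]
    linear_combination (norm := noncomm_ring) d g * h.gs_g - g * h.d_Q + h.d_g
  have e3 : (1 - p) * (1 - p) = 1 - p := by
    rw [← h.g_gs]
    linear_combination (norm := noncomm_ring) g * h.gs_g * gs + g * h.Q_gs
  have e4 : gs * (d p * d p) * g = d gs * (1 - p) * d g := by
    calc gs * (d p * d p) * g = (gs * d p) * (d p * g) := by noncomm_ring
      _ = d gs * ((1 - p) * (1 - p)) * d g := by rw [e1, e2]; noncomm_ring
      _ = _ := by rw [e3]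
  have h1 : gs * (d g * Q) = gs * d g - Q * d Q := by
    linear_combination (norm := noncomm_ring) gs * h.d_g - h.gs_g * d Q
  have h2 : d (form g gs Q) = d gs * d g + d Q * d Q := by
    rw [form, d_sub, d_mul, d_mul, d_d, d_d, d_sub, d_one]
    noncomm_ring
  have h3 : Q * curv (form g gs Q) = Q * (d gs * d g + d Q * d Q) + gs * d g * form g gs Q := by
    rw [curv, mul_add, h2, ← mul_assoc Q (form g gs Q), h.Q_form]
  rw [e4, h3, ← h.g_gs, form]
  linear_combination (norm := noncomm_ring) h.d_gs * d g - h.d_Q * gs * d g + h1 * d Q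

theorem trace_form (h : IsFrame g gs p Q) (τ : A →L[ℝ] B) (hτ : ∀ a b, τ (a * b) = τ (b * a))
    (n : ℕ) : mapVal τ (Q * curv (form g gs Q) ^ (n + 1)) =
      mapVal τ (p * (d p * d p) ^ (n + 1)) := by
  have hp : p * (d p * d p) = (d p * d p) * p := by
    have hpp : p * p = p := by
      rw [← h.g_gs]
      linear_combination (norm := noncomm_ring) g * h.gs_g * gs + g * h.Q_gs
    have hd : d p * p + p * d p = d p := by
      conv_rhs => rw [← hpp, d_mul, h.sgn_p]
    linear_combination (norm := noncomm_ring) hd * d p - d p * hd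
  have hpg : p * g = g := by rw [← h.g_gs, mul_assoc, h.gs_g, h.g_Q]
  have hK : gs * (d p * d p) * g * Q = gs * (d p * d p) * g := by rw [mul_assoc, h.g_Q]
  rw [mul_pow_of_mul_eq h.Q_curv_form hK]
  have hpow : ∀ n : ℕ, (gs * (d p * d p) * g) ^ (n + 1) = gs * (d p * d p) ^ (n + 1) * g := by
    intro n
    induction n with
    | zero => simp
    | succ n ih =>
      rw [pow_succ, ih]
      calc gs * (d p * d p) ^ (n + 1) * g * (gs * (d p * d p) * g)
          = gs * (d p * d p) ^ (n + 1) * (g * gs * (d p * d p)) * g := by noncomm_ring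
        _ = gs * (d p * d p) ^ (n + 1) * ((d p * d p) * p) * g := by rw [h.g_gs, hp]
        _ = gs * ((d p * d p) ^ (n + 1) * (d p * d p)) * (p * g) := by noncomm_ring
        _ = _ := by rw [hpg, ← pow_succ]
  rw [hpow, ← mapVal_mul_comm τ hτ h.sgn_g, ← mul_assoc, h.g_gs]

end IsFrame

/-- The curvature on the complement is determined by the complementary part of the connection. -/
theorem compl_curv {C : SForm S A} (hQ : sgn Q = Q) (hQQ : Q * Q = Q)
    (hC : (1 - Q) * C = -((1 - Q) * d Q)) : (1 - Q) * curv C = d Q * d Q * (1 - Q) := by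
  have hd : d Q * Q + Q * d Q = d Q := by
    conv_rhs => rw [← hQQ, d_mul, hQ]
  have h1 : (1 - Q) * d C - d Q * C = d Q * d Q := by
    have h2 := congrArg d hC
    rw [d_mul, d_neg, d_mul, d_sub, d_one, d_d, map_sub, map_one, hQ] at h2
    linear_combination (norm := noncomm_ring) h2
  unfold curv
  linear_combination (norm := noncomm_ring) h1 + hC * C + d Q * hC + hd * C + d Q * hd

end Frame

end SForm

end HolChern

namespace HolChern

namespace SForm

variable {V W A B : Type*} [NormedAddCommGroup V] [NormedSpace ℝ V]
  [NormedAddCommGroup W] [NormedSpace ℝ W]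
  [NormedRing A] [NormedAlgebra ℝ A] [NormedRing B] [NormedAlgebra ℝ B]
  {S : Dom V} {T : Dom W}

section Gauge

variable {u h C : SForm S A}

theorem d_inv (hu : sgn u = u) (huh : u * h = 1) : d u * h + u * d h = 0 := by
  have := d_mul u h
  rw [huh, d_one, hu] at this
  exact this.symm

theorem sgn_gauge (hu : sgn u = u) (hh : sgn h = h) (hC : sgn C = -C) :
    sgn (u * d h + u * C * h) = -(u * d h + u * C * h) := by
  simp only [map_add, map_mul, sgn_d, hu, hh, hC]
  noncomm_ring

/-- The curvature of a gauge transform. -/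
theorem curv_gauge (hu : sgn u = u) (hC : sgn C = -C) (huh : u * h = 1)
    (hhu : h * u = 1) : curv (u * d h + u * C * h) = u * curv C * h := by
  have h1 := d_inv hu huh
  have h2 : d u = -(u * d h * u) := by
    have : d u = d u * h * u := by rw [mul_assoc, hhu, mul_one]
    rw [this, eq_neg_of_add_eq_zero_left h1, neg_mul]
  have h3 : d (u * d h + u * C * h) = d u * d h + d u * C * h + u * d C * h - u * C * d h := by
    rw [d_add, d_mul, d_d, d_mul, d_mul, map_mul, hu, hC]
    noncomm_ring
  have h4 : u * C * h * (u * d h) = u * C * d h := by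
    rw [mul_assoc (u * C), ← mul_assoc h, hhu, one_mul]
  have h5 : u * C * h * (u * C * h) = u * (C * C) * h := by
    calc u * C * h * (u * C * h) = u * C * (h * u) * C * h := by noncomm_ring
      _ = _ := by rw [hhu]; noncomm_ring
  have h6 : u * d h * (u * d h + u * C * h) = -(d u * d h + d u * C * h) := by
    rw [h2]; noncomm_ring
  rw [curv, curv, h3, add_mul, h6, mul_add (u * C * h), h4, h5]
  noncomm_ring

theorem trace_gauge (τ : A →L[ℝ] B) (hτ : ∀ a b, τ (a * b) = τ (b * a))
    (hu : sgn u = u) (hC : sgn C = -C) (huh : u * h = 1) (hhu : h * u = 1) (n : ℕ) :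
    mapVal τ (curv (u * d h + u * C * h) ^ n) = mapVal τ (curv C ^ n) := by
  have hpow : ∀ n : ℕ, (u * curv C * h) ^ n = u * (curv C ^ n * h) := by
    intro n
    induction n with
    | zero => simp [huh]
    | succ n ih =>
      calc (u * curv C * h) ^ (n + 1) = u * (curv C ^ n * h) * (u * curv C * h) := by
            rw [pow_succ, ih]
        _ = u * (curv C ^ n * (h * u) * curv C * h) := by noncomm_ring
        _ = _ := by rw [hhu, mul_one, ← pow_succ]
  rw [curv_gauge hu hC huh hhu, hpow, mapVal_mul_comm τ hτ hu, mul_assoc, hhu, mul_one]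

/-- The connection form of a direct sum pulled back along `g ⊕ id`. -/
theorem gauge_frame {g gs Q : SForm S A} (hf : IsFrame g gs Q Q) :
    (gs + (1 - Q)) * d (g + (1 - Q)) +
        (gs + (1 - Q)) * (Q * d Q - (1 - Q) * d Q) * (g + (1 - Q)) =
      IsFrame.form g gs Q := by
  have hQg : Q * g = g := by
    rw [← hf.g_gs, mul_assoc, hf.gs_g, hf.g_Q]
  have hgsQ : gs * Q = gs := by
    rw [← hf.g_gs, ← mul_assoc, hf.gs_g, hf.Q_gs]
  have e1 : d Q * g + Q * d g = d g := by
    conv_rhs => rw [← hQg, d_mul, hf.sgn_Q]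
  have z := hf.Q_dQ_Q
  have dq := hf.d_QQ
  have z1 : (1 - Q) * d Q = d Q * Q := by linear_combination (norm := noncomm_ring) -dq
  have z2 : Q * d Q = d Q * (1 - Q) := by linear_combination (norm := noncomm_ring) dq
  have p1 : (gs + (1 - Q)) * (Q * d Q - (1 - Q) * d Q) = gs * d Q - (1 - Q) * d Q := by
    linear_combination (norm := noncomm_ring) 2 • (hgsQ * d Q) - 2 • (hf.Q_Q * d Q)
  have p2 : gs * d Q * (g + (1 - Q)) = gs * d Q := by
    have a1 : gs * d Q * Q = 0 := by
      rw [← hgsQ, mul_assoc gs, mul_assoc gs, z, mul_zero]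
    have a2 : gs * d Q * g = 0 := by rw [← hQg, ← mul_assoc, a1, zero_mul]
    linear_combination (norm := noncomm_ring) a2 - a1
  have p3 : (1 - Q) * d Q * (g + (1 - Q)) = d Q * g := by
    rw [z1]
    linear_combination (norm := noncomm_ring) d Q * hQg - d Q * hf.Q_Q
  have p4 : (1 - Q) * d g = d Q * g := by linear_combination (norm := noncomm_ring) -e1
  rw [p1, sub_mul, p2, p3, IsFrame.form, d_add, d_sub, d_one]
  linear_combination (norm := noncomm_ring) p4

end Gauge

section Star

variable [StarRing A] [StarModule ℝ A] [ContinuousStar A]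

theorem star_curv {C : SForm S A} (hC : sgn C = -C) (hs : star C = -C) :
    star (curv C) = curv C := by
  rw [curv, star_add, star_mul, star_d, hs, map_neg, hC, neg_neg, neg_mul_neg]

theorem IsFrame.star_form {g gs p Q : SForm S A} (h : IsFrame g gs p Q) (hg : star g = gs) :
    star (IsFrame.form g gs Q) = -IsFrame.form g gs Q := by
  have hgs : star gs = g := by rw [← hg, star_star]
  have hQ : star Q = Q := by rw [← h.gs_g, star_mul, hg, hgs]
  rw [IsFrame.form, star_sub, star_mul, star_mul, star_d, star_d, hg, hgs, hQ, h.sgn_gs, h.sgn_Q,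
    star_sub, star_one, hQ]
  linear_combination (norm := noncomm_ring) -h.d_Q + h.d_QQ

theorem star_gauge {u h C : SForm S A} (hu : sgn u = u) (huh : u * h = 1)
    (hsu : star h = u) (hC : star C = -C) :
    star (u * d h + u * C * h) = -(u * d h + u * C * h) := by
  have hsu' : star u = h := by rw [← hsu, star_star]
  rw [star_add, star_mul, star_mul, star_mul, star_d, hsu, hsu', hC, hu]
  linear_combination (norm := noncomm_ring) d_inv hu huh

/-- The trace of `Q R^n` is real up to the sign of the degree. -/
theorem mapVal_mul_curv_pow_star [StarRing B] (τ : A →L[ℝ] B)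
    (hτ : ∀ a b, τ (a * b) = τ (b * a)) (hs : ∀ a, τ (star a) = star (τ a)) {C Q : SForm S A}
    (hC : sgn C = -C) (hC' : star C = -C) (hQ : star Q = Q) (n : ℕ) (y : S.carrier) :
    star ((mapVal τ (Q * curv C ^ n)).1 y) = (mapVal τ (Q * curv C ^ n)).1 y := by
  have h1 : ∀ f : SForm S A, star ((mapVal τ f).1 y) = (mapVal τ (star f)).1 y := by
    intro f
    ext l
    rw [LForm.star_apply, mapVal_val, mapVal_val, star_val, LForm.mapVal_apply,
      LForm.mapVal_apply, LForm.star_apply, map_zsmul]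
    congr 1
    exact (hs _).symm
  rw [h1, star_mul, star_pow, star_curv hC hC', hQ, mapVal_mul_comm τ hτ]
  rw [map_pow, sgn_curv hC]

end Star

end SForm

end HolChern

namespace HolChern

/-! ### Smooth dependence on parameters -/

section Curry

variable {E F : Type*} [NormedAddCommGroup E] [NormedSpace ℝ E]
  [NormedAddCommGroup F] [NormedSpace ℝ F]

/-- Every point has arbitrarily small neighbourhoods with convex intersection with the set. -/
def LocConvex (s : Set E) : Prop := ∀ x ∈ s, ∃ u ∈ 𝓝 x, ∀ ε > 0, Convex ℝ (s ∩ (u ∩ Metric.ball x ε))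

open Classical in
/-- A function on `E × ℝ` as a function on `E` with values in the continuous functions on `[0, 1]`. -/
def curryOn (f : E × ℝ → F) (x : E) : C(unitInterval, F) :=
  if h : Continuous fun t : unitInterval => f (x, t) then ⟨_, h⟩ else 0

variable {s : Set E} {f : E × ℝ → F}

theorem continuous_slice (hf : ContinuousOn f (s ×ˢ univ)) {x : E} (hx : x ∈ s) :
    Continuous fun t : ℝ => f (x, t) :=
  hf.comp_continuous (by fun_prop) fun _ => ⟨hx, mem_univ _⟩

theorem curryOn_apply (hf : ContinuousOn f (s ×ˢ univ)) {x : E} (hx : x ∈ s) (t : unitInterval) :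
    curryOn f x t = f (x, t) := by
  have h : Continuous fun t : unitInterval => f (x, t) :=
    (continuous_slice hf hx).comp continuous_subtype_val
  rw [curryOn, dif_pos h]; rfl

/-- The derivative of `f` in the direction of the parameters. -/
def derivFst (s : Set E) (f : E × ℝ → F) (v : E) (z : E × ℝ) : F :=
  fderivWithin ℝ f (s ×ˢ univ) z (v, 0)

theorem contDiffOn_derivFst (hs : UniqueDiffOn ℝ s) (hf : ContDiffOn ℝ ∞ f (s ×ˢ univ)) (v : E) :
    ContDiffOn ℝ ∞ (derivFst s f v) (s ×ˢ univ) :=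
  (hf.fderivWithin (hs.prod uniqueDiffOn_univ) (by simp)).clm_apply contDiffOn_const

variable [FiniteDimensional ℝ E]

theorem hasFDerivWithinAt_curryOn (hs : UniqueDiffOn ℝ s) (hc : LocConvex s)
    (hf : ContDiffOn ℝ ∞ f (s ×ˢ univ)) {x : E} (hx : x ∈ s) :
    ∃ L : E →L[ℝ] C(unitInterval, F), HasFDerivWithinAt (curryOn f) L s x ∧
      ∀ v, L v = curryOn (derivFst s f v) x := by
  have hD : ∀ v, ContinuousOn (derivFst s f v) (s ×ˢ univ) := fun v =>
    (contDiffOn_derivFst hs hf v).continuousOn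
  let L : E →L[ℝ] C(unitInterval, F) := LinearMap.toContinuousLinearMap
    { toFun := fun v => curryOn (derivFst s f v) x
      map_add' := fun v w => by
        ext t
        rw [ContinuousMap.add_apply, curryOn_apply (hD _) hx, curryOn_apply (hD _) hx,
          curryOn_apply (hD _) hx, derivFst, derivFst, derivFst, ← map_add]
        simp
      map_smul' := fun c v => by
        ext t
        rw [RingHom.id_apply, ContinuousMap.smul_apply, curryOn_apply (hD _) hx,
          curryOn_apply (hD _) hx, derivFst, derivFst, ← map_smul]
        simp }
  refine ⟨L, ?_, fun v => rfl⟩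
  have hL : ∀ v (t : unitInterval), L v t = fderivWithin ℝ f (s ×ˢ univ) (x, t) (v, 0) :=
    fun v t => curryOn_apply (hD v) hx t
  rw [hasFDerivWithinAt_iff_isLittleO, Asymptotics.isLittleO_iff]
  intro c hc0
  obtain ⟨u, hu, hconv⟩ := hc x hx
  have hcont : ContinuousOn (fderivWithin ℝ f (s ×ˢ univ)) (s ×ˢ univ) :=
    hf.continuousOn_fderivWithin (hs.prod uniqueDiffOn_univ) (by simp)
  have htube : ∀ᶠ z in 𝓝 x, ∀ t ∈ Icc (0 : ℝ) 1, z ∈ s →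
      ‖fderivWithin ℝ f (s ×ˢ univ) (z, t) - fderivWithin ℝ f (s ×ˢ univ) (x, t)‖ ≤ c := by
    refine isCompact_Icc.eventually_forall_of_forall_eventually fun t _ => ?_
    have h1 := hcont (x, t) ⟨hx, mem_univ _⟩
    have h2 : ContinuousWithinAt (fun z : E × ℝ => fderivWithin ℝ f (s ×ˢ univ) (x, z.2))
        (s ×ˢ univ) (x, t) :=
      ContinuousWithinAt.comp (t := s ×ˢ univ) (f := fun z : E × ℝ => (x, z.2)) (by exact h1)
        (by fun_prop) fun z _ => ⟨hx, mem_univ _⟩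
    have h3 : ∀ᶠ z in 𝓝[s ×ˢ univ] (x, t), ‖fderivWithin ℝ f (s ×ˢ univ) z -
        fderivWithin ℝ f (s ×ˢ univ) (x, z.2)‖ ≤ c :=
      ((h1.sub h2).norm).eventually_le_const (by simpa using hc0)
    rw [eventually_nhdsWithin_iff] at h3
    filter_upwards [h3] with z hz hzs using hz ⟨hzs, mem_univ _⟩
  obtain ⟨ε, hε, hball⟩ := Metric.eventually_nhds_iff_ball.1 htube
  have hmem : ∀ᶠ y in 𝓝[s] x, y ∈ s ∩ (u ∩ Metric.ball x ε) :=
    Filter.inter_mem self_mem_nhdsWithin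
      (nhdsWithin_le_nhds (Filter.inter_mem hu (Metric.ball_mem_nhds x hε)))
  have hx' : x ∈ s ∩ (u ∩ Metric.ball x ε) := ⟨hx, mem_of_mem_nhds hu, Metric.mem_ball_self hε⟩
  filter_upwards [hmem] with y hy
  rw [ContinuousMap.norm_le _ (by positivity)]
  intro t
  rw [ContinuousMap.sub_apply, ContinuousMap.sub_apply, curryOn_apply hf.continuousOn hy.1,
    curryOn_apply hf.continuousOn hx, hL]
  have hder : ∀ z ∈ s ∩ (u ∩ Metric.ball x ε), HasFDerivWithinAt (fun z => f (z, (t : ℝ)))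
      ((fderivWithin ℝ f (s ×ˢ univ) (z, t)).comp (ContinuousLinearMap.inl ℝ E ℝ))
      (s ∩ (u ∩ Metric.ball x ε)) z := by
    intro z hz
    have h1 := (hf.differentiableOn (by simp) (z, (t : ℝ)) ⟨hz.1, mem_univ _⟩).hasFDerivWithinAt
    exact h1.comp z ((hasFDerivAt_prodMk_left z (t : ℝ)).hasFDerivWithinAt)
      fun w hw => mk_mem_prod hw.1 (mem_univ _)
  have := (hconv ε hε).norm_image_sub_le_of_norm_hasFDerivWithin_le' (f := fun z => f (z, (t : ℝ)))
    (φ := (fderivWithin ℝ f (s ×ˢ univ) (x, t)).comp (ContinuousLinearMap.inl ℝ E ℝ)) (C := c)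
    hder (fun z hz => ?_) hx' hy
  · simpa using this
  · rw [← ContinuousLinearMap.sub_comp]
    refine (ContinuousLinearMap.opNorm_comp_le _ _).trans ?_
    have h1 := hball z hz.2.2 t t.2 hz.1
    have h2 : ‖ContinuousLinearMap.inl ℝ E ℝ‖ ≤ 1 := ContinuousLinearMap.norm_inl_le_one ℝ E ℝ
    calc _ ≤ c * 1 := by gcongr
      _ = c := mul_one c

theorem contDiffOn_curryOn (hs : UniqueDiffOn ℝ s) (hc : LocConvex s)
    (hf : ContDiffOn ℝ ∞ f (s ×ˢ univ)) : ContDiffOn ℝ ∞ (curryOn f) s := by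
  rw [contDiffOn_infty]
  intro n
  induction n generalizing f with
  | zero =>
    refine contDiffOn_zero.2 fun x hx => ?_
    obtain ⟨L, hL, -⟩ := hasFDerivWithinAt_curryOn hs hc hf hx
    exact hL.continuousWithinAt
  | succ n ih =>
    push_cast
    rw [contDiffOn_succ_iff_fderiv_apply hs]
    refine ⟨fun x hx => ?_, by simp, fun v => ?_⟩
    · obtain ⟨L, hL, -⟩ := hasFDerivWithinAt_curryOn hs hc hf hx
      exact hL.differentiableWithinAt
    · refine (ih (contDiffOn_derivFst hs hf v)).congr fun x hx => ?_
      obtain ⟨L, hL, hL'⟩ := hasFDerivWithinAt_curryOn hs hc hf hx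
      rw [hL.fderivWithin (hs x hx), hL']

/-- Integration over `[0, 1]`, as a continuous linear map. -/
def integralC [CompleteSpace F] : C(unitInterval, F) →L[ℝ] F :=
  LinearMap.mkContinuous
    { toFun := fun φ => ∫ t in (0 : ℝ)..1, φ (projIcc 0 1 zero_le_one t)
      map_add' := fun φ ψ => by
        simp only [ContinuousMap.add_apply]
        exact intervalIntegral.integral_add
          ((φ.continuous.comp continuous_projIcc).intervalIntegrable _ _)
          ((ψ.continuous.comp continuous_projIcc).intervalIntegrable _ _)
      map_smul' := fun c φ => by
        simp only [ContinuousMap.smul_apply]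
        exact intervalIntegral.integral_smul c _ } 1 fun φ => by
    have := intervalIntegral.norm_integral_le_of_norm_le_const (a := (0 : ℝ)) (b := 1)
      (f := fun t => φ (projIcc 0 1 zero_le_one t)) (C := ‖φ‖) fun t _ => φ.norm_coe_le_norm _
    simpa using this

theorem integralC_apply [CompleteSpace F] (φ : C(unitInterval, F)) :
    integralC φ = ∫ t in (0 : ℝ)..1, φ (projIcc 0 1 zero_le_one t) := rfl

/-- Integration over `[0, 1]` of a function depending on parameters. -/
def paramInt (f : E × ℝ → F) (x : E) : F := ∫ t in (0 : ℝ)..1, f (x, t)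

theorem paramInt_eq [CompleteSpace F] (hf : ContinuousOn f (s ×ˢ univ)) {x : E} (hx : x ∈ s) :
    paramInt f x = integralC (curryOn f x) := by
  rw [integralC_apply, paramInt]
  refine intervalIntegral.integral_congr fun t ht => ?_
  rw [uIcc_of_le zero_le_one] at ht
  rw [curryOn_apply hf hx, projIcc_of_mem _ ht]

theorem contDiffOn_paramInt [CompleteSpace F] (hs : UniqueDiffOn ℝ s) (hc : LocConvex s)
    (hf : ContDiffOn ℝ ∞ f (s ×ˢ univ)) : ContDiffOn ℝ ∞ (paramInt f) s :=
  ((integralC (F := F)).contDiff.comp_contDiffOn (contDiffOn_curryOn hs hc hf)).congr fun _ hx =>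
    paramInt_eq hf.continuousOn hx

theorem fderivWithin_paramInt [CompleteSpace F] (hs : UniqueDiffOn ℝ s) (hc : LocConvex s)
    (hf : ContDiffOn ℝ ∞ f (s ×ˢ univ)) {x : E} (hx : x ∈ s) (v : E) :
    fderivWithin ℝ (paramInt f) s x v = paramInt (derivFst s f v) x := by
  obtain ⟨L, hL, hL'⟩ := hasFDerivWithinAt_curryOn hs hc hf hx
  have h1 : HasFDerivWithinAt (fun y => integralC (curryOn f y)) (integralC.comp L) s x :=
    (integralC (F := F)).hasFDerivAt.comp_hasFDerivWithinAt x hL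
  rw [fderivWithin_congr (fun y hy => paramInt_eq hf.continuousOn hy)
    (paramInt_eq hf.continuousOn hx), h1.fderivWithin (hs x hx), ContinuousLinearMap.comp_apply,
    hL', paramInt_eq (contDiffOn_derivFst hs hf v).continuousOn hx]

omit [FiniteDimensional ℝ E] in
theorem LocConvex.prod_univ {G : Type*} [NormedAddCommGroup G] [NormedSpace ℝ G]
    (hc : LocConvex s) : LocConvex (s ×ˢ (univ : Set G)) := by
  rintro ⟨x, g⟩ ⟨hx, -⟩
  obtain ⟨u, hu, h⟩ := hc x hx
  refine ⟨u ×ˢ univ, prod_mem_nhds hu univ_mem, fun ε hε => ?_⟩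
  have : s ×ˢ (univ : Set G) ∩ (u ×ˢ univ ∩ Metric.ball (x, g) ε) =
      (s ∩ (u ∩ Metric.ball x ε)) ×ˢ Metric.ball g ε := by
    rw [← ball_prod_same]
    ext ⟨a, b⟩
    simp only [mem_inter_iff, mem_prod, mem_univ, and_true]
    tauto
  rw [this]
  exact (h ε hε).prod (convex_ball g ε)

end Curry

section ODE

theorem isUnit_one_sub_of_norm_pow_lt_one {R : Type*} [NormedRing R] [CompleteSpace R] {x : R}
    {n : ℕ} (h : ‖x ^ n‖ < 1) : IsUnit (1 - x) := by
  have h2 : IsUnit (1 - x ^ n) := isUnit_one_sub_of_norm_lt_one h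
  have h3 : Commute (1 - x) (∑ i ∈ Finset.range n, x ^ i) := by
    rw [Commute, SemiconjBy, mul_neg_geom_sum, geom_sum_mul_neg]
  rw [← mul_neg_geom_sum] at h2
  exact (h3.isUnit_mul_iff.1 h2).1

theorem contDiffAt_inverse_one_sub {R : Type*} [NormedRing R] [NormedAlgebra ℝ R] [CompleteSpace R]
    {x : R} (h : IsUnit (1 - x)) : ContDiffAt ℝ ∞ (fun y : R => Ring.inverse (1 - y)) x := by
  obtain ⟨u, hu⟩ := h
  have h2 := contDiffAt_ringInverse (n := ∞) ℝ u
  rw [hu] at h2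
  exact h2.comp x (contDiff_const.sub contDiff_id).contDiffAt

variable {A : Type*} [NormedRing A] [NormedAlgebra ℝ A] [CompleteSpace A]

theorem contDiff_inverse_one_sub_comp_mul {R : Type*} [NormedRing R] [NormedAlgebra ℝ R]
    [CompleteSpace R] (T : R →L[ℝ] R)
    (h : ∀ k : R, IsUnit (1 - T.comp (ContinuousLinearMap.mul ℝ R k))) (a : R) :
    ContDiff ℝ ∞ fun k : R => Ring.inverse (1 - T.comp (ContinuousLinearMap.mul ℝ R k)) a := by
  let L : R →L[ℝ] R →L[ℝ] R :=
    (ContinuousLinearMap.compL ℝ R R R T).comp (ContinuousLinearMap.mul ℝ R)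
  have hL : ContDiff ℝ ∞ L := L.contDiff
  have h1 : ContDiff ℝ ∞ fun k => Ring.inverse (1 - L k) := by
    refine contDiff_iff_contDiffAt.2 fun k => ?_
    have hg : ContDiffAt ℝ ∞ (fun y : R →L[ℝ] R => Ring.inverse (1 - y)) (L k) :=
      contDiffAt_inverse_one_sub (R := R →L[ℝ] R) (h k)
    exact hg.comp k hL.contDiffAt
  exact h1.clm_apply contDiff_const

/-- The primitive vanishing at `0` of a continuous function on `[0, 1]`. -/
def primitiveC : C(unitInterval, A) →L[ℝ] C(unitInterval, A) :=
  LinearMap.mkContinuous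
    { toFun := fun φ => ⟨fun s => ∫ t in (0 : ℝ)..s, φ (projIcc 0 1 zero_le_one t), by
        have h : Continuous fun t : ℝ => φ (projIcc 0 1 zero_le_one t) :=
          φ.continuous.comp continuous_projIcc
        exact (intervalIntegral.continuous_primitive
          (fun a b => h.intervalIntegrable a b) 0).comp continuous_subtype_val⟩
      map_add' := fun φ ψ => by
        ext s
        exact intervalIntegral.integral_add
          ((φ.continuous.comp continuous_projIcc).intervalIntegrable _ _)
          ((ψ.continuous.comp continuous_projIcc).intervalIntegrable _ _)
      map_smul' := fun c φ => by
        ext s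
        exact intervalIntegral.integral_smul c _ } 1 fun φ => by
    rw [one_mul, ContinuousMap.norm_le _ (norm_nonneg _)]
    intro s
    have := intervalIntegral.norm_integral_le_of_norm_le_const (a := (0 : ℝ)) (b := s)
      (f := fun t => φ (projIcc 0 1 zero_le_one t)) (C := ‖φ‖) fun t _ => φ.norm_coe_le_norm _
    refine this.trans ?_
    rw [sub_zero, abs_of_nonneg s.2.1]
    exact mul_le_of_le_one_right (norm_nonneg _) s.2.2

theorem primitiveC_apply (φ : C(unitInterval, A)) (s : unitInterval) :
    primitiveC φ s = ∫ t in (0 : ℝ)..s, φ (projIcc 0 1 zero_le_one t) := rfl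

/-- The Volterra operator `φ ↦ ∫₀ k φ`. -/
def volterra : C(unitInterval, A) →L[ℝ] C(unitInterval, A) →L[ℝ] C(unitInterval, A) :=
  (ContinuousLinearMap.compL ℝ _ _ _ primitiveC).comp (ContinuousLinearMap.mul ℝ C(unitInterval, A))

theorem volterra_apply (k φ : C(unitInterval, A)) : volterra k φ = primitiveC (k * φ) := rfl

theorem norm_volterra_pow_le (k φ : C(unitInterval, A)) (n : ℕ) (s : unitInterval) :
    ‖((volterra k) ^ n) φ s‖ ≤ ‖φ‖ * (‖k‖ ^ n * (s : ℝ) ^ n / n.factorial) := by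
  induction n generalizing s with
  | zero => simpa using φ.norm_coe_le_norm s
  | succ n ih =>
    rw [pow_succ', mul_apply_eq_comp, volterra_apply, primitiveC_apply]
    have h1 : ∀ t ∈ Ioc (0 : ℝ) s, ‖(k * (volterra k ^ n) φ) (projIcc 0 1 zero_le_one t)‖ ≤
        ‖φ‖ * ‖k‖ ^ (n + 1) / n.factorial * t ^ n := by
      intro t ht
      have ht' : t ∈ Icc (0 : ℝ) 1 := ⟨ht.1.le, ht.2.trans s.2.2⟩
      rw [projIcc_of_mem _ ht', ContinuousMap.mul_apply]
      refine (norm_mul_le _ _).trans ?_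
      have h2 := ih ⟨t, ht'⟩
      calc _ ≤ ‖k‖ * (‖φ‖ * (‖k‖ ^ n * t ^ n / n.factorial)) :=
            mul_le_mul (k.norm_coe_le_norm _) h2 (norm_nonneg _) (norm_nonneg _)
        _ = _ := by rw [pow_succ]; ring
    have h3 := intervalIntegral.norm_integral_le_of_norm_le (μ := volume) s.2.1
      (Eventually.of_forall h1)
      ((continuous_const.mul (continuous_pow n)).intervalIntegrable 0 (s : ℝ))
    refine h3.trans (le_of_eq ?_)
    rw [intervalIntegral.integral_const_mul, integral_pow, Nat.factorial_succ]
    push_cast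
    field_simp
    simp

theorem isUnit_one_sub_volterra (k : C(unitInterval, A)) : IsUnit (1 - volterra k) := by
  obtain ⟨n, hn⟩ : ∃ n : ℕ, ‖k‖ ^ n / n.factorial < 1 :=
    ((FloorSemiring.tendsto_pow_div_factorial_atTop ‖k‖).eventually (gt_mem_nhds one_pos)).exists
  have h1 : ‖volterra k ^ n‖ < 1 := by
    refine lt_of_le_of_lt (ContinuousLinearMap.opNorm_le_bound _ (by positivity) fun φ => ?_) hn
    rw [ContinuousMap.norm_le _ (by positivity)]
    intro s
    refine (norm_volterra_pow_le k φ n s).trans ?_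
    rw [mul_comm]
    have : (s : ℝ) ^ n ≤ 1 := pow_le_one₀ s.2.1 s.2.2
    have h2 : ‖k‖ ^ n * (s : ℝ) ^ n ≤ ‖k‖ ^ n := mul_le_of_le_one_right (by positivity) this
    gcongr
  exact isUnit_one_sub_of_norm_pow_lt_one
    (R := C(unitInterval, A) →L[ℝ] C(unitInterval, A)) h1

/-- The solution of `φ = 1 + ∫₀ k φ`. -/
def volterraSol (k : C(unitInterval, A)) : C(unitInterval, A) := Ring.inverse (1 - volterra k) 1

theorem volterraSol_eq (k : C(unitInterval, A)) :
    volterraSol k = 1 + volterra k (volterraSol k) := by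
  have h := congrArg (fun T => T (1 : C(unitInterval, A)))
    (Ring.mul_inverse_cancel _ (isUnit_one_sub_volterra k))
  simp only [mul_apply_eq_comp] at h
  have h' : volterraSol k - volterra k (volterraSol k) = 1 := h
  rw [← h', sub_add_cancel]

theorem eq_volterraSol {k φ : C(unitInterval, A)} (h : φ = 1 + volterra k φ) :
    φ = volterraSol k := by
  have h1 : (1 - volterra k) φ = 1 := by
    change φ - volterra k φ = 1
    rw [sub_eq_iff_eq_add]; exact h
  have h2 := congrArg (fun T => T φ) (Ring.inverse_mul_cancel _ (isUnit_one_sub_volterra k))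
  simp only [mul_apply_eq_comp, h1] at h2
  exact h2.symm

theorem contDiff_volterraSol : ContDiff ℝ ∞ (volterraSol (A := A)) := by
  exact contDiff_inverse_one_sub_comp_mul (primitiveC (A := A)) isUnit_one_sub_volterra 1

variable {E : Type*} [NormedAddCommGroup E] [NormedSpace ℝ E]
  {s : Set E} {K : E × ℝ → A}

/-- The coefficients of a linear equation, with time rescaled to `[0, 1]`. -/
def rescale (K : E × ℝ → A) (z : (E × ℝ) × ℝ) : A := z.1.2 • K (z.1.1, z.1.2 * z.2)

/-- The solution of the linear equation `U' = K U`, `U(0) = 1`. -/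
def linSol (K : E × ℝ → A) (z : E × ℝ) : A := volterraSol (curryOn (rescale K) z) 1

theorem contDiffOn_rescale (hK : ContDiffOn ℝ ∞ K (s ×ˢ univ)) :
    ContDiffOn ℝ ∞ (rescale K) ((s ×ˢ univ) ×ˢ univ) := by
  refine ContDiffOn.smul (contDiff_snd.comp contDiff_fst).contDiffOn ?_
  refine hK.comp (t := s ×ˢ univ) (f := fun z : (E × ℝ) × ℝ => (z.1.1, z.1.2 * z.2)) ?_ ?_
  · fun_prop
  · rintro z ⟨⟨hz, -⟩, -⟩
    exact ⟨hz, mem_univ _⟩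

theorem curryOn_rescale_apply (hK : ContDiffOn ℝ ∞ K (s ×ˢ univ)) {x : E} (hx : x ∈ s) (t : ℝ)
    (r : unitInterval) : curryOn (rescale K) (x, t) r = t • K (x, t * r) :=
  curryOn_apply (contDiffOn_rescale hK).continuousOn (x := (x, t))
    (mk_mem_prod hx (mem_univ t)) r

theorem volterraSol_rescale (hK : ContDiffOn ℝ ∞ K (s ×ˢ univ)) {x : E} (hx : x ∈ s) (t : ℝ)
    (r : unitInterval) :
    volterraSol (curryOn (rescale K) (x, t)) r = linSol K (x, t * r) := by
  set W := volterraSol (curryOn (rescale K) (x, t)) with hW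
  have hmem : ∀ r' : ℝ, r' ∈ Icc (0 : ℝ) 1 → r * r' ∈ Icc (0 : ℝ) 1 := fun r' h =>
    ⟨mul_nonneg r.2.1 h.1, mul_le_one₀ r.2.2 h.1 h.2⟩
  let φ : C(unitInterval, A) := ⟨fun r' => W ⟨r * r', hmem r' r'.2⟩, by fun_prop⟩
  have h : φ = 1 + volterra (curryOn (rescale K) (x, t * r)) φ := by
    ext r'
    have h1 := congrArg (fun f => f ⟨r * r', hmem r' r'.2⟩)
      (volterraSol_eq (curryOn (rescale K) (x, t)))
    simp only [← hW] at h1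
    change W ⟨r * r', _⟩ = 1 + primitiveC (curryOn (rescale K) (x, t * r) * φ) r'
    rw [h1, ContinuousMap.add_apply, volterra_apply, primitiveC_apply, primitiveC_apply]
    congr 1
    have h2 : (∫ t_1 in (0 : ℝ)..r * r', (curryOn (rescale K) (x, t) * W)
        (projIcc 0 1 zero_le_one t_1)) = (r : ℝ) • ∫ τ in (0 : ℝ)..r',
          (curryOn (rescale K) (x, t) * W) (projIcc 0 1 zero_le_one (r * τ)) := by
      rw [intervalIntegral.smul_integral_comp_mul_left
        (fun τ => (curryOn (rescale K) (x, t) * W) (projIcc 0 1 zero_le_one τ)), mul_zero]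
    rw [h2, ← intervalIntegral.integral_smul]
    refine intervalIntegral.integral_congr fun τ hτ => ?_
    rw [uIcc_of_le r'.2.1] at hτ
    have hτ' : τ ∈ Icc (0 : ℝ) 1 := ⟨hτ.1, hτ.2.trans r'.2.2⟩
    rw [projIcc_of_mem _ hτ', projIcc_of_mem _ (hmem τ hτ'), ContinuousMap.mul_apply,
      ContinuousMap.mul_apply, curryOn_rescale_apply hK hx, curryOn_rescale_apply hK hx]
    change _ = _ * W ⟨r * τ, _⟩
    rw [smul_mul_assoc, smul_mul_assoc, smul_smul, mul_comm (r : ℝ) t, mul_assoc]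
  have h3 := congrArg (fun f => f 1) (eq_volterraSol h)
  refine Eq.trans ?_ h3
  change W r = W ⟨r * ((1 : unitInterval) : ℝ), _⟩
  congr 1
  exact Subtype.ext (by simp)

variable [FiniteDimensional ℝ E]

theorem contDiffOn_linSol (hs : UniqueDiffOn ℝ s) (hc : LocConvex s)
    (hK : ContDiffOn ℝ ∞ K (s ×ˢ univ)) : ContDiffOn ℝ ∞ (linSol K) (s ×ˢ univ) := by
  have h1 := contDiffOn_curryOn (hs.prod uniqueDiffOn_univ) hc.prod_univ (contDiffOn_rescale hK)
  exact ((ContinuousMap.evalCLM ℝ (1 : unitInterval)).contDiff.comp contDiff_volterraSol).comp_contDiffOn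
    h1

theorem linSol_eq (hK : ContDiffOn ℝ ∞ K (s ×ˢ univ)) {x : E} (hx : x ∈ s) (t : ℝ) :
    linSol K (x, t) = 1 + ∫ τ in (0 : ℝ)..t, K (x, τ) * linSol K (x, τ) := by
  have h1 := congrArg (fun f => f 1) (volterraSol_eq (curryOn (rescale K) (x, t)))
  change linSol K (x, t) = 1 + primitiveC
    (curryOn (rescale K) (x, t) * volterraSol (curryOn (rescale K) (x, t))) 1 at h1
  rw [h1, primitiveC_apply]
  congr 1
  have h2 := intervalIntegral.smul_integral_comp_mul_left (a := 0) (b := 1)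
    (fun τ => K (x, τ) * linSol K (x, τ)) t
  rw [mul_zero, mul_one] at h2
  rw [← h2, ← intervalIntegral.integral_smul]
  refine intervalIntegral.integral_congr fun τ hτ => ?_
  have hτ' : τ ∈ Icc (0 : ℝ) 1 := by rwa [uIcc_of_le] at hτ; simp
  rw [projIcc_of_mem _ hτ', ContinuousMap.mul_apply, curryOn_rescale_apply hK hx,
    volterraSol_rescale hK hx, smul_mul_assoc]

theorem linSol_zero (hK : ContDiffOn ℝ ∞ K (s ×ˢ univ)) {x : E} (hx : x ∈ s) :
    linSol K (x, 0) = 1 := by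
  rw [linSol_eq hK hx]; simp

theorem hasDerivAt_linSol (hs : UniqueDiffOn ℝ s) (hc : LocConvex s)
    (hK : ContDiffOn ℝ ∞ K (s ×ˢ univ)) {x : E} (hx : x ∈ s) (t : ℝ) :
    HasDerivAt (fun t => linSol K (x, t)) (K (x, t) * linSol K (x, t)) t := by
  have h1 : Continuous fun τ : ℝ => K (x, τ) * linSol K (x, τ) :=
    (continuous_slice hK.continuousOn hx).mul
      (continuous_slice (contDiffOn_linSol hs hc hK).continuousOn hx)
  have h2 := (h1.integral_hasStrictDerivAt 0 t).hasDerivAt.const_add 1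
  refine h2.congr_of_eventuallyEq (Eventually.of_forall fun t => ?_)
  exact linSol_eq hK hx t

end ODE

end HolChern

namespace HolChern

section Fibre

variable {E G B : Type*} [NormedAddCommGroup E] [NormedSpace ℝ E]
  [NormedAddCommGroup G] [NormedSpace ℝ G] [NormedRing B] [NormedAlgebra ℝ B]

/-- The product of a domain with a normed space. -/
def Dom.prodUniv (S : Dom E) (G : Type*) [NormedAddCommGroup G] [NormedSpace ℝ G] : Dom (E × G) where
  carrier := S.carrier ×ˢ univ
  uniqueDiff := S.uniqueDiff.prod uniqueDiffOn_univ
  subset_closure := by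
    rw [interior_prod_eq, interior_univ, closure_prod_eq, closure_univ]
    exact prod_mono S.subset_closure subset_rfl

variable {S : Dom E}

theorem Dom.mem_prodUniv {y : E} (hy : y ∈ S.carrier) (g : G) :
    (y, g) ∈ (S.prodUniv G).carrier := ⟨hy, mem_univ _⟩

namespace SForm

/-- The derivative along a line in the second factor. -/
theorem hasDerivAt_ev_line (f : SForm (S.prodUniv G) B) (l : List (E × G)) {y : E}
    (hy : y ∈ S.carrier) {c : ℝ → G} {v : G} {s : ℝ} (hc : HasDerivAt c v s) :
    HasDerivAt (fun s => ev f l (y, c s)) (ev (ld (0, v) f) l (y, c s)) s := by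
  have h1 := (differentiableOn_ev f l _ (Dom.mem_prodUniv hy (c s))).hasFDerivWithinAt
  have h2 : HasDerivAt (fun s => (y, c s)) ((0 : E), v) s := (hasDerivAt_const s y).prodMk hc
  rw [ev_ld _ _ _ (Dom.mem_prodUniv hy (c s)), ← hasDerivWithinAt_univ]
  exact h1.comp_hasDerivWithinAt s h2.hasDerivWithinAt fun s _ => Dom.mem_prodUniv hy (c s)

theorem continuous_ev_line (f : SForm (S.prodUniv G) B) (l : List (E × G)) {y : E}
    (hy : y ∈ S.carrier) : Continuous fun g => ev f l (y, g) :=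
  (contDiffOn_ev f l).continuousOn.comp_continuous (by fun_prop) fun g => Dom.mem_prodUniv hy g

variable [FiniteDimensional ℝ E] [CompleteSpace B]

/-- The coefficient of a form on `S × ℝ²`, as a function on `(S × ℝ) × ℝ`. -/
def coeffSquare (f : SForm (S.prodUniv (ℝ × ℝ)) B) (l : List E) (z : (E × ℝ) × ℝ) : B :=
  ev f (l.map fun v => (v, 0)) (z.1.1, (z.2, z.1.2))

theorem contDiffOn_coeffSquare (f : SForm (S.prodUniv (ℝ × ℝ)) B) (l : List E) :
    ContDiffOn ℝ ∞ (coeffSquare f l) ((S.carrier ×ˢ univ) ×ˢ univ) := by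
  refine (contDiffOn_ev f (l.map fun v => (v, 0))).comp
    (f := fun z : (E × ℝ) × ℝ => (z.1.1, (z.2, z.1.2))) ?_ ?_
  · fun_prop
  · rintro z ⟨⟨hz, -⟩, -⟩
    exact Dom.mem_prodUniv hz _

/-- Integration over the unit square of the components of a form along `S`. -/
def squareIntS (hc : LocConvex S.carrier) (f : SForm (S.prodUniv (ℝ × ℝ)) B) : SForm S B :=
  ⟨fun y => ⟨fun l => paramInt (paramInt (coeffSquare f l)) (y : E)⟩,
    .of_eq (F := fun l => paramInt (paramInt (coeffSquare f l)))
      (fun l => contDiffOn_paramInt S.uniqueDiff hc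
        (contDiffOn_paramInt (S.uniqueDiff.prod uniqueDiffOn_univ) hc.prod_univ
          (contDiffOn_coeffSquare f l))) fun _ _ => rfl⟩

theorem squareIntS_val (hc : LocConvex S.carrier) (f : SForm (S.prodUniv (ℝ × ℝ)) B) (y : S.carrier) (l : List E) :
    (squareIntS hc f).1 y l = ∫ t in (0 : ℝ)..1, ∫ r in (0 : ℝ)..1,
      ev f (l.map fun v => (v, 0)) ((y : E), (r, t)) := rfl

theorem contr_squareIntS (hc : LocConvex S.carrier) (f : SForm (S.prodUniv (ℝ × ℝ)) B) (v : E) :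
    contr v (squareIntS hc f) = squareIntS hc (contr (v, 0) f) := by
  ext y l
  rw [contr_val, LForm.contr_apply, squareIntS_val, squareIntS_val]
  refine intervalIntegral.integral_congr fun t _ => intervalIntegral.integral_congr fun r _ => ?_
  rw [ev_of_mem _ _ (Dom.mem_prodUniv y.2 _), ev_of_mem _ _ (Dom.mem_prodUniv y.2 _)]
  rfl

theorem continuous_inner (hc : LocConvex S.carrier) (f : SForm (S.prodUniv (ℝ × ℝ)) B) (y : S.carrier) (l : List E) :
    Continuous fun t : ℝ => ∫ r in (0 : ℝ)..1, ev f (l.map fun v => (v, 0)) ((y : E), (r, t)) :=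
  continuous_slice (f := paramInt (coeffSquare f l))
    (contDiffOn_paramInt (S.uniqueDiff.prod uniqueDiffOn_univ) hc.prod_univ
      (contDiffOn_coeffSquare f l)).continuousOn y.2

theorem squareIntS_sub (hc : LocConvex S.carrier) (f g : SForm (S.prodUniv (ℝ × ℝ)) B) :
    squareIntS hc (f - g) = squareIntS hc f - squareIntS hc g := by
  ext y l
  rw [sub_val, LForm.sub_apply, squareIntS_val, squareIntS_val, squareIntS_val,
    ← intervalIntegral.integral_sub ((continuous_inner hc f y l).intervalIntegrable _ _)
      ((continuous_inner hc g y l).intervalIntegrable _ _)]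
  refine intervalIntegral.integral_congr fun t _ => ?_
  rw [← intervalIntegral.integral_sub]
  · refine intervalIntegral.integral_congr fun r _ => ?_
    simp only [ev_of_mem _ _ (Dom.mem_prodUniv y.2 _)]
    rfl
  · exact ((continuous_ev_line f _ y.2).comp (by fun_prop : Continuous fun r : ℝ => (r, t))
      ).intervalIntegrable _ _
  · exact ((continuous_ev_line g _ y.2).comp (by fun_prop : Continuous fun r : ℝ => (r, t))
      ).intervalIntegrable _ _

theorem derivFst_coeffSquare (f : SForm (S.prodUniv (ℝ × ℝ)) B) (l : List E) (w : E) {y : E}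
    (hy : y ∈ S.carrier) (r t : ℝ) :
    derivFst (S.carrier ×ˢ univ) (coeffSquare f l) (w, 0) ((y, t), r) =
      coeffSquare (ld (w, 0) f) l ((y, t), r) := by
  let j : (E × ℝ) × ℝ →L[ℝ] E × (ℝ × ℝ) :=
    ((ContinuousLinearMap.fst ℝ E ℝ).comp (ContinuousLinearMap.fst ℝ (E × ℝ) ℝ)).prod
      ((ContinuousLinearMap.snd ℝ (E × ℝ) ℝ).prod
        ((ContinuousLinearMap.snd ℝ E ℝ).comp (ContinuousLinearMap.fst ℝ (E × ℝ) ℝ)))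
  have h1 := (differentiableOn_ev f (l.map fun v => (v, 0)) _
    (Dom.mem_prodUniv hy (r, t))).hasFDerivWithinAt
  have h2 : HasFDerivWithinAt j j ((S.carrier ×ˢ univ) ×ˢ univ) ((y, t), r) :=
    j.hasFDerivWithinAt
  have h3 : HasFDerivWithinAt (coeffSquare f l) _ ((S.carrier ×ˢ univ) ×ˢ univ) ((y, t), r) :=
    h1.comp (g := ev f (l.map fun v => (v, 0))) ((y, t), r) h2
      (fun z hz => Dom.mem_prodUniv hz.1.1 _)
  rw [derivFst, h3.fderivWithin (((S.uniqueDiff.prod uniqueDiffOn_univ).prod uniqueDiffOn_univ) _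
    ⟨⟨hy, mem_univ _⟩, mem_univ _⟩), coeffSquare, ev_ld _ _ _ (Dom.mem_prodUniv hy (r, t))]
  rfl

theorem ld_squareIntS (hc : LocConvex S.carrier) (f : SForm (S.prodUniv (ℝ × ℝ)) B) (w : E) :
    ld w (squareIntS hc f) = squareIntS hc (ld (w, 0) f) := by
  ext y l
  have h : EqOn (ev (squareIntS hc f) l) (paramInt (paramInt (coeffSquare f l))) S.carrier :=
    fun y hy => ev_of_mem _ _ hy
  have h1 := contDiffOn_paramInt (S.uniqueDiff.prod uniqueDiffOn_univ) hc.prod_univ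
    (contDiffOn_coeffSquare f l)
  rw [ld_congr h, fderivWithin_paramInt S.uniqueDiff hc h1 y.2, squareIntS_val]
  refine intervalIntegral.integral_congr fun t _ => ?_
  change fderivWithin ℝ (paramInt (coeffSquare f l)) (S.carrier ×ˢ univ) ((y : E), t) (w, 0) = _
  rw [fderivWithin_paramInt (S.uniqueDiff.prod uniqueDiffOn_univ) hc.prod_univ
    (contDiffOn_coeffSquare f l) ⟨y.2, mem_univ _⟩]
  refine intervalIntegral.integral_congr fun r _ => ?_
  exact derivFst_coeffSquare f l w y.2 r t

theorem d_squareIntS (hc : LocConvex S.carrier) (f : SForm (S.prodUniv (ℝ × ℝ)) B) :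
    d (squareIntS hc f) = squareIntS hc (d f) := by
  ext y l
  induction l generalizing f with
  | nil =>
    rw [d_nil, squareIntS_val]
    have : ∀ r t : ℝ, ev (d f) (([] : List E).map fun v => (v, 0)) ((y : E), (r, t)) = 0 := by
      intro r t
      rw [ev_of_mem _ _ (Dom.mem_prodUniv y.2 _)]; rfl
    simp only [this, intervalIntegral.integral_zero]
  | cons w l ih =>
    have h1 : (squareIntS hc (d f)).1 y (w :: l) = (contr w (squareIntS hc (d f))).1 y l := rfl
    rw [d_cons, ld_squareIntS, contr_squareIntS hc f, h1, contr_squareIntS hc (d f), contr_d,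
      squareIntS_sub, sub_val, LForm.sub_apply, ih]

/-- Integration over `[0, 1]` of the contraction with the velocity. -/
def lineInt (f : SForm (S.prodUniv ℝ) B) (y : S.carrier) (l : List E) : B :=
  ∫ s in (0 : ℝ)..1, f.1 ⟨((y : E), s), Dom.mem_prodUniv y.2 s⟩ ((0, 1) :: l.map fun v => (v, 0))

/-- The inclusion of a vertical line into the square. -/
def vertLine (S : Dom E) (c : ℝ) : AffMap (S.prodUniv ℝ) (S.prodUniv (ℝ × ℝ)) where
  base := (0, (c, 0))
  lin := (ContinuousLinearMap.fst ℝ E ℝ).prod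
    ((ContinuousLinearMap.inr ℝ ℝ ℝ).comp (ContinuousLinearMap.snd ℝ E ℝ))
  mapsTo w hw := by
    refine ⟨?_, mem_univ _⟩
    simpa using hw.1

/-- The inclusion of a horizontal line into the square. -/
def horLine (S : Dom E) (c : ℝ) : AffMap (S.prodUniv ℝ) (S.prodUniv (ℝ × ℝ)) where
  base := (0, (0, c))
  lin := (ContinuousLinearMap.fst ℝ E ℝ).prod
    ((ContinuousLinearMap.inl ℝ ℝ ℝ).comp (ContinuousLinearMap.snd ℝ E ℝ))
  mapsTo w hw := by
    refine ⟨?_, mem_univ _⟩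
    simpa using hw.1

theorem lineInt_vertLine (f : SForm (S.prodUniv (ℝ × ℝ)) B) (c : ℝ) (y : S.carrier) (l : List E) :
    lineInt (pull (vertLine S c) f) y l = ∫ t in (0 : ℝ)..1,
      ev (contr (0, (0, 1)) f) (l.map fun v => (v, 0)) ((y : E), (c, t)) := by
  refine intervalIntegral.integral_congr fun t _ => ?_
  rw [ev_of_mem _ _ (Dom.mem_prodUniv y.2 _), pull_val, LForm.pull_apply, contr_val,
    LForm.contr_apply]
  congr 2
  · simp [AffMap.app, vertLine]
  · simp [vertLine, Function.comp_def]

theorem lineInt_horLine (f : SForm (S.prodUniv (ℝ × ℝ)) B) (c : ℝ) (y : S.carrier) (l : List E) :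
    lineInt (pull (horLine S c) f) y l = ∫ r in (0 : ℝ)..1,
      ev (contr (0, (1, 0)) f) (l.map fun v => (v, 0)) ((y : E), (r, c)) := by
  refine intervalIntegral.integral_congr fun t _ => ?_
  rw [ev_of_mem _ _ (Dom.mem_prodUniv y.2 _), pull_val, LForm.pull_apply, contr_val,
    LForm.contr_apply]
  congr 2
  · simp [AffMap.app, horLine]
  · simp [horLine, Function.comp_def]

/-- Stokes' theorem on the square, for a closed form. -/
theorem d_squareIntS_of_closed (hc : LocConvex S.carrier) {f : SForm (S.prodUniv (ℝ × ℝ)) B} (hf : d f = 0) (y : S.carrier)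
    (l : List E) :
    (d (squareIntS hc (contr (0, (1, 0)) (contr (0, (0, 1)) f)))).1 y l =
      (lineInt (pull (vertLine S 1) f) y l - lineInt (pull (vertLine S 0) f) y l) -
        (lineInt (pull (horLine S 1) f) y l - lineInt (pull (horLine S 0) f) y l) := by
  set er : E × (ℝ × ℝ) := (0, (1, 0))
  set et : E × (ℝ × ℝ) := (0, (0, 1))
  have h1 : d (contr er (contr et f)) = ld er (contr et f) - ld et (contr er f) := by
    have h2 : contr er (contr et (d f)) = 0 := by rw [hf, contr_zero, contr_zero]
    rw [contr_d, contr_sub, contr_d, ← ld_contr] at h2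
    rw [← sub_eq_zero, ← h2]; abel
  have hr : ∀ g : SForm (S.prodUniv (ℝ × ℝ)) B, (squareIntS hc (ld er g)).1 y l =
      (∫ t in (0 : ℝ)..1, ev g (l.map fun v => (v, 0)) ((y : E), ((1 : ℝ), t))) -
        ∫ t in (0 : ℝ)..1, ev g (l.map fun v => (v, 0)) ((y : E), ((0 : ℝ), t)) := by
    intro g
    rw [squareIntS_val, ← intervalIntegral.integral_sub]
    · refine intervalIntegral.integral_congr fun t _ => ?_
      refine intervalIntegral.integral_eq_sub_of_hasDerivAt
        (f := fun r => ev g (l.map fun v => (v, 0)) ((y : E), (r, t))) (fun r _ => ?_) ?_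
      · exact hasDerivAt_ev_line g _ y.2 ((hasDerivAt_id r).prodMk (hasDerivAt_const r t))
      · exact ((continuous_ev_line (ld er g) _ y.2).comp
          (by fun_prop : Continuous fun r : ℝ => (r, t))).intervalIntegrable _ _
    · exact ((continuous_ev_line g _ y.2).comp
          (by fun_prop : Continuous fun t : ℝ => ((1 : ℝ), t))).intervalIntegrable _ _
    · exact ((continuous_ev_line g _ y.2).comp
          (by fun_prop : Continuous fun t : ℝ => ((0 : ℝ), t))).intervalIntegrable _ _
  have ht : ∀ g : SForm (S.prodUniv (ℝ × ℝ)) B, (squareIntS hc (ld et g)).1 y l =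
      (∫ r in (0 : ℝ)..1, ev g (l.map fun v => (v, 0)) ((y : E), (r, (1 : ℝ)))) -
        ∫ r in (0 : ℝ)..1, ev g (l.map fun v => (v, 0)) ((y : E), (r, (0 : ℝ))) := by
    intro g
    rw [squareIntS_val, intervalIntegral_intervalIntegral_swap, ← intervalIntegral.integral_sub]
    · refine intervalIntegral.integral_congr fun r _ => ?_
      refine intervalIntegral.integral_eq_sub_of_hasDerivAt
        (f := fun t => ev g (l.map fun v => (v, 0)) ((y : E), (r, t))) (fun t _ => ?_) ?_
      · exact hasDerivAt_ev_line g _ y.2 ((hasDerivAt_const t r).prodMk (hasDerivAt_id t))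
      · exact ((continuous_ev_line (ld et g) _ y.2).comp
          (by fun_prop : Continuous fun t : ℝ => (r, t))).intervalIntegrable _ _
    · exact ((continuous_ev_line g _ y.2).comp
          (by fun_prop : Continuous fun t : ℝ => (t, (1 : ℝ)))).intervalIntegrable _ _
    · exact ((continuous_ev_line g _ y.2).comp
          (by fun_prop : Continuous fun t : ℝ => (t, (0 : ℝ)))).intervalIntegrable _ _
    · have hcont : Continuous (Function.uncurry fun t r : ℝ =>
          ev (ld et g) (l.map fun v => (v, 0)) ((y : E), (r, t))) :=
        (continuous_ev_line (ld et g) _ y.2).comp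
          (by fun_prop : Continuous fun p : ℝ × ℝ => (p.2, p.1))
      exact (hcont.continuousOn.integrableOn_compact (isCompact_uIcc.prod isCompact_uIcc)).mono_set
        (prod_mono uIoc_subset_uIcc uIoc_subset_uIcc)
  rw [d_squareIntS, h1, squareIntS_sub, sub_val, LForm.sub_apply, hr, ht, lineInt_vertLine,
    lineInt_vertLine, lineInt_horLine, lineInt_horLine]

end SForm

end Fibre

end HolChern

namespace HolChern

section Path

theorem eq_zero_of_linear_ode {F : Type*} [NormedAddCommGroup F] [NormedSpace ℝ F]
    {L : ℝ → F →L[ℝ] F} (hL : Continuous L) {D : ℝ → F} (hD : ∀ t, HasDerivAt D (L t (D t)) t)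
    (h0 : D 0 = 0) (t : ℝ) : D t = 0 := by
  obtain ⟨C, hC⟩ := (isCompact_Icc (a := -(|t| + 1)) (b := |t| + 1)).exists_bound_of_continuousOn
    hL.continuousOn
  have hlip : ∀ s ∈ Ioo (-(|t| + 1)) (|t| + 1),
      LipschitzOnWith C.toNNReal (fun x => L s x) univ := fun s hs => by
    refine ((L s).lipschitz.weaken ?_).lipschitzOnWith
    rw [← NNReal.coe_le_coe]
    exact (hC s (Ioo_subset_Icc_self hs)).trans (Real.le_coe_toNNReal C)
  have ht : t ∈ Ioo (-(|t| + 1)) (|t| + 1) := by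
    constructor <;> [have := neg_abs_le t; have := le_abs_self t] <;> linarith
  refine ODE_solution_unique_of_mem_Ioo (g := fun _ => (0 : F)) (t₀ := 0) hlip ?_
    (fun s _ => ⟨hD s, mem_univ _⟩) (fun s _ => ⟨?_, mem_univ _⟩) h0 ht
  · constructor <;> [have := abs_nonneg t; have := abs_nonneg t] <;> linarith
  · simpa using hasDerivAt_const s (0 : F)

variable {A : Type*} [NormedRing A] [NormedAlgebra ℝ A]

/-- A differentiable path of projections. -/
structure ProjPath [StarRing A] (γ γ' : ℝ → A) : Prop where
  deriv : ∀ t, HasDerivAt γ (γ' t) t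
  cont : Continuous γ'
  idem : ∀ t, γ t * γ t = γ t
  star : ∀ t, star (γ t) = γ t

variable [StarRing A] [StarModule ℝ A] [ContinuousStar A] {γ γ' φ : ℝ → A}

namespace ProjPath

theorem deriv_idem (h : ProjPath γ γ') (t : ℝ) : γ' t * γ t + γ t * γ' t = γ' t := by
  have h1 := (h.deriv t).mul (h.deriv t)
  exact h1.unique ((h.deriv t).congr_of_eventuallyEq (Eventually.of_forall fun s => h.idem s))

theorem star_deriv (h : ProjPath γ γ') (t : ℝ) : Star.star (γ' t) = γ' t :=
  ((h.deriv t).star).unique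
    ((h.deriv t).congr_of_eventuallyEq (Eventually.of_forall fun s => h.star s))

theorem mul_deriv_mul (h : ProjPath γ γ') (t : ℝ) : γ t * γ' t * γ t = 0 := by
  linear_combination (norm := noncomm_ring) γ t * h.deriv_idem t - h.idem t * γ' t

variable (h : ProjPath γ γ') (hφ : ∀ t, HasDerivAt φ (γ' t * φ t) t) (h0 : φ 0 = γ 0)

include h hφ h0

theorem mul_transport (t : ℝ) : γ t * φ t = φ t := by
  rw [← sub_eq_zero]
  refine eq_zero_of_linear_ode (L := fun t => -(ContinuousLinearMap.mul ℝ A (γ t * γ' t)))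
    ?_ (D := fun t => γ t * φ t - φ t) (fun t => ?_) ?_ t
  · have : Continuous γ := continuous_iff_continuousAt.2 fun t => (h.deriv t).continuousAt
    exact ((ContinuousLinearMap.mul ℝ A).continuous.comp (this.mul h.cont)).neg
  · refine (((h.deriv t).mul (hφ t)).sub (hφ t)).congr_deriv ?_
    change _ = -(γ t * γ' t * (γ t * φ t - φ t))
    linear_combination (norm := noncomm_ring) h.mul_deriv_mul t * φ t
  · simp [h0, h.idem]

theorem star_transport_mul (t : ℝ) : Star.star (φ t) * φ t = γ 0 := by
  have hd : ∀ t, HasDerivAt (fun t => Star.star (φ t) * φ t) 0 t := fun t => by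
    refine ((hφ t).star.mul (hφ t)).congr_deriv ?_
    have h1 : Star.star (φ t) * γ' t * φ t = 0 := by
      have h2 := h.mul_transport hφ h0 t
      have h3 := congrArg Star.star h2
      rw [star_mul, h.star] at h3
      calc Star.star (φ t) * γ' t * φ t = Star.star (φ t) * γ t * γ' t * (γ t * φ t) := by
            rw [h3, h2]
        _ = Star.star (φ t) * (γ t * γ' t * γ t) * φ t := by noncomm_ring
        _ = 0 := by rw [h.mul_deriv_mul]; simp
    rw [star_mul, h.star_deriv, h1, ← mul_assoc, h1, add_zero]
  have := is_const_of_deriv_eq_zero (fun t => (hd t).differentiableAt) (fun t => (hd t).deriv) t 0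
  rw [this, h0, h.star, h.idem]

theorem transport_mul (t : ℝ) : φ t * γ 0 = φ t := by
  rw [← sub_eq_zero]
  refine eq_zero_of_linear_ode (L := fun t => ContinuousLinearMap.mul ℝ A (γ' t))
    ((ContinuousLinearMap.mul ℝ A).continuous.comp h.cont)
    (D := fun t => φ t * γ 0 - φ t) (fun t => ?_) ?_ t
  · refine (((hφ t).mul_const _).sub (hφ t)).congr_deriv ?_
    change _ = γ' t * (φ t * γ 0 - φ t)
    noncomm_ring
  · simp [h0, h.idem]

theorem transport_mul_star (t : ℝ) : φ t * Star.star (φ t) = γ t := by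
  rw [← sub_eq_zero]
  refine eq_zero_of_linear_ode
    (L := fun t => ContinuousLinearMap.mul ℝ A (γ' t) + (ContinuousLinearMap.mul ℝ A).flip (γ' t))
    (((ContinuousLinearMap.mul ℝ A).continuous.comp h.cont).add
      ((ContinuousLinearMap.mul ℝ A).flip.continuous.comp h.cont))
    (D := fun t => φ t * Star.star (φ t) - γ t) (fun t => ?_) ?_ t
  · refine (((hφ t).mul (hφ t).star).sub (h.deriv t)).congr_deriv ?_
    change _ = γ' t * (φ t * Star.star (φ t) - γ t) + (φ t * Star.star (φ t) - γ t) * γ' t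
    rw [star_mul, h.star_deriv]
    linear_combination (norm := noncomm_ring) h.deriv_idem t
  · simp [h0, h.idem, h.star]

theorem mul_transport_deriv (t : ℝ) : γ t * (γ' t * φ t) = 0 := by
  conv_lhs => rw [← h.mul_transport hφ h0 t]
  rw [← mul_assoc, ← mul_assoc, h.mul_deriv_mul, zero_mul]

theorem star_transport_mul_deriv (t : ℝ) : Star.star (φ t) * (γ' t * φ t) = 0 := by
  have h3 := congrArg Star.star (h.mul_transport hφ h0 t)
  rw [star_mul, h.star] at h3
  rw [← h3, mul_assoc, h.mul_transport_deriv hφ h0, mul_zero]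

end ProjPath

end Path

section Loop

variable {E A : Type*} [NormedAddCommGroup E] [NormedSpace ℝ E] [FiniteDimensional ℝ E]
  [NormedRing A] [NormedAlgebra ℝ A] [CompleteSpace A]
  [StarRing A] [StarModule ℝ A] [ContinuousStar A] {S : Dom E}

/-- A smooth family of loops of projections, parametrized by the unit interval. -/
structure ProjLoop (S : Dom E) (p : E × ℝ → A) : Prop where
  smooth : ContDiffOn ℝ ∞ p (S.carrier ×ˢ univ)
  idem : ∀ y ∈ S.carrier, ∀ t, p (y, t) * p (y, t) = p (y, t)
  star_eq : ∀ y ∈ S.carrier, ∀ t, star (p (y, t)) = p (y, t)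
  loop : ∀ y ∈ S.carrier, p (y, 1) = p (y, 0)

/-- The derivative in the direction of the parameter. -/
def derivT (S : Dom E) (p : E × ℝ → A) (z : E × ℝ) : A :=
  fderivWithin ℝ p (S.carrier ×ˢ univ) z (0, 1)

/-- The parallel transport of the family of projections. -/
def frameFn (S : Dom E) (p : E × ℝ → A) (z : E × ℝ) : A := linSol (derivT S p) z * p (z.1, 0)

variable {p : E × ℝ → A}

theorem contDiffOn_derivT (hp : ContDiffOn ℝ ∞ p (S.carrier ×ˢ univ)) :
    ContDiffOn ℝ ∞ (derivT S p) (S.carrier ×ˢ univ) :=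
  (hp.fderivWithin (S.uniqueDiff.prod uniqueDiffOn_univ) (by simp)).clm_apply contDiffOn_const

namespace ProjLoop

variable (h : ProjLoop S p) (hc : LocConvex S.carrier)

include h

theorem projPath {y : E} (hy : y ∈ S.carrier) :
    ProjPath (fun t => p (y, t)) (fun t => derivT S p (y, t)) where
  deriv t := by
    have h1 := (h.smooth.differentiableOn (by simp) (y, t) ⟨hy, mem_univ _⟩).hasFDerivWithinAt
    have h2 : HasDerivAt (fun s => (y, s)) ((0 : E), (1 : ℝ)) t :=
      (hasDerivAt_const t y).prodMk (hasDerivAt_id t)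
    rw [← hasDerivWithinAt_univ]
    exact h1.comp_hasDerivWithinAt t h2.hasDerivWithinAt fun s _ => ⟨hy, mem_univ _⟩
  cont := continuous_slice (contDiffOn_derivT h.smooth).continuousOn hy
  idem := h.idem y hy
  star := h.star_eq y hy

include hc

theorem contDiffOn_frameFn : ContDiffOn ℝ ∞ (frameFn S p) (S.carrier ×ˢ univ) := by
  refine (contDiffOn_linSol S.uniqueDiff hc (contDiffOn_derivT h.smooth)).mul
    (h.smooth.comp (f := fun z : E × ℝ => (z.1, (0 : ℝ))) (by fun_prop) ?_)
  rintro z ⟨hz, -⟩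
  exact ⟨hz, mem_univ _⟩

theorem hasDerivAt_frameFn {y : E} (hy : y ∈ S.carrier) (t : ℝ) :
    HasDerivAt (fun t => frameFn S p (y, t)) (derivT S p (y, t) * frameFn S p (y, t)) t := by
  refine ((hasDerivAt_linSol S.uniqueDiff hc (contDiffOn_derivT h.smooth) hy t).mul_const
    (p (y, 0))).congr_deriv ?_
  rw [mul_assoc]; rfl

omit hc in
theorem frameFn_zero {y : E} (hy : y ∈ S.carrier) : frameFn S p (y, 0) = p (y, 0) := by
  rw [frameFn, linSol_zero (contDiffOn_derivT h.smooth) hy, one_mul]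

end ProjLoop

end Loop

end HolChern

namespace HolChern

namespace SForm

section PullLemmas

variable {U V W A B : Type*} [NormedAddCommGroup U] [NormedSpace ℝ U] [NormedAddCommGroup V]
  [NormedSpace ℝ V] [NormedAddCommGroup W] [NormedSpace ℝ W]
  [NormedRing A] [NormedAlgebra ℝ A] [NormedRing B] [NormedAlgebra ℝ B]
  {R : Dom U} {S : Dom V} {T : Dom W}

theorem pull_pull (j : AffMap T S) (k : AffMap R T) (m : AffMap R S)
    (h1 : ∀ w, j.base + j.lin (k.base + k.lin w) = m.base + m.lin w)
    (h2 : ∀ w, j.lin (k.lin w) = m.lin w)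
    (f : SForm S A) : pull k (pull j f) = pull m f := by
  ext y l
  rw [pull_val, pull_val, pull_val, LForm.pull_apply, LForm.pull_apply, LForm.pull_apply,
    List.map_map]
  have e1 : j.app (k.app y) = m.app y := Subtype.ext (h1 y)
  have e2 : (j.lin ∘ k.lin) = m.lin := funext h2
  rw [e1, e2]

theorem pull_id (j : AffMap S S) (h1 : ∀ w, j.base + j.lin w = w) (h2 : ∀ w, j.lin w = w)
    (f : SForm S A) : pull j f = f := by
  ext y l
  rw [pull_val, LForm.pull_apply]
  have e1 : j.app y = y := Subtype.ext (h1 y)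
  have e2 : (j.lin : V → V) = id := funext h2
  rw [e1, e2, List.map_id]

theorem ld_zero_left (f : SForm S A) : ld 0 f = 0 := by
  ext y l
  rw [ld_val, map_zero]; rfl

/-- The forms that are horizontal and invariant in a direction. -/
def basic (S : Dom V) (A : Type*) [NormedRing A] [NormedAlgebra ℝ A] (v : V) :
    Subring (SForm S A) where
  carrier := {f | contr v f = 0 ∧ ld v f = 0}
  mul_mem' {f g} hf hg := ⟨by rw [contr_mul, hf.1, hg.1]; simp, by rw [ld_mul, hf.2, hg.2]; simp⟩
  one_mem' := ⟨contr_one v, by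
    have := ld_mul v (1 : SForm S A) 1
    rw [mul_one, mul_one, one_mul] at this
    exact add_eq_left.1 this.symm⟩
  add_mem' {f g} hf hg := ⟨by rw [contr_add, hf.1, hg.1, add_zero],
    by rw [ld_add, hf.2, hg.2, add_zero]⟩
  zero_mem' := ⟨contr_zero v, by simpa using ld_sub v (0 : SForm S A) 0⟩
  neg_mem' {f} hf := ⟨by rw [contr_neg, hf.1, neg_zero], by rw [ld_neg, hf.2, neg_zero]⟩

theorem d_mem_basic {v : V} {f : SForm S A} (hf : f ∈ basic S A v) : d f ∈ basic S A v :=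
  ⟨by rw [contr_d, hf.1, hf.2]; simp, by rw [ld_d, hf.2, d_zero]⟩

theorem curv_mem_basic {v : V} {f : SForm S A} (hf : f ∈ basic S A v) : curv f ∈ basic S A v :=
  add_mem (d_mem_basic hf) (mul_mem hf hf)

theorem contr_mapVal (τ : A →L[ℝ] B) (v : V) (f : SForm S A) :
    contr v (mapVal τ f) = mapVal τ (contr v f) := rfl

theorem contr_mapVal_eq_zero (τ : A →L[ℝ] B) {v : V} {f : SForm S A} (hf : f ∈ basic S A v) :
    contr v (mapVal τ f) = 0 := by
  ext y l
  rw [contr_mapVal, hf.1, mapVal_val, LForm.mapVal_apply]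
  exact map_zero τ

theorem IsFrame.pull {g gs p Q : SForm S A} (h : IsFrame g gs p Q) (j : AffMap T S) :
    IsFrame (pull j g) (pull j gs) (pull j p) (pull j Q) where
  gs_g := by rw [← map_mul, h.gs_g]
  g_gs := by rw [← map_mul, h.g_gs]
  g_Q := by rw [← map_mul, h.g_Q]
  Q_gs := by rw [← map_mul, h.Q_gs]
  Q_Q := by rw [← map_mul, h.Q_Q]
  sgn_g := by rw [← pull_sgn, h.sgn_g]
  sgn_gs := by rw [← pull_sgn, h.sgn_gs]

theorem pull_form (j : AffMap T S) (g gs Q : SForm S A) :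
    SForm.pull j (IsFrame.form g gs Q) =
      IsFrame.form (SForm.pull j g) (SForm.pull j gs) (SForm.pull j Q) := by
  simp only [IsFrame.form, map_sub, map_mul, map_one, pull_d]

theorem pull_star [StarRing A] [StarModule ℝ A] [ContinuousStar A] (j : AffMap T S)
    (f : SForm S A) : SForm.pull j (star f) = star (SForm.pull j f) := by
  ext y l
  rw [pull_val, LForm.pull_apply, star_val, star_val, LForm.star_apply, LForm.star_apply,
    pull_val, LForm.pull_apply, List.length_map]

end PullLemmas

section Square

variable {E A B : Type*} [NormedAddCommGroup E] [NormedSpace ℝ E]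
  [NormedRing A] [NormedAlgebra ℝ A] [NormedRing B] [NormedAlgebra ℝ B]

/-- The projection to the first factor. -/
def projFst (S : Dom E) (G : Type*) [NormedAddCommGroup G] [NormedSpace ℝ G] :
    AffMap (S.prodUniv G) S where
  base := 0
  lin := ContinuousLinearMap.fst ℝ E G
  mapsTo w hw := by simpa using hw.1

/-- The map `(y, (r, t)) ↦ (y, t)`. -/
def projTime (S : Dom E) : AffMap (S.prodUniv (ℝ × ℝ)) (S.prodUniv ℝ) where
  base := 0
  lin := (ContinuousLinearMap.fst ℝ E (ℝ × ℝ)).prod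
    ((ContinuousLinearMap.snd ℝ ℝ ℝ).comp (ContinuousLinearMap.snd ℝ E (ℝ × ℝ)))
  mapsTo w hw := by
    refine ⟨?_, mem_univ _⟩
    simpa using hw.1

/-- The inclusion `y ↦ (y, c)` of a slice. -/
def slice (S : Dom E) (c : ℝ) : AffMap S (S.prodUniv ℝ) where
  base := (0, c)
  lin := ContinuousLinearMap.inl ℝ E ℝ
  mapsTo w hw := by
    refine ⟨?_, mem_univ _⟩
    simpa using hw

/-- A real function as a form with central values. -/
def scalar {V : Type*} [NormedAddCommGroup V] [NormedSpace ℝ V] (T : Dom V) (A : Type*)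
    [NormedRing A] [NormedAlgebra ℝ A] (a : V →L[ℝ] ℝ) (b : ℝ) : SForm T A :=
  ofFun (fun z => (b + a z) • 1) (by fun_prop)

variable {S : Dom E}

section Scalar

variable {V W : Type*} [NormedAddCommGroup V] [NormedSpace ℝ V] [NormedAddCommGroup W]
  [NormedSpace ℝ W] {T : Dom V} {T' : Dom W}

theorem mul_scalar (a : V →L[ℝ] ℝ) (b : ℝ) (f : SForm T A) :
    f * scalar T A a b = scalar T A a b * f :=
  ofFun_smul_one_comm (fun z => b + a z) _ f

@[simp] theorem sgn_scalar (a : V →L[ℝ] ℝ) (b : ℝ) : sgn (scalar T A a b) = scalar T A a b :=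
  sgn_ofFun _ _

theorem pull_scalar (j : AffMap T' T) (a : V →L[ℝ] ℝ) (b : ℝ) :
    pull j (scalar T A a b) = scalar T' A (a.comp j.lin) (b + a j.base) := by
  rw [scalar, pull_ofFun]
  refine ofFun_congr fun w _ => ?_
  simp [add_assoc]

theorem scalar_congr {a a' : V →L[ℝ] ℝ} {b b' : ℝ} (h : ∀ z, b + a z = b' + a' z) :
    scalar T A a b = scalar T A a' b' := ofFun_congr fun w _ => by simp only [h w]

theorem scalar_zero_zero : scalar T A 0 0 = 0 := by
  rw [scalar, ← ofFun_zero]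
  exact ofFun_congr fun w _ => by simp

theorem scalar_zero_one : scalar T A 0 1 = 1 := by
  rw [scalar, ← ofFun_one]
  exact ofFun_congr fun w _ => by simp

theorem star_scalar [StarRing A] [StarModule ℝ A] [ContinuousStar A] (a : V →L[ℝ] ℝ) (b : ℝ) :
    star (scalar T A a b) = scalar T A a b := by
  rw [scalar, star_ofFun]
  exact ofFun_congr fun w _ => by simp

theorem scalar_mul_val (a : V →L[ℝ] ℝ) (b : ℝ) (f : SForm T A) (y : T.carrier) (l : List V) :
    (scalar T A a b * f).1 y l = (b + a y) • f.1 y l := by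
  rw [mul_val, scalar, ofFun_val, LForm.const_mul, smul_mul_assoc, one_mul]

end Scalar

theorem lineInt_eq (f : SForm (S.prodUniv ℝ) B) (y : S.carrier) (l : List E) :
    lineInt f y l = ∫ s in (0 : ℝ)..1, (pull (slice S s) (contr (0, 1) f)).1 y l := by
  refine intervalIntegral.integral_congr fun s _ => ?_
  rw [pull_val, LForm.pull_apply, contr_val, LForm.contr_apply]
  have e : (slice S s).app y = ⟨((y : E), s), Dom.mem_prodUniv y.2 s⟩ :=
    Subtype.ext (by simp [AffMap.app, slice])
  rw [e]; rfl

theorem lineInt_congr {f g : SForm (S.prodUniv ℝ) B} (h : contr (0, 1) f = contr (0, 1) g) :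
    lineInt f = lineInt g := by
  funext y l
  rw [lineInt_eq, lineInt_eq, h]

theorem ld_pull_projFst (f : SForm S B) {G : Type*} [NormedAddCommGroup G] [NormedSpace ℝ G]
    (v : G) : ld (0, v) (pull (projFst S G) f) = 0 := by
  have : (projFst S G).lin (0, v) = 0 := rfl
  rw [pull_ld, this, ld_zero_left, map_zero]

theorem pull_projFst_mem_basic {f : SForm S B} (hf : ∀ v, contr v f = 0) {G : Type*}
    [NormedAddCommGroup G] [NormedSpace ℝ G] (v : G) :
    pull (projFst S G) f ∈ basic (S.prodUniv G) B (0, v) :=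
  ⟨by rw [pull_contr, hf, map_zero], ld_pull_projFst f v⟩

/-- The form `Tr (Q R^{n+1})`. -/
def traceCurv {V : Type*} [NormedAddCommGroup V] [NormedSpace ℝ V] {T : Dom V} (τ : A →L[ℝ] B)
    (Q C : SForm T A) (n : ℕ) : SForm T B := mapVal τ (Q * curv C ^ (n + 1))

/-- The first coordinate of the square. -/
def coordR (S : Dom E) (A : Type*) [NormedRing A] [NormedAlgebra ℝ A] :
    SForm (S.prodUniv (ℝ × ℝ)) A :=
  scalar _ A ((ContinuousLinearMap.fst ℝ ℝ ℝ).comp (ContinuousLinearMap.snd ℝ E (ℝ × ℝ))) 0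

/-- The second coordinate of the square. -/
def coordT (S : Dom E) (A : Type*) [NormedRing A] [NormedAlgebra ℝ A] :
    SForm (S.prodUniv (ℝ × ℝ)) A :=
  scalar _ A ((ContinuousLinearMap.snd ℝ ℝ ℝ).comp (ContinuousLinearMap.snd ℝ E (ℝ × ℝ))) 0

/-- The coordinate of the line. -/
def coord (S : Dom E) (A : Type*) [NormedRing A] [NormedAlgebra ℝ A] : SForm (S.prodUniv ℝ) A :=
  scalar _ A (ContinuousLinearMap.snd ℝ E ℝ) 0

theorem pull_vertLine_coordR (c : ℝ) : pull (vertLine S c) (coordR S A) = scalar _ A 0 c := by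
  rw [coordR, pull_scalar]
  exact scalar_congr fun z => by simp [vertLine]

theorem pull_vertLine_coordT (c : ℝ) : pull (vertLine S c) (coordT S A) = coord S A := by
  rw [coordT, pull_scalar]
  exact scalar_congr fun z => by simp [vertLine]

theorem pull_horLine_coordR (c : ℝ) : pull (horLine S c) (coordR S A) = coord S A := by
  rw [coordR, pull_scalar]
  exact scalar_congr fun z => by simp [horLine]

theorem pull_horLine_coordT (c : ℝ) : pull (horLine S c) (coordT S A) = scalar _ A 0 c := by
  rw [coordT, pull_scalar]
  exact scalar_congr fun z => by simp [horLine]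

theorem pull_vertLine_projFst (c : ℝ) (f : SForm S A) :
    pull (vertLine S c) (pull (projFst S (ℝ × ℝ)) f) = pull (projFst S ℝ) f :=
  pull_pull _ _ _ (fun w => by simp [vertLine, projFst]) (fun w => by simp [vertLine, projFst]) f

theorem pull_horLine_projFst (c : ℝ) (f : SForm S A) :
    pull (horLine S c) (pull (projFst S (ℝ × ℝ)) f) = pull (projFst S ℝ) f :=
  pull_pull _ _ _ (fun w => by simp [horLine, projFst]) (fun w => by simp [horLine, projFst]) f

theorem pull_vertLine_projTime (c : ℝ) (f : SForm (S.prodUniv ℝ) A) :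
    pull (vertLine S c) (pull (projTime S) f) = f := by
  let i : AffMap (S.prodUniv ℝ) (S.prodUniv ℝ) :=
    ⟨0, ContinuousLinearMap.id ℝ _, fun w hw => by simpa using hw⟩
  rw [pull_pull (projTime S) (vertLine S c) i, pull_id] <;> intro w <;>
    simp [vertLine, projTime, i]

theorem pull_horLine_projTime (c : ℝ) (f : SForm (S.prodUniv ℝ) A) :
    pull (horLine S c) (pull (projTime S) f) = pull (projFst S ℝ) (pull (slice S c) f) := by
  let i : AffMap (S.prodUniv ℝ) (S.prodUniv ℝ) :=
    ⟨(0, c), (ContinuousLinearMap.inl ℝ E ℝ).comp (ContinuousLinearMap.fst ℝ E ℝ), fun w hw => by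
      refine ⟨?_, mem_univ _⟩
      simpa using hw.1⟩
  rw [pull_pull (projTime S) (horLine S c) i, pull_pull (slice S c) (projFst S ℝ) i] <;>
    intro w <;> simp [horLine, projTime, i, slice, projFst]

theorem pull_slice_projFst (c : ℝ) (f : SForm S A) :
    pull (slice S c) (pull (projFst S ℝ) f) = f := by
  let i : AffMap S S := ⟨0, ContinuousLinearMap.id ℝ _, fun w hw => by simpa using hw⟩
  rw [pull_pull (projFst S ℝ) (slice S c) i, pull_id] <;> intro w <;>
    simp [slice, projFst, i]

theorem pull_projTime_projFst (f : SForm S A) :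
    pull (projTime S) (pull (projFst S ℝ) f) = pull (projFst S (ℝ × ℝ)) f :=
  pull_pull _ _ _ (fun w => by simp [projTime, projFst]) (fun w => by simp [projTime, projFst]) f

end Square

section Algebra

variable {V A : Type*} [NormedAddCommGroup V] [NormedSpace ℝ V]
  [NormedRing A] [NormedAlgebra ℝ A] {T : Dom V}

/-- The connection form of `∇ ⊕ ∇^⊥`. -/
def sumConn (Q : SForm T A) : SForm T A := Q * d Q - (1 - Q) * d Q

/-- The first family of connections. -/
def famOne (g gs Q ρ : SForm T A) : SForm T A :=
  (1 - ρ) * sumConn Q + ρ * IsFrame.form g gs Q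

/-- The second family of connections. -/
def famTwo (g gs Q ρ t : SForm T A) : SForm T A :=
  (1 - ρ) * (t * sumConn Q) +
    ρ * ((gs + (1 - Q)) * d (g + (1 - Q)) + (gs + (1 - Q)) * (t * sumConn Q) * (g + (1 - Q)))

variable {g gs p Q ρ t : SForm T A}

theorem IsFrame.refl (h : IsFrame g gs p Q) : IsFrame Q Q Q Q :=
  ⟨h.Q_Q, h.Q_Q, h.Q_Q, h.Q_Q, h.Q_Q, h.sgn_Q, h.sgn_Q⟩

theorem sumConn_eq_form (Q : SForm T A) : sumConn Q = IsFrame.form Q Q Q := rfl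

theorem sgn_famOne (h : IsFrame g gs p Q) (hρ : sgn ρ = ρ) :
    sgn (famOne g gs Q ρ) = -famOne g gs Q ρ := by
  rw [famOne, sumConn_eq_form, map_add, map_mul, map_mul, map_sub, map_one, hρ, h.sgn_form,
    h.refl.sgn_form]
  noncomm_ring

theorem d_Q_famOne (h : IsFrame g gs p Q) (hρ : ∀ f, f * ρ = ρ * f) :
    d Q = Q * famOne g gs Q ρ - famOne g gs Q ρ * Q := by
  rw [famOne, sumConn_eq_form]
  have h1 := h.refl.d_Q_eq
  have h2 := h.d_Q_eq
  linear_combination (norm := noncomm_ring) (1 - ρ) * h1 + ρ * h2 +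
    hρ Q * IsFrame.form Q Q Q - hρ Q * IsFrame.form g gs Q

theorem gauge_mul (h : IsFrame g gs Q Q) : (gs + (1 - Q)) * (g + (1 - Q)) = 1 := by
  have hQg : Q * g = g := by rw [← h.g_gs, mul_assoc, h.gs_g, h.g_Q]
  have hgsQ : gs * Q = gs := by rw [← h.g_gs, ← mul_assoc, h.gs_g, h.Q_gs]
  linear_combination (norm := noncomm_ring) h.gs_g - hgsQ - hQg + h.Q_Q

theorem IsFrame.symm (h : IsFrame g gs Q Q) : IsFrame gs g Q Q where
  gs_g := h.g_gs
  g_gs := h.gs_g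
  g_Q := by rw [← h.g_gs, ← mul_assoc, h.gs_g, h.Q_gs]
  Q_gs := by rw [← h.g_gs, mul_assoc, h.gs_g, h.g_Q]
  Q_Q := h.Q_Q
  sgn_g := h.sgn_gs
  sgn_gs := h.sgn_g

theorem IsFrame.sgn_add (h : IsFrame g gs p Q) : sgn (g + (1 - Q)) = g + (1 - Q) := by
  rw [map_add, map_sub, map_one, h.sgn_g, h.sgn_Q]

theorem sgn_mul_sumConn (h : IsFrame g gs p Q) (ht : sgn t = t) :
    sgn (t * sumConn Q) = -(t * sumConn Q) := by
  rw [map_mul, ht, sumConn_eq_form, h.refl.sgn_form, mul_neg]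

theorem sgn_famTwo (h : IsFrame g gs Q Q) (hρ : sgn ρ = ρ) (ht : sgn t = t) :
    sgn (famTwo g gs Q ρ t) = -famTwo g gs Q ρ t := by
  rw [famTwo, map_add, map_mul _ (1 - ρ), map_mul _ ρ, map_sub, map_one, hρ,
    sgn_gauge h.symm.sgn_add h.sgn_add (sgn_mul_sumConn h ht), sgn_mul_sumConn h ht]
  noncomm_ring

section Star

variable [StarRing A] [StarModule ℝ A] [ContinuousStar A]

theorem star_Q (h : IsFrame g gs p Q) (hg : star g = gs) : star Q = Q := by
  rw [← h.gs_g, star_mul, hg, ← hg, star_star]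

theorem star_famOne (h : IsFrame g gs p Q) (hg : star g = gs) (hρ : ∀ f, f * ρ = ρ * f)
    (hs : star ρ = ρ) : star (famOne g gs Q ρ) = -famOne g gs Q ρ := by
  rw [famOne, sumConn_eq_form, star_add, star_mul, star_mul, star_sub, star_one, hs,
    h.star_form hg, h.refl.star_form (star_Q h hg)]
  linear_combination (norm := noncomm_ring) hρ (IsFrame.form Q Q Q) - hρ (IsFrame.form g gs Q)

theorem star_mul_sumConn (h : IsFrame g gs p Q) (hg : star g = gs) (ht : ∀ f, f * t = t * f)
    (hs : star t = t) : star (t * sumConn Q) = -(t * sumConn Q) := by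
  rw [star_mul, sumConn_eq_form, hs, h.refl.star_form (star_Q h hg), neg_mul, ht]

theorem star_famTwo (h : IsFrame g gs Q Q) (hg : star g = gs) (hρ : ∀ f, f * ρ = ρ * f)
    (hs : star ρ = ρ) (ht : ∀ f, f * t = t * f) (hst : star t = t) :
    star (famTwo g gs Q ρ t) = -famTwo g gs Q ρ t := by
  have h1 := star_mul_sumConn h hg ht hst
  have h2 := star_gauge (u := gs + (1 - Q)) (h := g + (1 - Q)) h.symm.sgn_add (gauge_mul h)
    (by rw [star_add, hg, star_sub, star_one, star_Q h hg]) h1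
  rw [famTwo, star_add, star_mul (1 - ρ), star_mul ρ, star_sub, star_one, hs, h1, h2]
  linear_combination (norm := noncomm_ring) hρ (t * sumConn Q) -
    hρ ((gs + (1 - Q)) * d (g + (1 - Q)) + (gs + (1 - Q)) * (t * sumConn Q) * (g + (1 - Q)))

end Star

theorem pull_famOne {W : Type*} [NormedAddCommGroup W] [NormedSpace ℝ W] {T' : Dom W}
    (j : AffMap T' T) : pull j (famOne g gs Q ρ) =
      famOne (pull j g) (pull j gs) (pull j Q) (pull j ρ) := by
  simp only [famOne, sumConn_eq_form, map_add, map_mul, map_sub, map_one, pull_form]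

theorem pull_famTwo {W : Type*} [NormedAddCommGroup W] [NormedSpace ℝ W] {T' : Dom W}
    (j : AffMap T' T) : pull j (famTwo g gs Q ρ t) =
      famTwo (pull j g) (pull j gs) (pull j Q) (pull j ρ) (pull j t) := by
  simp only [famTwo, sumConn_eq_form, map_add, map_mul, map_sub, map_one, pull_form, pull_d]

theorem famTwo_one (h : IsFrame g gs Q Q) : famTwo g gs Q ρ 1 = famOne g gs Q ρ := by
  rw [famTwo, famOne, one_mul, ← gauge_frame h]; rfl

theorem compl_famOne (h : IsFrame g gs p Q) (hρ : ∀ f, f * ρ = ρ * f) :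
    (1 - Q) * famOne g gs Q ρ = -((1 - Q) * d Q) := by
  have h1 := h.refl.compl_form
  have h2 := h.compl_form
  rw [famOne, sumConn_eq_form]
  linear_combination (norm := noncomm_ring) (1 - ρ) * h1 + ρ * h2 -
    hρ (1 - Q) * IsFrame.form Q Q Q + hρ (1 - Q) * IsFrame.form g gs Q

end Algebra

end SForm

end HolChern

namespace HolChern

theorem integral_pow_mul_one_sub_pow (m n : ℕ) :
    ∫ r in (0 : ℝ)..1, r ^ m * (1 - r) ^ n =
      (m.factorial * n.factorial : ℝ) / (m + n + 1).factorial := by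
  induction n generalizing m with
  | zero =>
    simp only [pow_zero, mul_one, integral_pow, one_pow, Nat.factorial_zero, add_zero,
      Nat.factorial_succ]
    have := Nat.factorial_ne_zero m
    push_cast
    field_simp
    simp
  | succ n ih =>
    have hd : ∀ r ∈ uIcc (0 : ℝ) 1, HasDerivAt (fun r : ℝ => r ^ (m + 1) * (1 - r) ^ (n + 1))
        ((m + 1) * (r ^ m * (1 - r) ^ (n + 1)) - (n + 1) * (r ^ (m + 1) * (1 - r) ^ n)) r := by
      intro r _
      refine ((hasDerivAt_pow (m + 1) r).mul
        (((hasDerivAt_id r).const_sub 1).pow (n + 1))).congr_deriv ?_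
      simp
      ring
    have h1 := intervalIntegral.integral_eq_sub_of_hasDerivAt hd
      (Continuous.intervalIntegrable (by fun_prop) _ _)
    rw [intervalIntegral.integral_sub (Continuous.intervalIntegrable (by fun_prop) _ _)
      (Continuous.intervalIntegrable (by fun_prop) _ _), intervalIntegral.integral_const_mul,
      intervalIntegral.integral_const_mul, ih] at h1
    have e : m + 1 + n + 1 = m + (n + 1) + 1 := by ring
    rw [e, Nat.factorial_succ m] at h1
    rw [Nat.factorial_succ n]
    have h2 : ((m : ℝ) + 1) * ∫ r in (0 : ℝ)..1, r ^ m * (1 - r) ^ (n + 1) =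
        (n + 1) * ((((m + 1) * m.factorial : ℕ) * n.factorial : ℝ) / (m + (n + 1) + 1).factorial) := by
      rw [← sub_eq_zero, h1]; simp
    have h3 : (m : ℝ) + 1 ≠ 0 := by positivity
    apply mul_left_cancel₀ h3
    rw [h2]
    push_cast
    ring

theorem integral_sq_sub_pow (n : ℕ) :
    ∫ r in (0 : ℝ)..1, (r ^ 2 - r) ^ n =
      (-1) ^ n * ((n.factorial : ℝ) ^ 2 / (2 * n + 1).factorial) := by
  have h : ∀ r : ℝ, (r ^ 2 - r) ^ n = (-1) ^ n * (r ^ n * (1 - r) ^ n) := fun r => by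
    rw [← mul_pow, ← mul_pow]; ring
  simp only [h, intervalIntegral.integral_const_mul, integral_pow_mul_one_sub_pow]
  rw [two_mul, sq]

namespace SForm

section Edges

variable {E A B : Type*} [NormedAddCommGroup E] [NormedSpace ℝ E] [FiniteDimensional ℝ E]
  [NormedRing A] [NormedAlgebra ℝ A] [NormedRing B] [NormedAlgebra ℝ B] [CompleteSpace B]
  {S : Dom E}

theorem nsmul_val {V : Type*} [NormedAddCommGroup V] [NormedSpace ℝ V] {T : Dom V} (n : ℕ)
    (f : SForm T A) (y : T.carrier) (l : List V) : (n • f).1 y l = n • f.1 y l := by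
  induction n with
  | zero => simp
  | succ n ih => rw [succ_nsmul, succ_nsmul, add_val, LForm.add_apply, ih]

theorem traceCurv_sub {V : Type*} [NormedAddCommGroup V] [NormedSpace ℝ V] {T : Dom V}
    (τ : A →L[ℝ] B) (Q C : SForm T A) (n : ℕ) :
    traceCurv τ 1 C n - traceCurv τ Q C n = traceCurv τ (1 - Q) C n := by
  rw [traceCurv, traceCurv, traceCurv, ← mapVal_sub, sub_mul]

theorem pull_traceCurv {V W : Type*} [NormedAddCommGroup V] [NormedSpace ℝ V]
    [NormedAddCommGroup W] [NormedSpace ℝ W] {T : Dom V} {T' : Dom W} (j : AffMap T' T)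
    (τ : A →L[ℝ] B) (Q C : SForm T A) (n : ℕ) :
    pull j (traceCurv τ Q C n) = traceCurv τ (pull j Q) (pull j C) n := by
  rw [traceCurv, pull_mapVal, map_mul, map_pow, pull_curv, traceCurv]

theorem lineInt_eq_zero {f : SForm (S.prodUniv ℝ) B} (h : contr (0, 1) f = 0) : lineInt f = 0 := by
  funext y l
  rw [lineInt_eq, h]
  simp

theorem scalar_mul_pow {V : Type*} [NormedAddCommGroup V] [NormedSpace ℝ V] {T : Dom V} (b : ℝ)
    (f : SForm T A) (n : ℕ) : (scalar T A 0 b * f) ^ n = scalar T A 0 (b ^ n) * f ^ n := by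
  have h : ∀ b c : ℝ, scalar T A 0 (b * c) = scalar T A 0 b * scalar T A 0 c := fun b c => by
    rw [scalar, scalar, scalar, ofFun_mul]
    exact ofFun_congr fun z _ => by simp [smul_smul, mul_comm]
  induction n with
  | zero => simp [scalar_zero_one]
  | succ n ih =>
    rw [pow_succ, ih, pow_succ, pow_succ, h]
    linear_combination (norm := noncomm_ring) scalar T A 0 (b ^ n) * mul_scalar 0 b (f ^ n) * f

theorem d_scalar_zero {V : Type*} [NormedAddCommGroup V] [NormedSpace ℝ V] {T : Dom V} (b : ℝ) :
    d (scalar T A 0 b) = 0 := by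
  ext y (_ | ⟨v, l⟩)
  · rfl
  · rw [scalar, d_ofFun_cons]
    simp

theorem ld_coord : ld (0, 1) (coord S A) = 1 := by
  ext y (_ | ⟨v, l⟩)
  · rw [ld_congr (F := fun z : E × ℝ => (ContinuousLinearMap.snd ℝ E ℝ) z • (1 : A))]
    · rw [(((ContinuousLinearMap.snd ℝ E ℝ).hasFDerivWithinAt).smul_const (1 : A)).fderivWithin
        ((S.prodUniv ℝ).uniqueDiff y y.2)]
      simp
    · intro z hz
      rw [ev_of_mem _ _ hz, coord, scalar, ofFun_val]
      simp
  · rw [ld_congr (F := fun _ : E × ℝ => (0 : A))]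
    · simp; rfl
    · intro z hz
      rw [ev_of_mem _ _ hz, coord, scalar, ofFun_val]
      rfl

theorem contr_coord (v : E × ℝ) : contr v (coord S A) = 0 := by
  rw [coord, scalar, contr_ofFun]

variable (τ : A →L[ℝ] B) (hτ : ∀ a b, τ (a * b) = τ (b * a))

include hτ

/-- The transgression form of the pure gauge connection `θ = u dh`. -/
theorem lineInt_coord_mul {u h : SForm S A} (hu : sgn u = u) (hh : sgn h = h) (huh : u * h = 1)
    (hhu : h * u = 1) (hbu : ∀ v, contr v u = 0) (hbh : ∀ v, contr v h = 0) (n : ℕ)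
    (y : S.carrier) (l : List E) :
    lineInt (traceCurv τ 1 (coord S A * pull (projFst S ℝ) (u * d h)) n) y l =
      ((-1) ^ n * ((n + 1) * (n.factorial : ℝ) ^ 2 / (2 * n + 1).factorial)) •
        (mapVal τ (((u * d h) * (u * d h)) ^ n * (u * d h))).1 y l := by
  set θ := u * d h with hθ
  have hsθ : sgn θ = -θ := by rw [hθ, map_mul, hu, sgn_d, hh, mul_neg]
  have hdθ : d θ = -(θ * θ) := by
    have h1 := curv_gauge (C := 0) hu (by simp) huh hhu
    have h2 : curv (0 : SForm S A) = 0 := by simp [curv]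
    simp only [h2, mul_zero, zero_mul, add_zero] at h1
    rw [← hθ, curv] at h1
    exact eq_neg_of_add_eq_zero_left h1
  set Θ := pull (projFst S ℝ) θ with hΘ
  set C := coord S A * Θ with hC
  have hΘb : Θ ∈ basic (S.prodUniv ℝ) A (0, 1) := by
    rw [hΘ, hθ, map_mul, pull_d]
    exact mul_mem (pull_projFst_mem_basic hbu _) (d_mem_basic (pull_projFst_mem_basic hbh _))
  have hCs : sgn C = -C := by
    rw [hC, map_mul, ← pull_sgn, hsθ, coord, sgn_scalar, map_neg, mul_neg]
  have h1 : contr (0, 1) (curv C) = Θ := by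
    have h2 : contr (0, 1) C = 0 := by
      rw [hC, contr_mul, contr_coord, hΘb.1]; simp
    have h2' : ld (0, 1) C = Θ := by rw [hC, ld_mul, ld_coord, hΘb.2]; simp
    rw [curv, contr_add, contr_d, contr_mul _ C C, h2, h2']; simp
  have h3 : ∀ s, pull (slice S s) C = scalar S A 0 s * θ := fun s => by
    rw [hC, map_mul, hΘ, pull_slice_projFst, coord, pull_scalar]
    congr 1
    exact scalar_congr fun z => by simp [slice]
  have h4 : ∀ s, curv (scalar S A 0 s * θ) = scalar S A 0 (s ^ 2 - s) * (θ * θ) := fun s => by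
    have h5 : scalar S A 0 (s ^ 2 - s) = scalar S A 0 s * scalar S A 0 s - scalar S A 0 s := by
      rw [scalar, scalar, ofFun_mul, ofFun_sub]
      exact ofFun_congr fun z _ => by simp [← mul_smul, ← sub_smul, sq]
    rw [curv, d_mul, d_scalar_zero, sgn_scalar, hdθ, h5]
    linear_combination (norm := noncomm_ring) scalar S A 0 s * mul_scalar 0 s θ * θ
  have h6 : ∀ s, (pull (slice S s) (contr (0, 1) (traceCurv τ 1 C n))).1 y l =
      (s ^ 2 - s) ^ n • ((n + 1) • (mapVal τ ((θ * θ) ^ n * θ)).1 y l) := fun s => by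
    have h7 : ∀ b, θ * (scalar S A 0 b * (θ * θ) ^ n) =
        scalar S A 0 b * ((θ * θ) ^ n * θ) := fun b => by
      have h8 : Commute θ (θ * θ) := (mul_assoc θ θ θ).symm
      rw [← mul_assoc, mul_scalar, mul_assoc, (h8.pow_right n).eq]
    rw [traceCurv, one_mul, contr_mapVal, mapVal_contr_pow τ hτ _ (sgn_curv hCs), map_nsmul,
      pull_mapVal, nsmul_val, h1, map_mul, map_pow, pull_curv, h3, h4, hΘ, pull_slice_projFst,
      scalar_mul_pow, h7]
    rw [mapVal_val, LForm.mapVal_apply, mapVal_val, LForm.mapVal_apply, smul_comm]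
    congr 1
    have := scalar_mul_val 0 ((s ^ 2 - s) ^ n) ((θ * θ) ^ n * θ) y l
    rw [this]
    simp
  rw [lineInt_eq]
  simp only [h6]
  rw [intervalIntegral.integral_smul_const, integral_sq_sub_pow, ← Nat.cast_smul_eq_nsmul ℝ,
    smul_smul]
  congr 1
  push_cast
  ring

omit hτ

/-- The transgression form on the first square. -/
def omegaOne (gL gsL : SForm (S.prodUniv ℝ) A) (Q : SForm S A) (n : ℕ) :
    SForm (S.prodUniv (ℝ × ℝ)) B :=
  traceCurv τ (pull (projFst S _) Q)
    (famOne (pull (projTime S) gL) (pull (projTime S) gsL) (pull (projFst S _) Q) (coordR S A)) n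

/-- The transgression form on the second square. -/
def omegaTwo (g gs Q : SForm S A) (n : ℕ) : SForm (S.prodUniv (ℝ × ℝ)) B :=
  traceCurv τ 1 (famTwo (pull (projFst S _) g) (pull (projFst S _) gs) (pull (projFst S _) Q)
    (coordR S A) (coordT S A)) n

variable {gL gsL pL : SForm (S.prodUniv ℝ) A} {Q g gs : SForm S A}

theorem isFrame_slice_one (hL : IsFrame gL gsL pL (pull (projFst S ℝ) Q))
    (e1 : pull (slice S 1) gL = g) (es1 : pull (slice S 1) gsL = gs)
    (ep1 : pull (slice S 1) pL = Q) : IsFrame g gs Q Q := by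
  have := hL.pull (slice S 1)
  rwa [e1, es1, ep1, pull_slice_projFst] at this

theorem isFrame_projTime (hL : IsFrame gL gsL pL (pull (projFst S ℝ) Q)) :
    IsFrame (pull (projTime S) gL) (pull (projTime S) gsL) (pull (projTime S) pL)
      (pull (projFst S (ℝ × ℝ)) Q) := by
  have := hL.pull (projTime S)
  rwa [pull_projTime_projFst] at this

include hτ

theorem d_omegaOne (hL : IsFrame gL gsL pL (pull (projFst S ℝ) Q)) (n : ℕ) :
    d (omegaOne τ gL gsL Q n) = 0 :=
  d_trace_eq_zero τ hτ (sgn_famOne (isFrame_projTime hL) (sgn_scalar _ _))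
    (isFrame_projTime hL).sgn_Q (d_Q_famOne (isFrame_projTime hL) (mul_scalar _ _)) _

theorem d_omegaTwo (h : IsFrame g gs Q Q) (n : ℕ) : d (omegaTwo τ g gs Q n) = 0 :=
  d_trace_eq_zero τ hτ (sgn_famTwo (h.pull _) (sgn_scalar _ _) (sgn_scalar _ _))
    (map_one _) (by simp) _

theorem d_squareInt_omega (hc : LocConvex S.carrier)
    (hL : IsFrame gL gsL pL (pull (projFst S ℝ) Q))
    (e0 : pull (slice S 0) gL = Q) (es0 : pull (slice S 0) gsL = Q)
    (e1 : pull (slice S 1) gL = g) (es1 : pull (slice S 1) gsL = gs)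
    (ep1 : pull (slice S 1) pL = Q)
    (hQ0 : ∀ v, contr v Q = 0) (hg0 : ∀ v, contr v g = 0) (hgs0 : ∀ v, contr v gs = 0)
    (n : ℕ) (y : S.carrier) (l : List E) :
    (d (squareIntS hc (contr (0, (1, 0)) (contr (0, (0, 1)) (omegaOne τ gL gsL Q n))))).1 y l -
      (d (squareIntS hc (contr (0, (1, 0)) (contr (0, (0, 1)) (omegaTwo τ g gs Q n))))).1 y l =
    lineInt (mapVal τ (pL * (d pL * d pL) ^ (n + 1))) y l -
      ((-1) ^ n * ((n + 1) * (n.factorial : ℝ) ^ 2 / (2 * n + 1).factorial)) •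
        (mapVal τ ((((gs + (1 - Q)) * d (g + (1 - Q))) * ((gs + (1 - Q)) * d (g + (1 - Q)))) ^ n *
          ((gs + (1 - Q)) * d (g + (1 - Q))))).1 y l := by
  have hF := isFrame_slice_one hL e1 es1 ep1
  have hFL := hF.pull (projFst S ℝ)
  set QL := pull (projFst S ℝ) Q with hQL
  have hQb : QL ∈ basic (S.prodUniv ℝ) A (0, 1) := pull_projFst_mem_basic hQ0 1
  have hC0b : sumConn QL ∈ basic (S.prodUniv ℝ) A (0, 1) :=
    sub_mem (mul_mem hQb (d_mem_basic hQb)) (mul_mem (sub_mem (one_mem _) hQb) (d_mem_basic hQb))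
  have hz : lineInt (traceCurv τ QL (sumConn QL) n) y l = 0 := by
    rw [traceCurv, lineInt_eq_zero (contr_mapVal_eq_zero τ (mul_mem hQb (pow_mem (curv_mem_basic hC0b) _)))]
    rfl
  have v1 : pull (vertLine S 1) (omegaOne τ gL gsL Q n) =
      mapVal τ (pL * (d pL * d pL) ^ (n + 1)) := by
    rw [omegaOne, pull_traceCurv, pull_famOne, pull_vertLine_projTime, pull_vertLine_projTime,
      pull_vertLine_projFst, pull_vertLine_coordR, scalar_zero_one, famOne, sub_self, zero_mul,
      zero_add, one_mul, traceCurv, hL.trace_form τ hτ]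
  have v0 : pull (vertLine S 0) (omegaOne τ gL gsL Q n) = traceCurv τ QL (sumConn QL) n := by
    rw [omegaOne, pull_traceCurv, pull_famOne, pull_vertLine_projFst, pull_vertLine_coordR,
      scalar_zero_zero, famOne, sub_zero, zero_mul, add_zero, one_mul]
  have k0 : pull (horLine S 0) (omegaOne τ gL gsL Q n) = traceCurv τ QL (sumConn QL) n := by
    rw [omegaOne, pull_traceCurv, pull_famOne, pull_horLine_projTime, pull_horLine_projTime,
      pull_horLine_projFst, e0, es0, famOne, ← sumConn_eq_form, ← add_mul, sub_add_cancel, one_mul]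
  have k1 : pull (horLine S 1) (omegaOne τ gL gsL Q n) =
      traceCurv τ QL (famOne (pull (projFst S ℝ) g) (pull (projFst S ℝ) gs) QL (coord S A)) n := by
    rw [omegaOne, pull_traceCurv, pull_famOne, pull_horLine_projTime, pull_horLine_projTime,
      pull_horLine_projFst, e1, es1, pull_horLine_coordR]
  have m1 : pull (horLine S 1) (omegaTwo τ g gs Q n) =
      traceCurv τ 1 (famOne (pull (projFst S ℝ) g) (pull (projFst S ℝ) gs) QL (coord S A)) n := by
    rw [omegaTwo, pull_traceCurv, pull_famTwo, pull_horLine_projFst, pull_horLine_projFst,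
      pull_horLine_projFst, pull_horLine_coordR, pull_horLine_coordT, scalar_zero_one, map_one,
      famTwo_one hFL]
  have m0 : pull (horLine S 0) (omegaTwo τ g gs Q n) =
      traceCurv τ 1 (coord S A *
        pull (projFst S ℝ) ((gs + (1 - Q)) * d (g + (1 - Q)))) n := by
    rw [omegaTwo, pull_traceCurv, pull_famTwo, pull_horLine_projFst, pull_horLine_projFst,
      pull_horLine_projFst, pull_horLine_coordR, pull_horLine_coordT, scalar_zero_zero, map_one,
      famTwo]
    simp only [zero_mul, mul_zero, add_zero, zero_add, map_mul, map_add, map_sub, map_one, pull_d]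
  have w : pull (vertLine S 1) (omegaTwo τ g gs Q n) = pull (vertLine S 0) (omegaTwo τ g gs Q n) := by
    rw [omegaTwo, pull_traceCurv, pull_traceCurv, pull_famTwo, pull_famTwo]
    simp only [pull_vertLine_projFst, pull_vertLine_coordR, pull_vertLine_coordT,
      scalar_zero_zero, scalar_zero_one, map_one, famTwo, sub_self, sub_zero, zero_mul, one_mul,
      zero_add, add_zero, traceCurv]
    exact trace_gauge τ hτ hFL.symm.sgn_add (sgn_mul_sumConn hFL (sgn_scalar _ _)) (gauge_mul hFL)
      (gauge_mul hFL.symm) _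
  have hk : lineInt (pull (horLine S 1) (omegaTwo τ g gs Q n)) =
      lineInt (pull (horLine S 1) (omegaOne τ gL gsL Q n)) := by
    rw [m1, k1]
    refine lineInt_congr ?_
    rw [← sub_eq_zero, ← contr_sub, traceCurv_sub, traceCurv]
    have hcur := compl_curv hFL.sgn_Q hFL.Q_Q
      (compl_famOne (ρ := coord S A) hFL (mul_scalar _ _))
    rw [mul_pow_of_mul_eq hcur]
    · refine contr_mapVal_eq_zero τ (pow_mem (mul_mem (mul_mem (d_mem_basic hQb)
        (d_mem_basic hQb)) (sub_mem (one_mem _) hQb)) _)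
    · linear_combination (norm := noncomm_ring) d QL * d QL * hFL.Q_Q
  rw [d_squareIntS_of_closed hc (d_omegaOne τ hτ hL n), d_squareIntS_of_closed hc
    (d_omegaTwo τ hτ hF n), hk, w, v1, v0, k0, hz, m0, lineInt_coord_mul τ hτ hF.symm.sgn_add
    hF.sgn_add (gauge_mul hF) (gauge_mul hF.symm)]
  · abel
  · intro v; rw [contr_add, contr_sub, hgs0, hQ0, contr_one]; simp
  · intro v; rw [contr_add, contr_sub, hg0, hQ0, contr_one]; simp

end Edges

end SForm

end HolChern

namespace HolChern

open SForm

section Loop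

variable {E A B : Type*} [NormedAddCommGroup E] [NormedSpace ℝ E] [FiniteDimensional ℝ E]
  [NormedRing A] [NormedAlgebra ℝ A] [CompleteSpace A]
  [NormedRing B] [NormedAlgebra ℝ B] [CompleteSpace B]
  [StarRing A] [StarModule ℝ A] [ContinuousStar A] {S : Dom E} {p : E × ℝ → A}

namespace ProjLoop

variable (h : ProjLoop S p) (hc : LocConvex S.carrier)

theorem contDiffOn_slice {a : E × ℝ → A} (ha : ContDiffOn ℝ ∞ a (S.carrier ×ˢ univ)) (c : ℝ) :
    ContDiffOn ℝ ∞ (fun y => a (y, c)) S.carrier :=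
  ha.comp (f := fun y => (y, c)) (by fun_prop) fun y hy => ⟨hy, mem_univ _⟩

theorem smooth_prodUniv (h : ProjLoop S p) : ContDiffOn ℝ ∞ p (S.prodUniv ℝ).carrier := h.smooth

theorem contDiffOn_frameFn_prodUniv (h : ProjLoop S p) (hc : LocConvex S.carrier) : ContDiffOn ℝ ∞ (frameFn S p) (S.prodUniv ℝ).carrier :=
  h.contDiffOn_frameFn hc

/-- The family of projections, as a form. -/
def projForm : SForm (S.prodUniv ℝ) A := ofFun p h.smooth_prodUniv

/-- The parallel transport, as a form. -/
def frameForm : SForm (S.prodUniv ℝ) A := ofFun (frameFn S p) (h.contDiffOn_frameFn_prodUniv hc)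

/-- The projection at the base point of the loop. -/
def baseForm : SForm S A := ofFun (fun y => p (y, 0)) (contDiffOn_slice h.smooth 0)

/-- The holonomy, extended by zero. -/
def holForm : SForm S A :=
  ofFun (fun y => frameFn S p (y, 1)) (contDiffOn_slice (h.contDiffOn_frameFn hc) 1)

theorem isFrame : IsFrame (h.frameForm hc) (star (h.frameForm hc)) h.projForm
    (pull (projFst S ℝ) h.baseForm) := by
  have e : pull (projFst S ℝ) h.baseForm =
      ofFun (fun z => p (z.1, 0)) ((contDiffOn_slice h.smooth 0).comp (f := fun z : E × ℝ => z.1)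
        (by fun_prop) fun z hz => hz.1) := by
    rw [baseForm, pull_ofFun]
    exact ofFun_congr fun z _ => by simp [projFst]
  have k := fun z : E × ℝ => fun hz : z ∈ (S.prodUniv ℝ).carrier => h.projPath hz.1
  have k1 := fun z : E × ℝ => fun hz : z ∈ (S.prodUniv ℝ).carrier =>
    h.hasDerivAt_frameFn hc hz.1
  have k0 := fun z : E × ℝ => fun hz : z ∈ (S.prodUniv ℝ).carrier => h.frameFn_zero hz.1
  rw [e, frameForm, star_ofFun, projForm]
  constructor
  · rw [ofFun_mul]
    exact ofFun_congr fun z hz => (k z hz).star_transport_mul (k1 z hz) (k0 z hz) z.2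
  · rw [ofFun_mul]
    exact ofFun_congr fun z hz => (k z hz).transport_mul_star (k1 z hz) (k0 z hz) z.2
  · rw [ofFun_mul]
    exact ofFun_congr fun z hz => (k z hz).transport_mul (k1 z hz) (k0 z hz) z.2
  · rw [ofFun_mul]
    refine ofFun_congr fun z hz => ?_
    have := congrArg star ((k z hz).transport_mul (k1 z hz) (k0 z hz) z.2)
    rwa [star_mul, h.star_eq _ hz.1] at this
  · rw [ofFun_mul]
    exact ofFun_congr fun z hz => h.idem _ hz.1 0
  · exact sgn_ofFun _ _
  · exact sgn_ofFun _ _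

theorem slice_zero_frameForm : pull (slice S 0) (h.frameForm hc) = h.baseForm := by
  rw [frameForm, pull_ofFun, baseForm]
  exact ofFun_congr fun y hy => by simpa [slice] using h.frameFn_zero hy

theorem star_baseForm : star h.baseForm = h.baseForm := by
  rw [baseForm, star_ofFun]
  exact ofFun_congr fun y hy => h.star_eq y hy 0

theorem slice_one_frameForm : pull (slice S 1) (h.frameForm hc) = h.holForm hc := by
  rw [frameForm, pull_ofFun, holForm]
  exact ofFun_congr fun y hy => by simp [slice]

theorem slice_one_projForm : pull (slice S 1) h.projForm = h.baseForm := by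
  rw [projForm, pull_ofFun, baseForm]
  exact ofFun_congr fun y hy => by simpa [slice] using h.loop y hy

theorem isFrame_hol : IsFrame (h.holForm hc) (star (h.holForm hc)) h.baseForm h.baseForm :=
  isFrame_slice_one (h.isFrame hc) (h.slice_one_frameForm hc)
    (by rw [pull_star, h.slice_one_frameForm hc]) h.slice_one_projForm

variable (τ : A →L[ℝ] B)

/-- The transgression form of the first square. -/
def formOne (n : ℕ) : SForm (S.prodUniv (ℝ × ℝ)) B :=
  omegaOne τ (h.frameForm hc) (star (h.frameForm hc)) h.baseForm n

/-- The transgression form of the second square. -/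
def formTwo (n : ℕ) : SForm (S.prodUniv (ℝ × ℝ)) B :=
  omegaTwo τ (h.holForm hc) (star (h.holForm hc)) h.baseForm n

/-- The Maurer-Cartan form of the holonomy. -/
def mcForm : SForm S A :=
  (star (h.holForm hc) + (1 - h.baseForm)) * d (h.holForm hc + (1 - h.baseForm))

theorem d_squareInt (hτ : ∀ a b, τ (a * b) = τ (b * a)) (n : ℕ) (y : S.carrier) (l : List E) :
    (d (squareIntS hc (contr (0, (1, 0)) (contr (0, (0, 1)) (h.formOne hc τ n))))).1 y l -
      (d (squareIntS hc (contr (0, (1, 0)) (contr (0, (0, 1)) (h.formTwo hc τ n))))).1 y l =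
    lineInt (mapVal τ (h.projForm * (d h.projForm * d h.projForm) ^ (n + 1))) y l -
      ((-1) ^ n * ((n + 1) * (n.factorial : ℝ) ^ 2 / (2 * n + 1).factorial)) •
        (mapVal τ ((h.mcForm hc * h.mcForm hc) ^ n * h.mcForm hc)).1 y l :=
  d_squareInt_omega τ hτ hc (h.isFrame hc) (h.slice_zero_frameForm hc)
    (by rw [pull_star, h.slice_zero_frameForm hc, h.star_baseForm]) (h.slice_one_frameForm hc)
    (by rw [pull_star, h.slice_one_frameForm hc]) h.slice_one_projForm
    (fun v => contr_ofFun _ _ _) (fun v => contr_ofFun _ _ _)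
    (fun v => by rw [holForm, star_ofFun, contr_ofFun]) n y l

variable [StarRing B]

theorem star_formOne (hτ : ∀ a b, τ (a * b) = τ (b * a)) (hs : ∀ a, τ (star a) = star (τ a))
    (n : ℕ) (z : (S.prodUniv (ℝ × ℝ)).carrier) :
    star ((h.formOne hc τ n).1 z) = (h.formOne hc τ n).1 z := by
  have hF := isFrame_projTime (h.isFrame hc)
  have hst : star (pull (projTime S) (h.frameForm hc)) =
    pull (projTime S) (star (h.frameForm hc)) := (pull_star _ _).symm
  exact mapVal_mul_curv_pow_star τ hτ hs (sgn_famOne hF (sgn_scalar _ _))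
    (star_famOne hF hst (mul_scalar _ _) (star_scalar _ _)) (star_Q hF hst) (n + 1) z

theorem star_formTwo (hτ : ∀ a b, τ (a * b) = τ (b * a)) (hs : ∀ a, τ (star a) = star (τ a))
    (n : ℕ) (z : (S.prodUniv (ℝ × ℝ)).carrier) :
    star ((h.formTwo hc τ n).1 z) = (h.formTwo hc τ n).1 z := by
  have hF := (h.isFrame_hol hc).pull (projFst S (ℝ × ℝ))
  have hst : star (pull (projFst S (ℝ × ℝ)) (h.holForm hc)) =
    pull (projFst S (ℝ × ℝ)) (star (h.holForm hc)) := (pull_star _ _).symm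
  exact mapVal_mul_curv_pow_star τ hτ hs (sgn_famTwo hF (sgn_scalar _ _) (sgn_scalar _ _))
    (star_famTwo hF hst (mul_scalar _ _) (star_scalar _ _) (mul_scalar _ _) (star_scalar _ _))
    (star_one _) (n + 1) z

end ProjLoop

end Loop

end HolChern

namespace HolChern

section MatInstances

variable {p q : ℤ}

instance : CompleteSpace (Mat p q) := FiniteDimensional.complete ℝ _

instance : StarRing (Mat p q) :=
  (inferInstance : StarRing (Matrix (Finset.Ico p q) (Finset.Ico p q) ℂ))

instance : StarModule ℝ (Mat p q) :=
  (inferInstance : StarModule ℝ (Matrix (Finset.Ico p q) (Finset.Ico p q) ℂ))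

/-- The adjoint, as a linear map. -/
def starLin (p q : ℤ) : Mat p q →ₗ[ℝ] Mat p q where
  toFun := star
  map_add' := star_add
  map_smul' c m := by simp

instance : ContinuousStar (Mat p q) := ⟨(starLin p q).continuous_of_finiteDimensional⟩

theorem trL_mul_comm (a b : Mat p q) : trL p q (a * b) = trL p q (b * a) :=
  Matrix.trace_mul_comm (n := Finset.Ico p q) (R := ℂ) a b

theorem trL_star (a : Mat p q) : trL p q (star a) = star (trL p q a) :=
  Matrix.trace_conjTranspose (n := Finset.Ico p q) (R := ℂ) a

theorem Mat.inv_eq {m u : Mat p q} (h : m * u = 1) : m.inv = u :=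
  Matrix.inv_eq_right_inv (n := Finset.Ico p q) (α := ℂ) h

/-- A matrix is given by its entries. -/
def entriesL (p q : ℤ) : (Finset.Ico p q → Finset.Ico p q → ℂ) ≃L[ℝ] Mat p q :=
  LinearEquiv.toContinuousLinearEquiv
    { toFun := fun m => (Matrix.of m : Matrix (Finset.Ico p q) (Finset.Ico p q) ℂ)
      invFun := fun m => m
      map_add' := fun _ _ => rfl
      map_smul' := fun _ _ => rfl }

theorem Mat.mul_apply (a b : Mat p q) (i j : Finset.Ico p q) :
    (a * b) i j = ∑ k, a i k * b k j :=
  Matrix.mul_apply (M := (a : Matrix (Finset.Ico p q) (Finset.Ico p q) ℂ))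

theorem Mat.add_apply (a b : Mat p q) (i j : Finset.Ico p q) : (a + b) i j = a i j + b i j := rfl
theorem Mat.sub_apply (a b : Mat p q) (i j : Finset.Ico p q) : (a - b) i j = a i j - b i j := rfl
theorem Mat.zero_apply (i j : Finset.Ico p q) : (0 : Mat p q) i j = 0 := rfl
theorem Mat.star_apply (a : Mat p q) (i j : Finset.Ico p q) : (star a) i j = star (a j i) := rfl
theorem Mat.one_apply (i j : Finset.Ico p q) : (1 : Mat p q) i j = if i = j then 1 else 0 :=
  Matrix.one_apply (α := ℂ)

@[ext] theorem Mat.ext {a b : Mat p q} (h : ∀ i j, a i j = b i j) : a = b :=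
  Matrix.ext (α := ℂ) h

end MatInstances

section Inner

theorem ip_basisVec_left (i : ℤ) (x : CZ) : ip (basisVec i) x = x i := by
  rw [ip, basisVec, Finsupp.sum_single_index] <;> simp

theorem ip_eq_sum {x : CZ} (y : CZ) {s : Finset ℤ} (hs : x.support ⊆ s) :
    ip x y = ∑ i ∈ s, star (x i) * y i :=
  Finsupp.sum_of_support_subset _ hs _ (by simp)

theorem star_ip (x y : CZ) : star (ip x y) = ip y x := by
  rw [ip_eq_sum y (Finset.subset_union_left (s₂ := y.support)),
    ip_eq_sum x (Finset.subset_union_right (s₁ := x.support)), star_sum]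
  exact Finset.sum_congr rfl fun i _ => by rw [star_mul, star_star]

theorem eq_zero_of_ip_self {x : CZ} (h : ip x x = 0) : x = 0 := by
  have h1 : ∀ i, star (x i) * x i = ((‖x i‖ ^ 2 : ℝ) : ℂ) := fun i => by
    have := Complex.conj_mul' (x i)
    simpa using this
  rw [ip_eq_sum x (Finset.Subset.refl _), Finset.sum_congr rfl fun i _ => h1 i,
    ← Complex.ofReal_sum, Complex.ofReal_eq_zero,
    Finset.sum_eq_zero_iff_of_nonneg fun i _ => by positivity] at h
  ext i
  by_contra hi
  have := h i (Finsupp.mem_support_iff.2 hi)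
  simp at this
  exact hi this

end Inner

section Idempotent

theorem stdProj_mul_self (k : ℤ) : stdProj k * stdProj k = stdProj k := by
  refine Finsupp.lhom_ext' fun i => LinearMap.ext_ring ?_
  have h : ∀ i, stdProj k (Finsupp.single i 1) = if i < k then basisVec i else 0 := fun i => by
    rw [stdProj, Finsupp.linearCombination_single, one_smul]
  simp only [LinearMap.comp_apply, Finsupp.lsingle_apply, Module.End.mul_apply, h]
  split_ifs with hi
  · rw [basisVec, h, if_pos hi, basisVec]
  · simp

theorem finiteDimensional_range_mul_left {A B : Op}
    (h : FiniteDimensional ℂ (LinearMap.range A)) : FiniteDimensional ℂ (LinearMap.range (A * B)) :=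
  Submodule.finiteDimensional_of_le (LinearMap.range_comp_le_range B A)

theorem finiteDimensional_range_mul_right {A B : Op}
    (h : FiniteDimensional ℂ (LinearMap.range B)) :
    FiniteDimensional ℂ (LinearMap.range (A * B)) := by
  have : LinearMap.range (A * B) = (LinearMap.range B).map A := LinearMap.range_comp B A
  rw [this]; infer_instance

theorem finiteDimensional_range_add {A B : Op} (h : FiniteDimensional ℂ (LinearMap.range A))
    (h' : FiniteDimensional ℂ (LinearMap.range B)) :
    FiniteDimensional ℂ (LinearMap.range (A + B)) :=
  Submodule.finiteDimensional_of_le (LinearMap.range_add_le A B)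

theorem mul_self_sub_eq {R : Type*} [Ring R] {P S K : R} (hP : P = S + K) (hS : S * S = S) :
    P * P - P = S * K + K * S + (K * K + (-1) * K) := by
  rw [hP]
  linear_combination (norm := noncomm_ring) hS

/-- Hermitian operators with spectrum in `{0, 1}` are projections. -/
theorem BUZ.mul_self {P : Op} (hP : P ∈ BUZ) : P * P = P := by
  obtain ⟨hH, hs, hf⟩ := hP
  set K := P - stdProj 0 with hK
  set T := P * P - P with hT
  have hTK : T = stdProj 0 * K + K * stdProj 0 + (K * K + (-1) * K) :=
    hT.trans (mul_self_sub_eq (R := Op) (add_sub_cancel (stdProj 0) P).symm (stdProj_mul_self 0))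
  have hfT : FiniteDimensional ℂ (LinearMap.range T) := by
    rw [hTK]
    exact finiteDimensional_range_add (finiteDimensional_range_add
      (finiteDimensional_range_mul_right hf) (finiteDimensional_range_mul_left hf))
      (finiteDimensional_range_add (finiteDimensional_range_mul_left hf)
        (finiteDimensional_range_mul_right hf))
  have hcomm : P * T = T * P := LinearMap.ext fun v => by
    change P (P (P v) - P v) = P (P (P v)) - P (P v)
    rw [map_sub]
  have hHT : ∀ x y, ip (T x) y = ip x (T y) := fun x y => by
    have e1 : ∀ a b c : CZ, ip (a - b) c = ip a c - ip b c := fun a b c => by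
      have h1 : (a - b).support ⊆ a.support ∪ b.support := Finsupp.support_sub
      rw [ip_eq_sum c h1, ip_eq_sum c (Finset.subset_union_left (s₂ := b.support)),
        ip_eq_sum c (Finset.subset_union_right (s₁ := a.support)), ← Finset.sum_sub_distrib]
      exact Finset.sum_congr rfl fun i _ => by simp [sub_mul]
    have e2 : ∀ a b c : CZ, ip c (a - b) = ip c a - ip c b := fun a b c => by
      rw [← star_ip, e1, star_sub, star_ip, star_ip]
    simp only [hT, LinearMap.sub_apply, Module.End.mul_apply, e1, e2, hH]
  rw [← sub_eq_zero]
  change T = 0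
  by_contra hne
  have hinv : ∀ w ∈ LinearMap.range T, P w ∈ LinearMap.range T := by
    rintro _ ⟨v, rfl⟩
    exact ⟨P v, (LinearMap.congr_fun hcomm v).symm⟩
  obtain ⟨v, hv⟩ : ∃ v, T v ≠ 0 := by
    by_contra! h
    exact hne (LinearMap.ext h)
  have : Nontrivial (LinearMap.range T) := ⟨⟨⟨T v, v, rfl⟩, 0, fun h => hv (congrArg Subtype.val h)⟩⟩
  obtain ⟨μ, hμ⟩ := Module.End.exists_eigenvalue (K := ℂ)
    (V := LinearMap.range T) (P.restrict hinv)
  obtain ⟨⟨w, u, rfl⟩, hw⟩ := hμ.exists_hasEigenvector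
  have hPw : P (T u) = μ • T u := congrArg Subtype.val hw.apply_eq_smul
  have hw0 : T u ≠ 0 := fun h => hw.2 (Subtype.ext h)
  have hμs : μ ∈ spectrum ℂ P :=
    (Module.End.hasEigenvalue_of_hasEigenvector
      (⟨Module.End.mem_eigenspace_iff.2 hPw, hw0⟩ : P.HasEigenvector μ (T u))).mem_spectrum
  have hμ2 : μ * μ - μ = 0 := by
    rcases hs hμs with h | h
    · rw [h]; ring
    · rw [show μ = 1 from h]; ring
  have hTT : T (T u) = 0 := by
    change P (P (T u)) - P (T u) = 0
    rw [hPw, map_smul, hPw, smul_smul, ← sub_smul, hμ2, zero_smul]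
  exact hw0 (eq_zero_of_ip_self (by rw [hHT, hTT, ip]; simp))

end Idempotent

section ExtOp

variable {p q : ℤ}

/-- The operator given by a matrix on the window `[p, q)`, by `a` below and by `b` above it. -/
def extOp (a b : ℂ) (m : Mat p q) : Op where
  toFun v := Finsupp.onFinset (v.support ∪ Finset.Ico p q)
    (fun i => if h : i ∈ Finset.Ico p q then ∑ k : Finset.Ico p q, m ⟨i, h⟩ k * v k
      else if i < p then a * v i else b * v i)
    (fun i hi => by
      rw [Finset.mem_union, or_iff_not_imp_right]
      intro h
      rw [Finsupp.mem_support_iff]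
      intro h0
      simp [h, h0] at hi)
  map_add' v w := by
    ext i
    simp only [Finsupp.onFinset_apply, Finsupp.add_apply]
    split_ifs
    · simp [mul_add, Finset.sum_add_distrib]
    · ring
    · ring
  map_smul' c v := by
    ext i
    simp only [Finsupp.onFinset_apply, Finsupp.smul_apply, smul_eq_mul, RingHom.id_apply]
    split_ifs
    · rw [Finset.mul_sum]
      exact Finset.sum_congr rfl fun k _ => by ring
    · ring
    · ring

theorem extOp_apply (a b : ℂ) (m : Mat p q) (v : CZ) (i : ℤ) : extOp a b m v i =
    if h : i ∈ Finset.Ico p q then ∑ k : Finset.Ico p q, m ⟨i, h⟩ k * v k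
      else if i < p then a * v i else b * v i := rfl

theorem Op.ext_apply {S T : Op} (h : ∀ v i, S v i = T v i) : S = T :=
  LinearMap.ext fun v => Finsupp.ext (h v)

theorem extOp_mul (a b a' b' : ℂ) (m m' : Mat p q) :
    extOp a b m * extOp a' b' m' = extOp (a * a') (b * b') (m * m') := by
  refine Op.ext_apply fun v i => ?_
  rw [Module.End.mul_apply, extOp_apply, extOp_apply _ _ (m * m')]
  by_cases h : i ∈ Finset.Ico p q
  · rw [dif_pos h, dif_pos h]
    simp only [extOp_apply, Mat.mul_apply, Finset.sum_mul]
    rw [Finset.sum_comm]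
    refine Finset.sum_congr rfl fun k _ => ?_
    rw [dif_pos k.2, Finset.mul_sum]
    exact Finset.sum_congr rfl fun l _ => by ring
  · rw [dif_neg h, dif_neg h, extOp_apply, dif_neg h]
    split_ifs <;> rw [mul_assoc]

theorem extOp_add (a b a' b' : ℂ) (m m' : Mat p q) :
    extOp a b m + extOp a' b' m' = extOp (a + a') (b + b') (m + m') := by
  refine Op.ext_apply fun v i => ?_
  rw [LinearMap.add_apply, Finsupp.add_apply, extOp_apply, extOp_apply, extOp_apply]
  split_ifs <;> simp [Mat.add_apply, add_mul, Finset.sum_add_distrib]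

theorem extOp_sub (a b a' b' : ℂ) (m m' : Mat p q) :
    extOp a b m - extOp a' b' m' = extOp (a - a') (b - b') (m - m') := by
  refine Op.ext_apply fun v i => ?_
  rw [LinearMap.sub_apply, Finsupp.sub_apply, extOp_apply, extOp_apply, extOp_apply]
  split_ifs <;> simp [Mat.sub_apply, sub_mul, Finset.sum_sub_distrib]

theorem extOp_one : extOp 1 1 (1 : Mat p q) = 1 := by
  refine Op.ext_apply fun v i => ?_
  rw [extOp_apply]
  split_ifs with h
  · simp [Mat.one_apply]
  · simp
  · simp

theorem extOp_zero : extOp 0 0 (0 : Mat p q) = 0 := by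
  refine Op.ext_apply fun v i => ?_
  rw [extOp_apply]
  split_ifs <;> simp [Mat.zero_apply]

theorem entry_extOp (a b : ℂ) (m : Mat p q) (i j : ℤ) : entry (extOp a b m) i j =
    if h : i ∈ Finset.Ico p q then (if h' : j ∈ Finset.Ico p q then m ⟨i, h⟩ ⟨j, h'⟩ else 0)
      else if i = j then (if i < p then a else b) else 0 := by
  rw [entry, extOp_apply]
  simp only [basisVec, Finsupp.single_apply]
  by_cases h : i ∈ Finset.Ico p q
  · rw [dif_pos h, dif_pos h]
    split_ifs with h'
    · rw [Finset.sum_eq_single ⟨j, h'⟩]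
      · simp
      · intro k _ hk
        rw [if_neg, mul_zero]
        intro e
        exact hk (Subtype.ext e.symm)
      · simp
    · refine Finset.sum_eq_zero fun k _ => ?_
      rw [if_neg, mul_zero]
      rintro rfl
      exact h' k.2
  · rw [dif_neg h, dif_neg h]
    by_cases hij : i = j
    · subst hij
      simp only [if_true, mul_one]
    · simp only [hij, Ne.symm hij, if_false, mul_zero, ite_self]

theorem block_extOp (a b : ℂ) (m : Mat p q) : block p q (extOp a b m) = m := by
  ext i j
  change entry (extOp a b m) i j = _
  rw [entry_extOp, dif_pos i.2, dif_pos j.2]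

theorem ip_extOp (a b : ℂ) (m : Mat p q) (x y : CZ) :
    ip (extOp a b m x) y = ip x (extOp (star a) (star b) (star m) y) := by
  set s := x.support ∪ Finset.Ico p q with hs
  have h1 : (extOp a b m x).support ⊆ s := fun i hi => by
    rw [hs, Finset.mem_union, or_iff_not_imp_right]
    intro h
    rw [Finsupp.mem_support_iff] at hi ⊢
    intro h0
    apply hi
    rw [extOp_apply, dif_neg h, h0]
    simp
  rw [ip_eq_sum y h1, ip_eq_sum _ (Finset.subset_union_left : x.support ⊆ s),
    ← Finset.sum_sdiff (Finset.subset_union_right : Finset.Ico p q ⊆ s),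
    ← Finset.sum_sdiff (Finset.subset_union_right : Finset.Ico p q ⊆ s)]
  congr 1
  · refine Finset.sum_congr rfl fun i hi => ?_
    have hi' := (Finset.mem_sdiff.1 hi).2
    rw [extOp_apply, extOp_apply, dif_neg hi', dif_neg hi']
    split_ifs <;> rw [star_mul] <;> ring
  · rw [← Finset.sum_coe_sort, ← Finset.sum_coe_sort (Finset.Ico p q)]
    have e1 : ∀ i : Finset.Ico p q, star (extOp a b m x i) * y i =
        ∑ k : Finset.Ico p q, star (m i k) * star (x k) * y i := fun i => by
      rw [extOp_apply, dif_pos i.2, star_sum, Finset.sum_mul]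
      exact Finset.sum_congr rfl fun k _ => by rw [star_mul']
    have e2 : ∀ i : Finset.Ico p q, star (x i) * extOp (star a) (star b) (star m) y i =
        ∑ k : Finset.Ico p q, star (m k i) * star (x i) * y k := fun i => by
      rw [extOp_apply, dif_pos i.2, Finset.mul_sum]
      exact Finset.sum_congr rfl fun k _ => by rw [Mat.star_apply]; ring
    simp only [e1, e2]
    exact Finset.sum_comm

theorem finiteDimensional_range_extOp (m : Mat p q) :
    FiniteDimensional ℂ (LinearMap.range (extOp 0 0 m)) := by
  have h : LinearMap.range (extOp 0 0 m) ≤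
      Submodule.span ℂ (basisVec '' (Finset.Ico p q : Set ℤ)) := by
    rintro _ ⟨v, rfl⟩
    have h1 : extOp 0 0 m v = ∑ i ∈ Finset.Ico p q, (extOp 0 0 m v i) • basisVec i := by
      ext j
      rw [Finsupp.finsetSum_apply]
      simp only [Finsupp.smul_apply, basisVec, Finsupp.single_apply, smul_eq_mul, mul_ite, mul_one,
        mul_zero]
      rw [Finset.sum_ite_eq' (Finset.Ico p q) j]
      split_ifs with h
      · rfl
      · rw [extOp_apply, dif_neg h]; simp
    rw [h1]
    exact Submodule.sum_mem _ fun i hi =>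
      Submodule.smul_mem _ _ (Submodule.subset_span ⟨i, hi, rfl⟩)
  have := FiniteDimensional.span_of_finite ℂ ((Finset.Ico p q).finite_toSet.image basisVec)
  exact Submodule.finiteDimensional_of_le h

theorem extOp_mem_UWindow {u : Mat p q} (h : star u * u = 1) (h' : u * star u = 1) :
    extOp 1 1 u ∈ UWindow p q := by
  have e1 : extOp 1 1 (star u) * extOp 1 1 u = 1 := by rw [extOp_mul, h, mul_one, extOp_one]
  have e2 : extOp 1 1 u * extOp 1 1 (star u) = 1 := by rw [extOp_mul, h', mul_one, extOp_one]
  refine ⟨⟨?_, fun x y => ?_, ?_⟩, fun i hi => ?_⟩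
  · exact Function.bijective_iff_has_inverse.2
      ⟨extOp 1 1 (star u), LinearMap.congr_fun e1, LinearMap.congr_fun e2⟩
  · rw [ip_extOp, star_one, ← Module.End.mul_apply, e1, Module.End.one_apply]
  · rw [← extOp_one (p := p) (q := q), extOp_sub, sub_self]
    exact finiteDimensional_range_extOp _
  · ext j
    change entry (extOp 1 1 u) j i = _
    rw [entry_extOp, basisVec, Finsupp.single_apply]
    have hi' : i ∉ Finset.Ico p q := by simpa using hi
    by_cases hj : j ∈ Finset.Ico p q
    · rw [dif_pos hj, dif_neg hi', if_neg (by rintro rfl; exact hi' hj)]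
    · rw [dif_neg hj, ite_self]
      simp only [eq_comm]

theorem below_apply {k i : ℤ} (hi : k ≤ i) {v : CZ} (hv : v ∈ below k) : v i = 0 := by
  refine Submodule.span_induction (p := fun v _ => v i = 0) ?_ (by simp) ?_ ?_ hv
  · rintro _ ⟨j, hj, rfl⟩
    rw [basisVec, Finsupp.single_apply, if_neg]
    rintro rfl
    exact absurd hj (not_lt.2 hi)
  · intro x y _ _ hx hy
    rw [Finsupp.add_apply, hx, hy, add_zero]
  · intro c x _ hx
    rw [Finsupp.smul_apply, hx, smul_zero]

theorem BUZWindow.star_block {P : Op} (hP : P ∈ BUZWindow p q) :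
    star (block p q P) = block p q P := by
  ext i j
  change star (entry P j i) = entry P i j
  rw [entry, entry, ← ip_basisVec_left j, star_ip, hP.1.1, ip_basisVec_left]

theorem BUZWindow.eq_extOp {P : Op} (hP : P ∈ BUZWindow p q) : P = extOp 1 0 (block p q P) := by
  have hfix : ∀ i < p, P (basisVec i) = basisVec i := fun i hi => by
    obtain ⟨v, hv⟩ := hP.2.1 (Submodule.subset_span ⟨i, hi, rfl⟩)
    rw [← hv, ← Module.End.mul_apply, BUZ.mul_self hP.1]
  have hlow : ∀ i < p, ∀ v, P v i = v i := fun i hi v => by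
    rw [← ip_basisVec_left i (P v), ← hP.1.1, hfix i hi, ip_basisVec_left]
  have hup : ∀ i, q ≤ i → ∀ v, P v i = 0 := fun i hi v =>
    below_apply hi (hP.2.2 ⟨v, rfl⟩)
  refine Op.ext_apply fun v i => ?_
  rw [extOp_apply]
  split_ifs with h h'
  · have hs : (P (basisVec i)).support ⊆ Finset.Ico p q := by
      intro k hk
      rw [Finsupp.mem_support_iff] at hk
      rw [Finset.mem_Ico] at h ⊢
      constructor
      · by_contra! hkp
        apply hk
        rw [hlow k hkp, basisVec, Finsupp.single_apply, if_neg]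
        omega
      · by_contra! hkq
        exact hk (hup k hkq _)
    rw [← ip_basisVec_left i (P v), ← hP.1.1, ip_eq_sum v hs, ← Finset.sum_coe_sort]
    refine Finset.sum_congr rfl fun k _ => ?_
    have := congrFun (congrFun (BUZWindow.star_block hP) ⟨i, h⟩) k
    rw [← this]
    rfl
  · rw [hlow i h', one_mul]
  · rw [Finset.mem_Ico] at h
    rw [hup i (by omega), zero_mul]

theorem BUZWindow.block_mul_self {P : Op} (hP : P ∈ BUZWindow p q) :
    block p q P * block p q P = block p q P := by
  have h := BUZ.mul_self hP.1
  rw [BUZWindow.eq_extOp hP, extOp_mul] at h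
  have := congrArg (block p q) h
  rwa [block_extOp, block_extOp] at this

theorem below_mono {k l : ℤ} (h : k ≤ l) : below k ≤ below l :=
  Submodule.span_mono (image_mono (Iio_subset_Iio h))

theorem BUZWindow.mono {p' q' : ℤ} (hp : p' ≤ p) (hq : q ≤ q') : BUZWindow p q ⊆ BUZWindow p' q' :=
  fun _ h => ⟨h.1, (below_mono hp).trans h.2.1, h.2.2.trans (below_mono hq)⟩

theorem UWindow.mono {p' q' : ℤ} (hp : p' ≤ p) (hq : q ≤ q') : UWindow p q ⊆ UWindow p' q' :=
  fun _ h => ⟨h.1, fun i hi => h.2 i fun h' => hi ⟨hp.trans h'.1, h'.2.trans_le hq⟩⟩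

theorem exists_window {N : Type*} [TopologicalSpace N] [CompactSpace N] {f : N → Op}
    (hf : ∀ x, ∃ n : ℕ, ∀ᶠ y in 𝓝 x, f y ∈ BUZWindow (-n) n) :
    ∃ p q : ℤ, ∀ y, f y ∈ BUZWindow p q := by
  choose n hn using hf
  obtain ⟨t, -, ht⟩ := isCompact_univ.elim_nhds_subcover (fun x => {y | f y ∈ BUZWindow (-n x) (n x)})
    fun x _ => hn x
  refine ⟨-(t.sup n : ℕ), (t.sup n : ℕ), fun y => ?_⟩
  obtain ⟨x, hx, hy⟩ := mem_iUnion₂.1 (ht (mem_univ y))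
  have := Finset.le_sup (f := n) hx
  exact BUZWindow.mono (by omega) (by omega) hy

end ExtOp

end HolChern

namespace HolChern

section Entries

variable {p q : ℤ}

theorem hasDerivAt_mat {f : ℝ → Mat p q} {f' : Mat p q} {t : ℝ} :
    HasDerivAt f f' t ↔ ∀ i j, HasDerivAt (fun s => f s i j) (f' i j) t := by
  have h : HasDerivAt f f' t ↔ HasDerivAt (fun s => (entriesL p q).symm (f s))
      ((entriesL p q).symm f') t := by
    constructor
    · intro h
      exact ((entriesL p q).symm : Mat p q →L[ℝ] (Finset.Ico p q → Finset.Ico p q → ℂ)).hasFDerivAt.comp_hasDerivAt t h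
    · intro h
      have := ((entriesL p q) : (Finset.Ico p q → Finset.Ico p q → ℂ) →L[ℝ] Mat p q).hasFDerivAt.comp_hasDerivAt t h
      exact this
  rw [h, hasDerivAt_pi]
  exact forall_congr' fun i => hasDerivAt_pi

theorem contMDiff_mat {E H N : Type*} [NormedAddCommGroup E] [NormedSpace ℝ E]
    [TopologicalSpace H] {I : ModelWithCorners ℝ E H} [TopologicalSpace N] [ChartedSpace H N]
    {f : N → Mat p q} : ContMDiff I 𝓘(ℝ, Mat p q) ∞ f ↔
      ∀ i j, ContMDiff I 𝓘(ℝ, ℂ) ∞ fun s => f s i j := by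
  have h : ContMDiff I 𝓘(ℝ, Mat p q) ∞ f ↔
      ContMDiff I 𝓘(ℝ, Finset.Ico p q → Finset.Ico p q → ℂ) ∞
        fun s => (entriesL p q).symm (f s) := by
    constructor
    · intro h
      exact ((entriesL p q).symm : Mat p q →L[ℝ] (Finset.Ico p q → Finset.Ico p q → ℂ)).contMDiff.comp h
    · intro h
      have := ((entriesL p q) : (Finset.Ico p q → Finset.Ico p q → ℂ) →L[ℝ] Mat p q).contMDiff.comp h
      exact this
  rw [h, contMDiff_pi_space]
  exact forall_congr' fun i => contMDiff_pi_space

end Entries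

section Transport

variable {p q : ℤ} {γ γ' φ : ℝ → Mat p q}

theorem hasDerivAt_entry_extOp {a b : ℂ} {m : Mat p q} {t : ℝ} (h : HasDerivAt φ m t) (i j : ℤ) :
    HasDerivAt (fun s => entry (extOp a b (φ s)) i j) (entry (extOp 0 0 m) i j) t := by
  simp only [entry_extOp]
  split_ifs
  · exact hasDerivAt_mat.1 h _ _
  all_goals exact hasDerivAt_const _ _

theorem isParallelTransport_extOp (h : ProjPath γ γ')
    (hφ : ∀ t, HasDerivAt φ (γ' t * φ t) t) (h0 : φ 0 = γ 0) :
    IsParallelTransport (fun t => extOp 1 0 (γ t)) (fun t => extOp 1 0 (φ t)) where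
  start := by rw [h0]
  mem t := by rw [extOp_mul, h.mul_transport hφ h0]; simp
  parallel := ⟨fun t => extOp 0 0 (γ' t * φ t), fun t i j => hasDerivAt_entry_extOp (hφ t) i j,
    fun t => by rw [extOp_mul, h.mul_transport_deriv hφ h0, mul_zero, mul_zero, extOp_zero]⟩

theorem eq_of_isParallelTransport (h : ProjPath γ γ') {f g : ℝ → Op}
    (hf : IsParallelTransport (fun t => extOp 1 0 (γ t)) f)
    (hg : IsParallelTransport (fun t => extOp 1 0 (γ t)) g) : f = g := by
  obtain ⟨f', hf', hf0⟩ := hf.parallel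
  obtain ⟨g', hg', hg0⟩ := hg.parallel
  have hmem : ∀ {T : Op} {t : ℝ}, extOp 1 0 (γ t) * T = T → ∀ i j, entry T i j =
      if h : i ∈ Finset.Ico p q then ∑ k : Finset.Ico p q, γ t ⟨i, h⟩ k * entry T k j
      else if i < p then 1 * entry T i j else 0 * entry T i j := fun {T t} hT i j => by
    conv_lhs => rw [← hT]
    rfl
  have hpar : ∀ {T : Op} {t : ℝ}, extOp 1 0 (γ t) * T = 0 → ∀ i j, (0 : ℂ) =
      if h : i ∈ Finset.Ico p q then ∑ k : Finset.Ico p q, γ t ⟨i, h⟩ k * entry T k j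
      else if i < p then 1 * entry T i j else 0 * entry T i j := fun {T t} hT i j => by
    have : entry (extOp 1 0 (γ t) * T) i j = 0 := by rw [hT]; rfl
    exact this.symm
  have hd0 : ∀ i j, entry (f 0) i j - entry (g 0) i j = 0 := fun i j => by
    rw [hf.start, hg.start, sub_self]
  have hent : ∀ t i j, entry (f t) i j - entry (g t) i j = 0 := by
    intro t i j
    by_cases hi : i ∈ Finset.Ico p q
    · let D : ℝ → Mat p q := fun t => entriesL p q fun i _ => entry (f t) i j - entry (g t) i j
      let D' : ℝ → Mat p q := fun t => entriesL p q fun i _ => entry (f' t) i j - entry (g' t) i j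
      have hD : ∀ t, HasDerivAt D (D' t) t := fun t =>
        hasDerivAt_mat.2 fun i _ => (hf' t i j).sub (hg' t i j)
      have h1 : ∀ t, γ t * D t = D t := fun t => by
        ext i k
        rw [Mat.mul_apply]
        have e1 := hmem (hf.mem t) i j
        have e2 := hmem (hg.mem t) i j
        rw [dif_pos i.2] at e1 e2
        change ∑ l : Finset.Ico p q, γ t i l * (entry (f t) l j - entry (g t) l j) =
          entry (f t) i j - entry (g t) i j
        rw [e1, e2, ← Finset.sum_sub_distrib]
        exact Finset.sum_congr rfl fun l _ => mul_sub _ _ _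
      have h2 : ∀ t, γ t * D' t = 0 := fun t => by
        ext i k
        rw [Mat.mul_apply]
        have e1 := hpar (hf0 t) i j
        have e2 := hpar (hg0 t) i j
        rw [dif_pos i.2] at e1 e2
        change ∑ l : Finset.Ico p q, γ t i l * (entry (f' t) l j - entry (g' t) l j) = 0
        simp only [mul_sub, Finset.sum_sub_distrib]
        rw [← e1, ← e2, sub_zero]
      have h3 : ∀ t, D' t = γ' t * D t := fun t => by
        have := ((h.deriv t).mul (hD t)).unique
          ((hD t).congr_of_eventuallyEq (Eventually.of_forall h1))
        rw [← this, h2, add_zero]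
      have h4 := eq_zero_of_linear_ode (L := fun t => ContinuousLinearMap.mul ℝ (Mat p q) (γ' t))
        ((ContinuousLinearMap.mul ℝ (Mat p q)).continuous.comp h.cont) (D := D)
        (fun t => (hD t).congr_deriv (h3 t)) (by ext i k; exact hd0 i j) t
      exact congrFun (congrFun h4 ⟨i, hi⟩) ⟨i, hi⟩
    · by_cases hip : i < p
      · have hz : ∀ t, HasDerivAt (fun t => entry (f t) i j - entry (g t) i j) 0 t := fun t => by
          refine ((hf' t i j).sub (hg' t i j)).congr_deriv ?_
          have e1 := hpar (hf0 t) i j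
          have e2 := hpar (hg0 t) i j
          rw [dif_neg hi, if_pos hip, one_mul] at e1 e2
          rw [← e1, ← e2, sub_zero]
        have := is_const_of_deriv_eq_zero (fun t => (hz t).differentiableAt)
          (fun t => (hz t).deriv) t 0
        rw [this, hd0]
      · have e1 := hmem (hf.mem t) i j
        have e2 := hmem (hg.mem t) i j
        rw [dif_neg hi, if_neg hip, zero_mul] at e1 e2
        rw [e1, e2, sub_zero]
  funext t
  refine Finsupp.lhom_ext' fun j => LinearMap.ext_ring (Finsupp.ext fun i => ?_)
  exact sub_eq_zero.1 (hent t i j)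

theorem parallelTransport_extOp (h : ProjPath γ γ')
    (hφ : ∀ t, HasDerivAt φ (γ' t * φ t) t) (h0 : φ 0 = γ 0) :
    parallelTransport (fun t => extOp 1 0 (γ t)) = fun t => extOp 1 0 (φ t) :=
  eq_of_isParallelTransport h
    (Classical.epsilon_spec ⟨_, isParallelTransport_extOp h hφ h0⟩)
    (isParallelTransport_extOp h hφ h0)

end Transport

end HolChern

namespace HolChern

section Charts

variable {E : Type*} [NormedAddCommGroup E] [NormedSpace ℝ E]
  {F : Type*} [NormedAddCommGroup F] [NormedSpace ℝ F]
  {H : Type*} [TopologicalSpace H] (I : ModelWithCorners ℝ E H)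
  {M : Type*} [TopologicalSpace M] [ChartedSpace H M]

/-- The target of the chart at a point, as a domain. -/
def chartDom (x₀ : M) : Dom E where
  carrier := (extChartAt I x₀).target
  uniqueDiff := uniqueDiffOn_extChartAt_target x₀
  subset_closure := extChartAt_target_subset_closure_interior

theorem locConvex_chartDom (x₀ : M) : LocConvex (chartDom I x₀).carrier := by
  intro y hy
  obtain ⟨u, hu, hus⟩ := mem_nhdsWithin_iff_exists_mem_nhds_inter.1
    (extChartAt_target_mem_nhdsWithin_of_mem (I := I) (x := x₀) hy)
  obtain ⟨δ, hδ, hδu⟩ := Metric.mem_nhds_iff.1 hu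
  refine ⟨Metric.ball y δ, Metric.ball_mem_nhds y hδ, fun ε _ => ?_⟩
  have h : (chartDom I x₀).carrier ∩ (Metric.ball y δ ∩ Metric.ball y ε) =
      range I ∩ (Metric.ball y δ ∩ Metric.ball y ε) := by
    refine Subset.antisymm (inter_subset_inter_left _ (extChartAt_target_subset_range x₀)) ?_
    rintro z ⟨hz, hz1, hz2⟩
    exact ⟨hus ⟨hδu hz1, hz⟩, hz1, hz2⟩
  rw [h]
  exact I.convex_range.inter ((convex_ball _ _).inter (convex_ball _ _))

/-- The derivative of the inverse of the chart at `x₀`. -/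
def symmD (x₀ : M) (y : E) : E →L[ℝ] E :=
  mfderivWithin 𝓘(ℝ, E) I (extChartAt I x₀).symm (range I) y

/-- The derivative of the chart at `x₀`. -/
def chartD (x₀ : M) (x : M) : E →L[ℝ] E := mfderiv I 𝓘(ℝ, E) (extChartAt I x₀) x

variable {I} {x₀ : M} {y : E}

theorem toL_inChart {k : ℕ} {B : Type*} [NormedRing B] [NormedAlgebra ℝ B] (θ : DForm E M k B) :
    toL (inChart I θ x₀ y) = LForm.pull (symmD I x₀ y) (toL (θ ((extChartAt I x₀).symm y))) :=
  toL_compContinuousLinearMap _ _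

variable [IsManifold I ∞ M]

theorem isManifold_one : IsManifold I 1 M := .of_le (n := ∞) (by simp)

theorem hasMFDerivWithinAt_symm (hy : y ∈ (extChartAt I x₀).target) :
    HasMFDerivWithinAt 𝓘(ℝ, E) I (extChartAt I x₀).symm (range I) y
      (mfderivWithin 𝓘(ℝ, E) I (extChartAt I x₀).symm (range I) y) :=
  have := isManifold_one (I := I) (M := M)
  (mdifferentiableWithinAt_extChartAt_symm hy).hasMFDerivWithinAt

theorem symmD_chartD (hy : y ∈ (extChartAt I x₀).target) :
    (symmD I x₀ y).comp (chartD I x₀ ((extChartAt I x₀).symm y)) = ContinuousLinearMap.id ℝ E :=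
  have := isManifold_one (I := I) (M := M)
  mfderivWithin_extChartAt_symm_comp_mfderiv_extChartAt hy

omit [IsManifold I ∞ M] in
theorem fderivWithin_range_eq {f : E → F} (hy : y ∈ (extChartAt I x₀).target) :
    fderivWithin ℝ f (range I) y = fderivWithin ℝ f (extChartAt I x₀).target y :=
  (fderivWithin_congr_set (extChartAt_target_eventuallyEq_of_mem hy)).symm

omit [IsManifold I ∞ M] in
theorem extDerivWithin_range_eq {k : ℕ} {f : E → E [⋀^Fin k]→L[ℝ] F}
    (hy : y ∈ (extChartAt I x₀).target) :
    extDerivWithin f (range I) y = extDerivWithin f (extChartAt I x₀).target y := by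
  rw [extDerivWithin, extDerivWithin, fderivWithin_range_eq hy]

/-- A function on the manifold with a smooth representative in a chart. -/
theorem contMDiffOn_of_chart {f : M → F} {Φ : E → F}
    (hΦ : ContDiffOn ℝ ∞ Φ (extChartAt I x₀).target)
    (h : ∀ y ∈ (extChartAt I x₀).target, f ((extChartAt I x₀).symm y) = Φ y) :
    ContMDiffOn I 𝓘(ℝ, F) ∞ f (extChartAt I x₀).source := by
  have h1 : ContMDiffOn I 𝓘(ℝ, F) ∞ (Φ ∘ extChartAt I x₀) (extChartAt I x₀).source := by
    refine (contMDiffOn_iff_contDiffOn.2 hΦ).comp ?_ fun x hx => (extChartAt I x₀).map_source hx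
    rw [extChartAt_source]
    exact contMDiffOn_extChartAt
  refine h1.congr fun x hx => ?_
  rw [Function.comp_apply, ← h _ ((extChartAt I x₀).map_source hx), (extChartAt I x₀).left_inv hx]

/-- The chain rule for the representative of a function in a chart. -/
theorem dFun_symmD {f : M → F} {Φ : E → F} (hΦ : ContDiffOn ℝ ∞ Φ (extChartAt I x₀).target)
    (h : ∀ y ∈ (extChartAt I x₀).target, f ((extChartAt I x₀).symm y) = Φ y)
    (hy : y ∈ (extChartAt I x₀).target) (v : E) :
    dFun I f ((extChartAt I x₀).symm y) (symmD I x₀ y v) =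
      fderivWithin ℝ Φ (extChartAt I x₀).target y v := by
  have hs := (extChartAt I x₀).map_target hy
  have h1 : MDifferentiableAt I 𝓘(ℝ, F) f ((extChartAt I x₀).symm y) :=
    ((contMDiffOn_of_chart hΦ h).contMDiffAt
      ((isOpen_extChartAt_source x₀).mem_nhds hs)).mdifferentiableAt (by simp)
  have h2 := h1.hasMFDerivAt.comp_hasMFDerivWithinAt y (hasMFDerivWithinAt_symm hy)
  have h3 : fderivWithin ℝ (f ∘ (extChartAt I x₀).symm) (range I) y =
      (dFun I f ((extChartAt I x₀).symm y)).comp (symmD I x₀ y) :=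
    HasFDerivWithinAt.fderivWithin (E := E) (F := F) h2.hasFDerivWithinAt
      (I.uniqueDiffOn y (extChartAt_target_subset_range x₀ hy))
  have h4 : fderivWithin ℝ (f ∘ (extChartAt I x₀).symm) (range I) y =
      fderivWithin ℝ Φ (extChartAt I x₀).target y := by
    rw [fderivWithin_range_eq hy]
    exact fderivWithin_congr h (h y hy)
  rw [← h4, h3]
  rfl

/-- The derivative of a change of coordinates. -/
theorem fderivWithin_coordChange {x : M} (hy : y ∈ (extChartAt I x₀).target)
    (hx : (extChartAt I x₀).symm y ∈ (extChartAt I x).source) :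
    fderivWithin ℝ (extChartAt I x ∘ (extChartAt I x₀).symm) (range I) y =
      (chartD I x ((extChartAt I x₀).symm y)).comp (symmD I x₀ y) := by
  have := isManifold_one (I := I) (M := M)
  rw [extChartAt_source] at hx
  have h2 := (mdifferentiableAt_extChartAt (I := I) hx).hasMFDerivAt.comp_hasMFDerivWithinAt y
    (hasMFDerivWithinAt_symm hy)
  exact HasFDerivWithinAt.fderivWithin (E := E) (F := E) h2.hasFDerivWithinAt
    (I.uniqueDiffOn y (extChartAt_target_subset_range x₀ hy))

/-- The exterior derivative may be computed in any chart. -/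
theorem extD_symmD {k : ℕ} {θ : DForm E M k F} (hθ : SmoothForm I θ)
    (hy : y ∈ (extChartAt I x₀).target) :
    (extD I θ ((extChartAt I x₀).symm y)).compContinuousLinearMap (symmD I x₀ y) =
      extDerivWithin (inChart I θ x₀) (range I) y := by
  set x := (extChartAt I x₀).symm y with hx
  have hr := extChartAt_target_subset_range x₀ hy
  have hxs : x ∈ (extChartAt I x).source := mem_extChartAt_source x
  have hψ : ContDiffWithinAt ℝ ∞ (extChartAt I x ∘ (extChartAt I x₀).symm) (range I) y :=
    contDiffWithinAt_ext_coord_change x x₀ ⟨hy, hxs⟩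
  have hev : inChart I θ x₀ =ᶠ[𝓝[range I] y] fun y' =>
      (inChart I θ x ((extChartAt I x ∘ (extChartAt I x₀).symm) y')).compContinuousLinearMap
        (fderivWithin ℝ (extChartAt I x ∘ (extChartAt I x₀).symm) (range I) y') := by
    filter_upwards [extChartAt_target_mem_nhdsWithin_of_mem hy, mem_nhdsWithin_of_mem_nhds
      ((continuousAt_extChartAt_symm'' hy).preimage_mem_nhds
        ((isOpen_extChartAt_source (I := I) x).mem_nhds hxs))] with y' hy' hy''
    have e1 : (extChartAt I x).symm ((extChartAt I x ∘ (extChartAt I x₀).symm) y') =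
      (extChartAt I x₀).symm y' := (extChartAt I x).left_inv hy''
    have e2 := symmD_chartD (I := I) (x₀ := x) ((extChartAt I x).map_source hy'')
    rw [(extChartAt I x).left_inv hy''] at e2
    have e3 : symmD I x₀ y' = (symmD I x ((extChartAt I x ∘ (extChartAt I x₀).symm) y')).comp
        (fderivWithin ℝ (extChartAt I x ∘ (extChartAt I x₀).symm) (range I) y') := by
      rw [fderivWithin_coordChange hy' hy'', ← ContinuousLinearMap.comp_assoc,
        Function.comp_apply, e2, ContinuousLinearMap.id_comp]
    have e4 : inChart I θ x₀ y' = (θ ((extChartAt I x₀).symm y')).compContinuousLinearMap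
      (symmD I x₀ y') := rfl
    have e5 : inChart I θ x ((extChartAt I x ∘ (extChartAt I x₀).symm) y') =
        (θ ((extChartAt I x₀).symm y')).compContinuousLinearMap
          (symmD I x ((extChartAt I x ∘ (extChartAt I x₀).symm) y')) := by
      rw [← e1]; rfl
    rw [e4, e5, e3]
    rfl
  have hd : DifferentiableWithinAt ℝ (inChart I θ x) (range I)
      ((extChartAt I x ∘ (extChartAt I x₀).symm) y) :=
    (((hθ x).differentiableOn (by simp)) _ (mem_extChartAt_target x)).mono_of_mem_nhdsWithin
      (extChartAt_target_mem_nhdsWithin x)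
  rw [hev.extDerivWithin_eq_of_mem hr, extDerivWithin_pullback hd hψ (by simpa using two_le_infty) I.uniqueDiffOn
    (I.range_subset_closure_interior hr) hr (fun y' _ => by
      rw [Function.comp_apply, extChartAt_coe]; exact mem_range_self _),
    fderivWithin_coordChange hy hxs]
  rfl

end Charts

end HolChern

namespace HolChern

open SForm

section FiniteDim

variable {V B X : Type*} [NormedAddCommGroup V] [NormedSpace ℝ V] [FiniteDimensional ℝ V]
  [NormedAddCommGroup B] [NormedSpace ℝ B] [FiniteDimensional ℝ B]

/-- Alternating forms are determined by, and depend continuously on, finitely many values. -/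
theorem exists_eval_leftInverse (V B : Type*) [NormedAddCommGroup V] [NormedSpace ℝ V]
    [FiniteDimensional ℝ V] [NormedAddCommGroup B] [NormedSpace ℝ B] [FiniteDimensional ℝ B]
    (k : ℕ) : ∃ (n : ℕ) (b : (Fin k → Fin n) → Fin k → V)
      (L : ((Fin k → Fin n) → B) →L[ℝ] V [⋀^Fin k]→L[ℝ] B),
      ∀ α : V [⋀^Fin k]→L[ℝ] B, L (fun i => α (b i)) = α := by
  let e := Module.finBasis ℝ V
  let ev : (V [⋀^Fin k]→L[ℝ] B) →ₗ[ℝ] ((Fin k → Fin (Module.finrank ℝ V)) → B) :=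
    { toFun := fun α i => α fun j => e (i j)
      map_add' := fun _ _ => rfl
      map_smul' := fun _ _ => rfl }
  have hinj : LinearMap.ker ev = ⊥ := by
    refine LinearMap.ker_eq_bot'.2 fun α hα => ?_
    apply ContinuousAlternatingMap.toAlternatingMap_injective
    exact Module.Basis.ext_alternating e fun i _ => congrFun hα i
  obtain ⟨g, hg⟩ := ev.exists_leftInverse_of_injective hinj
  exact ⟨_, fun i j => e (i j), ⟨g, g.continuous_of_finiteDimensional⟩,
    fun α => LinearMap.congr_fun hg α⟩

theorem contDiffOn_alternating {k : ℕ} [NormedAddCommGroup X] [NormedSpace ℝ X]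
    {θ : X → V [⋀^Fin k]→L[ℝ] B} {s : Set X} (h : ∀ v, ContDiffOn ℝ ∞ (fun y => θ y v) s) :
    ContDiffOn ℝ ∞ θ s := by
  obtain ⟨n, b, L, hL⟩ := exists_eval_leftInverse V B k
  refine (L.contDiff.comp_contDiffOn (contDiffOn_pi.2 fun i => h (b i))).congr fun y _ => ?_
  exact (hL (θ y)).symm

theorem continuous_alternating {k : ℕ} [TopologicalSpace X] {θ : X → V [⋀^Fin k]→L[ℝ] B}
    (h : ∀ v, Continuous fun y => θ y v) : Continuous θ := by
  obtain ⟨n, b, L, hL⟩ := exists_eval_leftInverse V B k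
  refine (L.continuous.comp (continuous_pi fun i => h (b i))).congr fun y => ?_
  exact hL (θ y)

end FiniteDim

section Represents

variable {V E' N A B : Type*} [NormedAddCommGroup V] [NormedSpace ℝ V]
  [NormedAddCommGroup E'] [NormedSpace ℝ E'] [NormedRing A] [NormedAlgebra ℝ A]
  [NormedRing B] [NormedAlgebra ℝ B] {T : Dom V} {ψ : V → N} {D : V → V →L[ℝ] E'}

/-- The form `f` on a domain represents the form `θ` along the parametrization `ψ` with
derivative `D`. -/
def Represents (T : Dom V) (ψ : V → N) (D : V → V →L[ℝ] E') {k : ℕ}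
    (θ : N → E' [⋀^Fin k]→L[ℝ] B) (f : SForm T B) : Prop :=
  ∀ z : T.carrier, LForm.pull (D z) (toL (θ (ψ z))) = f.1 z

namespace Represents

theorem wedge {k l : ℕ} {α : N → E' [⋀^Fin k]→L[ℝ] A} {β : N → E' [⋀^Fin l]→L[ℝ] A}
    {f g : SForm T A} (hf : Represents T ψ D α f) (hg : Represents T ψ D β g) :
    Represents T ψ D (fun x => wedge (α x) (β x)) (f * g) := fun z => by
  rw [toL_wedge, LForm.pull_mul, hf, hg, mul_val]

theorem wpow {α : N → E' [⋀^Fin 2]→L[ℝ] A} {f : SForm T A} (hf : Represents T ψ D α f) (n : ℕ) :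
    Represents T ψ D (fun x => wpow (α x) n) (f ^ n) := fun z => by
  rw [toL_wpow, LForm.pull_pow, hf, pow_val]

theorem add {k : ℕ} {α β : N → E' [⋀^Fin k]→L[ℝ] B}
    {f g : SForm T B} (hf : Represents T ψ D α f) (hg : Represents T ψ D β g) :
    Represents T ψ D (fun x => α x + β x) (f + g) := fun z => by
  rw [add_val, ← hf, ← hg, toL_add]
  rfl

theorem traceForm_smul {k : ℕ} {p q : ℤ} {Q : N → Mat p q} {a : V → Mat p q}
    (ha : ContDiffOn ℝ ∞ a T.carrier) (hQ : ∀ z ∈ T.carrier, Q (ψ z) = a z)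
    {θ : N → E' [⋀^Fin k]→L[ℝ] Mat p q} {f : SForm T (Mat p q)} (hf : Represents T ψ D θ f)
    (c : ℂ) :
    Represents T ψ D (fun x => c • traceForm (Q x) (θ x))
      (mapVal (c • trL p q) (ofFun a ha * f)) := fun z => by
  have h1 := toL_traceForm (Q (ψ z)) (θ (ψ z))
  ext l
  have h2 : toL (c • traceForm (Q (ψ z)) (θ (ψ z))) (l.map (D z)) =
      c * toL (traceForm (Q (ψ z)) (θ (ψ z))) (l.map (D z)) := by
    by_cases hl : (l.map (D z)).length = k
    · rw [toL_apply _ _ hl, toL_apply _ _ hl]; rfl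
    · rw [toL_of_length_ne _ _ hl, toL_of_length_ne _ _ hl, mul_zero]
  rw [LForm.pull_apply, h2, h1, mapVal_val, LForm.mapVal_apply, LForm.mapVal_apply, mul_val,
    ofFun_val, LForm.const_mul, LForm.const_mul, ← hf z, LForm.pull_apply, hQ z z.2]
  rfl

theorem oneForm {t : N → E' →L[ℝ] B} {f : SForm T B} (h0 : ∀ z, f.1 z [] = 0)
    (h1 : ∀ z v l, f.1 z (v :: l) = if l = [] then t (ψ z) (D z v) else 0) :
    Represents T ψ D (fun x => oneForm (t x)) f := fun z => by
  ext l
  rw [LForm.pull_apply]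
  rcases l with _ | ⟨v, l⟩
  · rw [h0, toL_of_length_ne _ _ (by simp)]
  · rw [List.map_cons, toL_oneForm_cons, h1]
    simp

theorem dFun {H' : Type*} [TopologicalSpace H'] {I' : ModelWithCorners ℝ E' H'}
    [TopologicalSpace N] [ChartedSpace H' N] {F : N → B} {a : V → B}
    (ha : ContDiffOn ℝ ∞ a T.carrier)
    (h : ∀ z ∈ T.carrier, ∀ v, dFun I' F (ψ z) (D z v) = fderivWithin ℝ a T.carrier z v) :
    Represents T ψ D (fun x => HolChern.oneForm (dFun I' F x)) (d (ofFun a ha)) :=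
  .oneForm (fun z => d_nil _ _) fun z v l => by rw [d_ofFun_cons, h z z.2]

theorem congr_param {ψ' : V → N} {D' : V → V →L[ℝ] E'} {k : ℕ} {θ : N → E' [⋀^Fin k]→L[ℝ] B}
    {f : SForm T B} (h : Represents T ψ D θ f) (hψ : EqOn ψ' ψ T.carrier)
    (hD : EqOn D' D T.carrier) : Represents T ψ' D' θ f := fun z => by
  rw [hψ z.2, hD z.2, h z]

end Represents

end Represents

section Charts

variable {E : Type*} [NormedAddCommGroup E] [NormedSpace ℝ E] [FiniteDimensional ℝ E]
  {B : Type*} [NormedRing B] [NormedAlgebra ℝ B] [FiniteDimensional ℝ B]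
  {H : Type*} [TopologicalSpace H] {I : ModelWithCorners ℝ E H}
  {M : Type*} [TopologicalSpace M] [ChartedSpace H M]

theorem contDiffOn_inChart {k : ℕ} {θ : DForm E M k B} {x₀ : M} {f : SForm (chartDom I x₀) B}
    (h : Represents _ (extChartAt I x₀).symm (symmD I x₀) θ f) :
    ContDiffOn ℝ ∞ (inChart I θ x₀) (extChartAt I x₀).target := by
  refine contDiffOn_alternating fun v => (contDiffOn_ev f (List.ofFn v)).congr fun y hy => ?_
  rw [ev_of_mem _ _ hy, ← h ⟨y, hy⟩, ← toL_inChart, toL_ofFn]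

theorem represents_extD [IsManifold I ∞ M] {k : ℕ} {θ : DForm E M k B} (hθ : SmoothForm I θ)
    {x₀ : M} {f : SForm (chartDom I x₀) B}
    (h : Represents _ (extChartAt I x₀).symm (symmD I x₀) θ f) :
    Represents _ (extChartAt I x₀).symm (symmD I x₀) (extD I θ) (d f) := fun z => by
  have hs : ContDiffOn ℝ ∞ (inChart I θ x₀) (chartDom I x₀).carrier := hθ x₀
  have e : f = ofForm (S := chartDom I x₀) (inChart I θ x₀) hs :=
    Subtype.ext (funext fun y => by rw [← h y, ofForm_val, toL_inChart])
  rw [← toL_compContinuousLinearMap, extD_symmD hθ z.2, extDerivWithin_range_eq z.2, e, d_ofForm]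
  rfl

/-- The parametrization of `M × G` by the product of a chart with `G`. -/
def prodParam (I : ModelWithCorners ℝ E H) (x₀ : M) {G G' : Type*} (c : G → G') (z : E × G) :
    M × G' := ((extChartAt I x₀).symm z.1, c z.2)

/-- The derivative of the parametrization of `M × G`. -/
def prodD (I : ModelWithCorners ℝ E H) (x₀ : M) {G F : Type*} [NormedAddCommGroup G]
    [NormedSpace ℝ G] [NormedAddCommGroup F] [NormedSpace ℝ F] (c' : G → G →L[ℝ] F) (z : E × G) :
    E × G →L[ℝ] E × F :=
  ((symmD I x₀ z.1).comp (ContinuousLinearMap.fst ℝ E G)).prod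
    ((c' z.2).comp (ContinuousLinearMap.snd ℝ E G))

variable {G : Type*} [NormedAddCommGroup G] [NormedSpace ℝ G]

theorem chartDom_prod (x₀ : M) (g₀ : G) :
    chartDom (I.prod 𝓘(ℝ, G)) (x₀, g₀) = (chartDom I x₀).prodUniv G := by
  have h : (chartDom (I.prod 𝓘(ℝ, G)) (x₀, g₀)).carrier = ((chartDom I x₀).prodUniv G).carrier := by
    change (extChartAt (I.prod 𝓘(ℝ, G)) (x₀, g₀)).target = (extChartAt I x₀).target ×ˢ univ
    rw [extChartAt_prod, PartialEquiv.prod_target]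
    simp
    rfl
  cases h1 : chartDom (I.prod 𝓘(ℝ, G)) (x₀, g₀)
  cases h2 : (chartDom I x₀).prodUniv G
  rw [h1, h2] at h
  congr

theorem extChartAt_prod_symm (x₀ : M) (g₀ : G) :
    ((extChartAt (I.prod 𝓘(ℝ, G)) (x₀, g₀)).symm : E × G → M × G) = prodParam I x₀ id := by
  funext z
  rw [extChartAt_prod]
  simp [prodParam]
  rfl

variable [IsManifold I ∞ M]

theorem symmD_prod (x₀ : M) (g₀ : G) {z : E × G} (hz : z.1 ∈ (extChartAt I x₀).target) :
    symmD (I.prod 𝓘(ℝ, G)) (x₀, g₀) z = prodD I x₀ (fun _ => ContinuousLinearMap.id ℝ G) z := by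
  have h1 : HasMFDerivWithinAt 𝓘(ℝ, E × G) I (fun w : E × G => (extChartAt I x₀).symm w.1)
      (range (I.prod 𝓘(ℝ, G))) z ((symmD I x₀ z.1).comp (ContinuousLinearMap.fst ℝ E G)) := by
    refine HasMFDerivWithinAt.comp (u := range I) z (hasMFDerivWithinAt_symm hz)
      (hasFDerivWithinAt_fst.hasMFDerivWithinAt) ?_
    rintro _ ⟨w, rfl⟩
    exact ⟨w.1, rfl⟩
  have h2 : HasMFDerivWithinAt 𝓘(ℝ, E × G) 𝓘(ℝ, G) (fun w : E × G => w.2)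
      (range (I.prod 𝓘(ℝ, G))) z (ContinuousLinearMap.snd ℝ E G) :=
    hasFDerivWithinAt_snd.hasMFDerivWithinAt
  have h3 := h1.prodMk h2
  have hu : UniqueMDiffWithinAt 𝓘(ℝ, E × G) (range (I.prod 𝓘(ℝ, G))) z := by
    refine UniqueDiffWithinAt.uniqueMDiffWithinAt ((I.prod 𝓘(ℝ, G)).uniqueDiffOn z ?_)
    obtain ⟨w, hw⟩ := extChartAt_target_subset_range (I := I) x₀ hz
    exact ⟨(w, z.2), Prod.ext hw rfl⟩
  have h4 := h3.mfderivWithin hu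
  rw [symmD, extChartAt_prod_symm]
  exact h4

end Charts

end HolChern

namespace HolChern

open SForm

section Linear

variable {V A : Type*} [NormedAddCommGroup V] [NormedSpace ℝ V] [NormedRing A] [NormedAlgebra ℝ A]
  {T : Dom V} {f g : SForm T A} {s t : V → V → A}

/-- The form `f` has degree one, with values given by `t`. -/
def IsOneForm (f : SForm T A) (t : V → V → A) : Prop :=
  ∀ z : T.carrier, f.1 z [] = 0 ∧ ∀ v l, f.1 z (v :: l) = if l = [] then t z v else 0

namespace IsOneForm

theorem add (hf : IsOneForm f s) (hg : IsOneForm g t) :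
    IsOneForm (f + g) fun z v => s z v + t z v := fun z => by
  refine ⟨by rw [add_val, LForm.add_apply, (hf z).1, (hg z).1, add_zero], fun v l => ?_⟩
  rw [add_val, LForm.add_apply, (hf z).2, (hg z).2]
  split_ifs <;> simp

theorem sub (hf : IsOneForm f s) (hg : IsOneForm g t) :
    IsOneForm (f - g) fun z v => s z v - t z v := fun z => by
  refine ⟨by rw [sub_val, LForm.sub_apply, (hf z).1, (hg z).1, sub_zero], fun v l => ?_⟩
  rw [sub_val, LForm.sub_apply, (hf z).2, (hg z).2]
  split_ifs <;> simp

theorem ofFun_mul {a : V → A} (ha : ContDiffOn ℝ ∞ a T.carrier) (hf : IsOneForm f s) :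
    IsOneForm (ofFun a ha * f) fun z v => a z * s z v := fun z => by
  refine ⟨by rw [mul_val, ofFun_val, LForm.const_mul, (hf z).1, mul_zero], fun v l => ?_⟩
  rw [mul_val, ofFun_val, LForm.const_mul, (hf z).2]
  split_ifs <;> simp

theorem mul_ofFun {a : V → A} (ha : ContDiffOn ℝ ∞ a T.carrier) (hf : IsOneForm f s) :
    IsOneForm (f * ofFun a ha) fun z v => s z v * a z := fun z => by
  refine ⟨by rw [mul_val, ofFun_val, LForm.mul_const, (hf z).1, zero_mul], fun v l => ?_⟩
  rw [mul_val, ofFun_val, LForm.mul_const, (hf z).2]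
  split_ifs <;> simp

theorem d_ofFun {a : V → A} (ha : ContDiffOn ℝ ∞ a T.carrier) :
    IsOneForm (d (ofFun a ha)) fun z v => fderivWithin ℝ a T.carrier z v := fun _ =>
  ⟨d_nil _ _, fun _ _ => d_ofFun_cons _ _ _ _ _⟩

theorem represents {E' N : Type*} [NormedAddCommGroup E'] [NormedSpace ℝ E'] {ψ : V → N}
    {D : V → V →L[ℝ] E'} {θ : N → E' →L[ℝ] A} (hf : IsOneForm f t)
    (h : ∀ z ∈ T.carrier, ∀ v, t z v = θ (ψ z) (D z v)) :
    Represents T ψ D (fun x => oneForm (θ x)) f :=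
  .oneForm (fun z => (hf z).1) fun z v l => by rw [(hf z).2, h z z.2]

theorem sumConn_ofFun {Q : V → A} (hQ : ContDiffOn ℝ ∞ Q T.carrier) :
    IsOneForm (sumConn (ofFun Q hQ)) fun z v =>
      Q z * fderivWithin ℝ Q T.carrier z v - (1 - Q z) * fderivWithin ℝ Q T.carrier z v := by
  rw [sumConn, ← ofFun_one, ofFun_sub]
  exact ((d_ofFun hQ).ofFun_mul hQ).sub ((d_ofFun hQ).ofFun_mul _)

theorem form_ofFun {g gs Q : V → A} (hg : ContDiffOn ℝ ∞ g T.carrier)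
    (hgs : ContDiffOn ℝ ∞ gs T.carrier) (hQ : ContDiffOn ℝ ∞ Q T.carrier) :
    IsOneForm (IsFrame.form (ofFun g hg) (ofFun gs hgs) (ofFun Q hQ)) fun z v =>
      gs z * fderivWithin ℝ g T.carrier z v - (1 - Q z) * fderivWithin ℝ Q T.carrier z v := by
  rw [IsFrame.form, ← ofFun_one, ofFun_sub]
  exact ((d_ofFun hg).ofFun_mul hgs).sub ((d_ofFun hQ).ofFun_mul _)

theorem scalar_mul (a : V →L[ℝ] ℝ) (b : ℝ) (hf : IsOneForm f s) :
    IsOneForm (scalar T A a b * f) fun z v => (b + a z) • s z v := by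
  have := hf.ofFun_mul (a := fun z => (b + a z) • (1 : A)) (by fun_prop)
  simp only [smul_mul_assoc, one_mul] at this
  exact this

theorem one_sub_scalar_mul (a : V →L[ℝ] ℝ) (hf : IsOneForm f s) :
    IsOneForm ((1 - scalar T A a 0) * f) fun z v => (1 - a z) • s z v := by
  have e : 1 - scalar T A a 0 = scalar T A (-a) 1 := by
    rw [scalar, scalar, ← ofFun_one, ofFun_sub]
    exact ofFun_congr fun z _ => by simp [add_smul, sub_eq_add_neg]
  rw [e]
  have := hf.scalar_mul (-a) 1
  simpa only [neg_apply, ← sub_eq_add_neg] using this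

theorem famOne_ofFun {g gs Q : V → A} (hg : ContDiffOn ℝ ∞ g T.carrier)
    (hgs : ContDiffOn ℝ ∞ gs T.carrier) (hQ : ContDiffOn ℝ ∞ Q T.carrier) (r : V →L[ℝ] ℝ) :
    IsOneForm (famOne (ofFun g hg) (ofFun gs hgs) (ofFun Q hQ) (scalar T A r 0)) fun z v =>
      (1 - r z) • (Q z * fderivWithin ℝ Q T.carrier z v -
        (1 - Q z) * fderivWithin ℝ Q T.carrier z v) +
      (0 + r z) • (gs z * fderivWithin ℝ g T.carrier z v -
        (1 - Q z) * fderivWithin ℝ Q T.carrier z v) :=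
  ((sumConn_ofFun hQ).one_sub_scalar_mul r).add ((form_ofFun hg hgs hQ).scalar_mul r 0)

theorem famTwo_ofFun {g gs Q : V → A} (hg : ContDiffOn ℝ ∞ g T.carrier)
    (hgs : ContDiffOn ℝ ∞ gs T.carrier) (hQ : ContDiffOn ℝ ∞ Q T.carrier) (r t : V →L[ℝ] ℝ) :
    IsOneForm (famTwo (ofFun g hg) (ofFun gs hgs) (ofFun Q hQ) (scalar T A r 0) (scalar T A t 0))
      fun z v =>
      (1 - r z) • ((0 + t z) • (Q z * fderivWithin ℝ Q T.carrier z v -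
        (1 - Q z) * fderivWithin ℝ Q T.carrier z v)) +
      (0 + r z) • ((gs z + (1 - Q z)) *
          fderivWithin ℝ (fun z => g z + (1 - Q z)) T.carrier z v +
        (gs z + (1 - Q z)) * ((0 + t z) • (Q z * fderivWithin ℝ Q T.carrier z v -
          (1 - Q z) * fderivWithin ℝ Q T.carrier z v)) * (g z + (1 - Q z))) := by
  have hs := (sumConn_ofFun hQ).scalar_mul t 0
  have hu : ∀ {k : V → A} (hk : ContDiffOn ℝ ∞ k T.carrier), ofFun k hk + (1 - ofFun Q hQ) =
      ofFun (fun z => k z + (1 - Q z)) (hk.add (contDiffOn_const.sub hQ)) := fun hk => by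
    rw [← ofFun_one, ofFun_sub, ofFun_add]
  rw [famTwo, hu, hu]
  exact (hs.one_sub_scalar_mul r).add ((((d_ofFun _).ofFun_mul _).add
    ((hs.ofFun_mul _).mul_ofFun _)).scalar_mul r 0)

end IsOneForm

end Linear

section Charts

variable {E : Type*} [NormedAddCommGroup E] [NormedSpace ℝ E] [FiniteDimensional ℝ E]
  {B : Type*} [NormedRing B] [NormedAlgebra ℝ B] [FiniteDimensional ℝ B]
  {H : Type*} [TopologicalSpace H] {I : ModelWithCorners ℝ E H}
  {M : Type*} [TopologicalSpace M] [ChartedSpace H M]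
  {G : Type*} [NormedAddCommGroup G] [NormedSpace ℝ G] [FiniteDimensional ℝ G]
  [IsManifold I ∞ M]

/-- The product parametrization of `M × G` agrees with the chart. -/
theorem represents_prod_iff {k : ℕ} {θ : DForm (E × G) (M × G) k B} {x₀ : M} (g₀ : G)
    {f : SForm ((chartDom I x₀).prodUniv G) B} :
    Represents _ (prodParam I x₀ id) (prodD I x₀ fun _ => ContinuousLinearMap.id ℝ G) θ f ↔
    Represents _ (extChartAt (I.prod 𝓘(ℝ, G)) (x₀, g₀)).symm
      (symmD (I.prod 𝓘(ℝ, G)) (x₀, g₀)) θ f := by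
  have h1 : EqOn (extChartAt (I.prod 𝓘(ℝ, G)) (x₀, g₀)).symm (prodParam I x₀ id)
      ((chartDom I x₀).prodUniv G).carrier := fun z _ => congrFun (extChartAt_prod_symm x₀ g₀) z
  have h2 : EqOn (symmD (I.prod 𝓘(ℝ, G)) (x₀, g₀))
      (prodD I x₀ fun _ => ContinuousLinearMap.id ℝ G)
      ((chartDom I x₀).prodUniv G).carrier := fun z hz => symmD_prod x₀ g₀ hz.1
  exact ⟨fun h => h.congr_param h1 h2, fun h => h.congr_param h1.symm h2.symm⟩

theorem smoothForm_of_prod {k : ℕ} {θ : DForm (E × G) (M × G) k B}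
    (h : ∀ x₀, ∃ f : SForm ((chartDom I x₀).prodUniv G) B,
      Represents _ (prodParam I x₀ id) (prodD I x₀ fun _ => ContinuousLinearMap.id ℝ G) θ f) :
    SmoothForm (I.prod 𝓘(ℝ, G)) θ := by
  rintro ⟨x₀, g₀⟩
  obtain ⟨f, hf⟩ := h x₀
  rw [represents_prod_iff g₀] at hf
  have key : ∀ T : Dom (E × G), chartDom (I.prod 𝓘(ℝ, G)) (x₀, g₀) = T → ∀ f : SForm T B,
      Represents T (extChartAt (I.prod 𝓘(ℝ, G)) (x₀, g₀)).symm
        (symmD (I.prod 𝓘(ℝ, G)) (x₀, g₀)) θ f →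
      ContDiffOn ℝ ∞ (inChart (I.prod 𝓘(ℝ, G)) θ (x₀, g₀))
        (extChartAt (I.prod 𝓘(ℝ, G)) (x₀, g₀)).target := by
    rintro _ rfl f hf
    exact contDiffOn_inChart hf
  exact key _ (chartDom_prod x₀ g₀) f hf

theorem represents_extD_prod {k : ℕ} {θ : DForm (E × G) (M × G) k B}
    (hθ : SmoothForm (I.prod 𝓘(ℝ, G)) θ) {x₀ : M} {f : SForm ((chartDom I x₀).prodUniv G) B}
    (hf : Represents _ (prodParam I x₀ id) (prodD I x₀ fun _ => ContinuousLinearMap.id ℝ G) θ f) :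
    Represents _ (prodParam I x₀ id) (prodD I x₀ fun _ => ContinuousLinearMap.id ℝ G)
      (extD (I.prod 𝓘(ℝ, G)) θ) (d f) := by
  let g₀ : G := 0
  rw [represents_prod_iff g₀] at hf ⊢
  have key : ∀ T : Dom (E × G), chartDom (I.prod 𝓘(ℝ, G)) (x₀, g₀) = T → ∀ f : SForm T B,
      Represents T (extChartAt (I.prod 𝓘(ℝ, G)) (x₀, g₀)).symm
        (symmD (I.prod 𝓘(ℝ, G)) (x₀, g₀)) θ f →
      Represents T (extChartAt (I.prod 𝓘(ℝ, G)) (x₀, g₀)).symm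
        (symmD (I.prod 𝓘(ℝ, G)) (x₀, g₀)) (extD (I.prod 𝓘(ℝ, G)) θ) (d f) := by
    rintro _ rfl f hf
    exact represents_extD hθ hf
  exact key _ (chartDom_prod x₀ g₀) f hf

theorem represents_curvature_prod {C : DForm (E × G) (M × G) 1 B}
    (hC : SmoothForm (I.prod 𝓘(ℝ, G)) C) {x₀ : M} {f : SForm ((chartDom I x₀).prodUniv G) B}
    (hf : Represents _ (prodParam I x₀ id) (prodD I x₀ fun _ => ContinuousLinearMap.id ℝ G) C f) :
    Represents _ (prodParam I x₀ id) (prodD I x₀ fun _ => ContinuousLinearMap.id ℝ G)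
      (curvature (I.prod 𝓘(ℝ, G)) C) (curv f) :=
  (represents_extD_prod hC hf).add (hf.wedge hf)

theorem symmD_chartD_apply {x₀ : M} {y : E} (hy : y ∈ (extChartAt I x₀).target) (v : E) :
    symmD I x₀ y (chartD I x₀ ((extChartAt I x₀).symm y) v) = v :=
  DFunLike.congr_fun (symmD_chartD hy) v

theorem continuous_square {k : ℕ} {α : DForm (E × (ℝ × ℝ)) (M × (ℝ × ℝ)) (k + 2) B} {x₀ : M}
    {f : SForm ((chartDom I x₀).prodUniv (ℝ × ℝ)) B}
    (hf : Represents _ (prodParam I x₀ id) (prodD I x₀ fun _ => ContinuousLinearMap.id ℝ (ℝ × ℝ))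
      α f) {y : E} (hy : y ∈ (extChartAt I x₀).target) :
    (∀ (g : ℝ × ℝ) (w : Fin k → E),
      (((α ((extChartAt I x₀).symm y, g)).curryLeft (0, (0, 1))).curryLeft
        (0, (1, 0))).compContinuousLinearMap (ContinuousLinearMap.inl ℝ E (ℝ × ℝ))
          (fun i => symmD I x₀ y (w i)) =
      ev (contr (0, (1, 0)) (contr (0, (0, 1)) f)) ((List.ofFn w).map fun v => (v, 0)) (y, g)) ∧
    Continuous fun g : ℝ × ℝ => (((α ((extChartAt I x₀).symm y, g)).curryLeft
      (0, (0, 1))).curryLeft (0, (1, 0))).compContinuousLinearMap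
        (ContinuousLinearMap.inl ℝ E (ℝ × ℝ)) := by
  have h1 : ∀ (g : ℝ × ℝ) (w : Fin k → E),
      (((α ((extChartAt I x₀).symm y, g)).curryLeft (0, (0, 1))).curryLeft
        (0, (1, 0))).compContinuousLinearMap (ContinuousLinearMap.inl ℝ E (ℝ × ℝ))
          (fun i => symmD I x₀ y (w i)) =
      ev (contr (0, (1, 0)) (contr (0, (0, 1)) f)) ((List.ofFn w).map fun v => (v, 0)) (y, g) := by
    intro g w
    have hz : (y, g) ∈ ((chartDom I x₀).prodUniv (ℝ × ℝ)).carrier := Dom.mem_prodUniv hy g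
    rw [ev_of_mem _ _ hz, contr_val, LForm.contr_apply, contr_val, LForm.contr_apply,
      ← hf ⟨_, hz⟩, LForm.pull_apply]
    have e : ((0, (0, 1)) :: (0, (1, 0)) :: (List.ofFn w).map fun v => (v, 0)).map
        (prodD I x₀ (fun _ => ContinuousLinearMap.id ℝ (ℝ × ℝ)) (y, g)) =
        List.ofFn (Fin.cons (0, (0, 1)) (Fin.cons (0, (1, 0)) fun i => (symmD I x₀ y (w i), 0)) :
          Fin (k + 2) → E × (ℝ × ℝ)) := by
      simp [prodD, List.ofFn_succ, Function.comp_def]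
    rw [e, toL_ofFn]
    rfl
  refine ⟨h1, continuous_alternating fun v => ?_⟩
  refine (continuous_ev_line (contr (0, (1, 0)) (contr (0, (0, 1)) f))
    ((List.ofFn fun i => chartD I x₀ ((extChartAt I x₀).symm y) (v i)).map fun v => (v, 0))
    (S := chartDom I x₀) hy).congr fun g => ?_
  rw [← h1 g]
  simp only [symmD_chartD_apply hy]

theorem represents_squareInt {k : ℕ} {α : DForm (E × (ℝ × ℝ)) (M × (ℝ × ℝ)) (k + 2) ℂ} {x₀ : M}
    {f : SForm ((chartDom I x₀).prodUniv (ℝ × ℝ)) ℂ}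
    (hf : Represents _ (prodParam I x₀ id) (prodD I x₀ fun _ => ContinuousLinearMap.id ℝ (ℝ × ℝ))
      α f) :
    Represents _ (extChartAt I x₀).symm (symmD I x₀) (squareInt α)
      (squareIntS (locConvex_chartDom I x₀) (contr (0, (1, 0)) (contr (0, (0, 1)) f))) := by
  intro y
  obtain ⟨h1, h2⟩ := continuous_square hf y.2
  ext l
  rw [LForm.pull_apply, squareIntS_val]
  by_cases hl : l.length = k
  · obtain ⟨w, rfl⟩ : ∃ w : Fin k → E, l = List.ofFn w := by
      subst hl
      exact ⟨l.get, (List.ofFn_get l).symm⟩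
    rw [List.map_ofFn, toL_ofFn, squareInt]
    have h3 : ∀ t : ℝ, Continuous fun r : ℝ => (((α ((extChartAt I x₀).symm y, (r, t))).curryLeft
      (0, (0, 1))).curryLeft (0, (1, 0))).compContinuousLinearMap
        (ContinuousLinearMap.inl ℝ E (ℝ × ℝ)) := fun t =>
      h2.comp (by fun_prop : Continuous fun r : ℝ => (r, t))
    have h4 : Continuous fun t : ℝ => ∫ r in (0 : ℝ)..1,
        (((α ((extChartAt I x₀).symm y, (r, t))).curryLeft (0, (0, 1))).curryLeft
          (0, (1, 0))).compContinuousLinearMap (ContinuousLinearMap.inl ℝ E (ℝ × ℝ)) :=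
      intervalIntegral.continuous_parametric_intervalIntegral_of_continuous'
        (f := fun t r => (((α ((extChartAt I x₀).symm y, (r, t))).curryLeft
          (0, (0, 1))).curryLeft (0, (1, 0))).compContinuousLinearMap
            (ContinuousLinearMap.inl ℝ E (ℝ × ℝ)))
        (h2.comp (by fun_prop : Continuous fun z : ℝ × ℝ => (z.2, z.1))) 0 1
    have h5 := (ContinuousAlternatingMap.apply ℝ E ℂ (symmD I x₀ y ∘ w)).intervalIntegral_comp_comm
      (h4.intervalIntegrable (μ := volume) 0 1)
    refine h5.symm.trans (intervalIntegral.integral_congr fun t _ => ?_)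
    have h6 := (ContinuousAlternatingMap.apply ℝ E ℂ (symmD I x₀ y ∘ w)).intervalIntegral_comp_comm
      ((h3 t).intervalIntegrable (μ := volume) 0 1)
    exact h6.symm.trans (intervalIntegral.integral_congr fun r _ => h1 (r, t) w)
  · rw [toL_of_length_ne _ _ (by simpa using hl)]
    symm
    refine (intervalIntegral.integral_congr (g := fun _ => ∫ _ in (0 : ℝ)..1, (0 : ℂ))
      fun t _ => intervalIntegral.integral_congr fun r _ => ?_).trans (by simp)
    rw [ev_of_mem _ _ (Dom.mem_prodUniv y.2 (r, t)), contr_val, LForm.contr_apply, contr_val,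
      LForm.contr_apply, ← hf, LForm.pull_apply]
    refine toL_of_length_ne _ _ ?_
    simpa using hl

/-- The derivative of the parametrization of the circle. -/
def circleD (t : ℝ) : ℝ →L[ℝ] EuclideanSpace ℝ (Fin 1) := mfderiv 𝓘(ℝ, ℝ) (𝓡 1) circlePt t

theorem represents_circleInt {k : ℕ}
    {α : DForm (E × EuclideanSpace ℝ (Fin 1)) (M × Circle) (k + 1) ℂ} {x₀ : M}
    {f : SForm ((chartDom I x₀).prodUniv ℝ) ℂ}
    (hf : Represents _ (prodParam I x₀ circlePt) (prodD I x₀ circleD) α f)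
    (y : (chartDom I x₀).carrier) (l : List E) :
    LForm.pull (symmD I x₀ y) (toL (circleInt α ((extChartAt I x₀).symm y))) l =
      lineInt f y l := by
  rw [LForm.pull_apply, lineInt]
  by_cases hl : l.length = k
  · obtain ⟨w, rfl⟩ : ∃ w : Fin k → E, l = List.ofFn w := by
      subst hl
      exact ⟨l.get, (List.ofFn_get l).symm⟩
    rw [List.map_ofFn, toL_ofFn, circleInt]
    have h1 : ∀ (s : ℝ) (w : Fin k → E),
        ((α ((extChartAt I x₀).symm y, circlePt s)).curryLeft
          (0, circleVel s)).compContinuousLinearMap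
            (ContinuousLinearMap.inl ℝ E (EuclideanSpace ℝ (Fin 1)))
            (fun i => symmD I x₀ y (w i)) =
        f.1 ⟨((y : E), s), Dom.mem_prodUniv y.2 s⟩
          ((0, 1) :: (List.ofFn w).map fun v => (v, 0)) := by
      intro s w
      rw [← hf, LForm.pull_apply]
      have e : ((0, 1) :: (List.ofFn w).map fun v => (v, 0)).map
          (prodD I x₀ circleD ((y : E), s)) =
          List.ofFn (Fin.cons (0, circleVel s) (fun i => (symmD I x₀ y (w i), 0)) :
            Fin (k + 1) → E × EuclideanSpace ℝ (Fin 1)) := by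
        simp [prodD, List.ofFn_succ, Function.comp_def]
        rfl
      rw [e, toL_ofFn]
      rfl
    have h2 : Continuous fun s : ℝ => ((α ((extChartAt I x₀).symm y, circlePt s)).curryLeft
          (0, circleVel s)).compContinuousLinearMap
            (ContinuousLinearMap.inl ℝ E (EuclideanSpace ℝ (Fin 1))) := by
      refine continuous_alternating fun v => ?_
      refine (continuous_ev_line f ((0, 1) :: (List.ofFn fun i => chartD I x₀
        ((extChartAt I x₀).symm y) (v i)).map fun v => (v, 0)) y.2).congr fun g => ?_
      rw [ev_of_mem _ _ (Dom.mem_prodUniv y.2 g), ← h1 g]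
      simp only [symmD_chartD_apply y.2]
    have h5 := (ContinuousAlternatingMap.apply ℝ E ℂ (symmD I x₀ y ∘ w)).intervalIntegral_comp_comm
      (h2.intervalIntegrable (μ := volume) 0 1)
    exact h5.symm.trans (intervalIntegral.integral_congr fun s _ => h1 s w)
  · rw [toL_of_length_ne _ _ (by simpa using hl)]
    symm
    refine (intervalIntegral.integral_congr (g := fun _ => (0 : ℂ))
      fun s _ => ?_).trans (by simp)
    change _ = (0 : ℂ)
    rw [← hf, LForm.pull_apply]
    refine toL_of_length_ne _ _ ?_
    simpa using hl

end Charts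

end HolChern

namespace HolChern

open SForm

theorem fderivWithin_comp_affMap {V W F : Type*} [NormedAddCommGroup V] [NormedSpace ℝ V]
    [NormedAddCommGroup W] [NormedSpace ℝ W] [NormedAddCommGroup F] [NormedSpace ℝ F]
    {S : Dom V} {T : Dom W} (j : AffMap T S) {a : V → F} {b : W → F}
    (ha : ContDiffOn ℝ ∞ a S.carrier) (hb : ∀ w, b w = a (j.base + j.lin w)) {w : W}
    (hw : w ∈ T.carrier) (v : W) :
    fderivWithin ℝ b T.carrier w v =
      fderivWithin ℝ a S.carrier (j.base + j.lin w) (j.lin v) := by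
  obtain rfl : b = fun w => a (j.base + j.lin w) := funext hb
  have h1 := (ha.differentiableOn (by simp) _ (j.mapsTo w hw)).hasFDerivWithinAt
  have h2 : HasFDerivWithinAt (fun w => j.base + j.lin w) j.lin T.carrier w :=
    j.lin.hasFDerivWithinAt.const_add _
  have h3 : HasFDerivWithinAt (fun w => a (j.base + j.lin w)) _ T.carrier w :=
    h1.comp w h2 j.mapsTo
  rw [h3.fderivWithin (T.uniqueDiff w hw)]
  rfl

section Circle

theorem contMDiff_circlePt : ContMDiff 𝓘(ℝ, ℝ) (𝓡 1) ∞ circlePt :=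
  contMDiff_circleExp.comp (contDiff_const.mul contDiff_id).contMDiff

theorem hasMFDerivAt_circlePt (t : ℝ) : HasMFDerivAt 𝓘(ℝ, ℝ) (𝓡 1) circlePt t (circleD t) :=
  (contMDiff_circlePt.mdifferentiableAt (by simp)).hasMFDerivAt

theorem circlePt_zero : circlePt 0 = 1 := by simp [circlePt]

theorem circlePt_one : circlePt 1 = 1 := by simp [circlePt]

end Circle

section Loop

variable {E : Type*} [NormedAddCommGroup E] [NormedSpace ℝ E] [FiniteDimensional ℝ E]
  {H : Type*} [TopologicalSpace H] {I : ModelWithCorners ℝ E H}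
  {M : Type*} [TopologicalSpace M] [ChartedSpace H M]
  {P : M × Circle → Op} {p q : ℤ}

theorem SmoothBUZ.contMDiff_block (hP : SmoothBUZ (I.prod (𝓡 1)) P) (p q : ℤ) :
    ContMDiff (I.prod (𝓡 1)) 𝓘(ℝ, Mat p q) ∞ fun y => block p q (P y) :=
  contMDiff_mat.2 fun i j => hP.2.2 i j

/-- The loops of projections in a chart. -/
def projFn (I : ModelWithCorners ℝ E H) (p q : ℤ) (P : M × Circle → Op) (x₀ : M) (z : E × ℝ) :
    Mat p q := block p q (P (prodParam I x₀ circlePt z))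

theorem projFn_zero (x₀ : M) (y : E) :
    projFn I p q P x₀ (y, 0) = P₀ p q P ((extChartAt I x₀).symm y) := by
  simp [projFn, P₀, prodParam, circlePt_zero]

theorem projFn_one (x₀ : M) (y : E) :
    projFn I p q P x₀ (y, 1) = P₀ p q P ((extChartAt I x₀).symm y) := by
  simp [projFn, P₀, prodParam, circlePt_one]

variable [IsManifold I ∞ M] (hP : SmoothBUZ (I.prod (𝓡 1)) P) (hw : ∀ y, P y ∈ BUZWindow p q)
  (x₀ : M)

include hP in
theorem contDiffOn_projFn : ContDiffOn ℝ ∞ (projFn I p q P x₀) ((chartDom I x₀).carrier ×ˢ univ) := by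
  rw [← contMDiffOn_iff_contDiffOn]
  have h1 : ContMDiffOn 𝓘(ℝ, E × ℝ) (I.prod (𝓡 1)) ∞ (prodParam I x₀ circlePt)
      ((chartDom I x₀).carrier ×ˢ univ) := by
    refine ContMDiffOn.prodMk ?_ ?_
    · exact (contMDiffOn_extChartAt_symm x₀).comp (contDiff_fst.contMDiff.contMDiffOn)
        fun z hz => hz.1
    · exact contMDiff_circlePt.comp_contMDiffOn contDiff_snd.contMDiff.contMDiffOn
  exact (hP.contMDiff_block p q).comp_contMDiffOn h1

include hP hw in
theorem projLoop : ProjLoop (chartDom I x₀) (projFn I p q P x₀) where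
  smooth := contDiffOn_projFn hP x₀
  idem _ _ _ := BUZWindow.block_mul_self (hw _)
  star_eq _ _ _ := BUZWindow.star_block (hw _)
  loop y _ := by rw [projFn_zero, projFn_one]

include hP in
theorem dFun_block_prodD {z : E × ℝ} (hz : z ∈ ((chartDom I x₀).prodUniv ℝ).carrier) (v : E × ℝ) :
    dFun (I.prod (𝓡 1)) (fun y => block p q (P y)) (prodParam I x₀ circlePt z)
      (prodD I x₀ circleD z v) =
    fderivWithin ℝ (projFn I p q P x₀) ((chartDom I x₀).prodUniv ℝ).carrier z v := by
  have h1 : HasMFDerivWithinAt 𝓘(ℝ, E × ℝ) I (fun w : E × ℝ => (extChartAt I x₀).symm w.1)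
      ((chartDom I x₀).carrier ×ˢ univ) z
      ((symmD I x₀ z.1).comp (ContinuousLinearMap.fst ℝ E ℝ)) :=
    HasMFDerivWithinAt.comp (u := range I) z (hasMFDerivWithinAt_symm hz.1)
      (hasFDerivWithinAt_fst.hasMFDerivWithinAt)
      fun w hw => extChartAt_target_subset_range x₀ hw.1
  have h2 : HasMFDerivWithinAt 𝓘(ℝ, E × ℝ) (𝓡 1) (fun w : E × ℝ => circlePt w.2)
      ((chartDom I x₀).carrier ×ˢ univ) z
      ((circleD z.2).comp (ContinuousLinearMap.snd ℝ E ℝ)) :=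
    (hasMFDerivAt_circlePt z.2).comp_hasMFDerivWithinAt z
      (hasFDerivWithinAt_snd.hasMFDerivWithinAt)
  have h3 : HasMFDerivWithinAt 𝓘(ℝ, E × ℝ) 𝓘(ℝ, Mat p q) (projFn I p q P x₀)
      ((chartDom I x₀).prodUniv ℝ).carrier z
      ((dFun (I.prod (𝓡 1)) (fun y => block p q (P y)) (prodParam I x₀ circlePt z)).comp
        (prodD I x₀ circleD z)) :=
    (((hP.contMDiff_block p q) (prodParam I x₀ circlePt z)).mdifferentiableAt
      (by simp)).hasMFDerivAt.comp_hasMFDerivWithinAt z (h1.prodMk h2)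
  have h4 : HasFDerivWithinAt (projFn I p q P x₀)
      ((dFun (I.prod (𝓡 1)) (fun y => block p q (P y)) (prodParam I x₀ circlePt z)).comp
        (prodD I x₀ circleD z)) ((chartDom I x₀).prodUniv ℝ).carrier z :=
    hasMFDerivWithinAt_iff_hasFDerivWithinAt.1 h3
  rw [h4.fderivWithin (((chartDom I x₀).prodUniv ℝ).uniqueDiff z hz)]
  rfl

include hP hw in
theorem transport_symm {y : E} (hy : y ∈ (extChartAt I x₀).target) (t : ℝ) :
    transport P ((extChartAt I x₀).symm y) t =
      extOp 1 0 (frameFn (chartDom I x₀) (projFn I p q P x₀) (y, t)) := by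
  have h := projLoop hP hw x₀
  have e : (fun t => P ((extChartAt I x₀).symm y, circlePt t)) =
      fun t => extOp 1 0 (projFn I p q P x₀ (y, t)) :=
    funext fun t => BUZWindow.eq_extOp (hw _)
  rw [transport, e, parallelTransport_extOp (h.projPath hy)
    (h.hasDerivAt_frameFn (locConvex_chartDom I x₀) hy) (h.frameFn_zero hy)]

/-- The holonomy in a chart. -/
def holFn (I : ModelWithCorners ℝ E H) (p q : ℤ) (P : M × Circle → Op) (x₀ : M) (y : E) :
    Mat p q :=
  frameFn (chartDom I x₀) (projFn I p q P x₀) (y, 1) + (1 - projFn I p q P x₀ (y, 0))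

include hP hw

theorem hStar_symm {y : E} (hy : y ∈ (extChartAt I x₀).target) :
    hStar P ((extChartAt I x₀).symm y) = extOp 1 1 (holFn I p q P x₀ y) := by
  have e : P ((extChartAt I x₀).symm y, 1) = extOp 1 0 (projFn I p q P x₀ (y, 0)) := by
    rw [projFn_zero]
    exact BUZWindow.eq_extOp (hw _)
  rw [hStar, transport_symm hP hw x₀ hy, e, holFn, ← extOp_one (p := p) (q := q), extOp_sub,
    extOp_add]
  norm_num

theorem block_hStar_symm {y : E} (hy : y ∈ (extChartAt I x₀).target) :
    block p q (hStar P ((extChartAt I x₀).symm y)) = holFn I p q P x₀ y := by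
  rw [hStar_symm hP hw x₀ hy, block_extOp]

theorem contDiffOn_holFn : ContDiffOn ℝ ∞ (holFn I p q P x₀) (chartDom I x₀).carrier :=
  (ProjLoop.contDiffOn_slice ((projLoop hP hw x₀).contDiffOn_frameFn
    (locConvex_chartDom I x₀)) 1).add
    (contDiffOn_const.sub (ProjLoop.contDiffOn_slice (projLoop hP hw x₀).smooth 0))

theorem star_holFn {y : E} (hy : y ∈ (extChartAt I x₀).target) :
    star (holFn I p q P x₀ y) = star (frameFn (chartDom I x₀) (projFn I p q P x₀) (y, 1)) +
      (1 - projFn I p q P x₀ (y, 0)) := by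
  rw [holFn, star_add, star_sub, star_one, (projLoop hP hw x₀).star_eq y hy]

theorem star_holFn_mul {y : E} (hy : y ∈ (extChartAt I x₀).target) :
    star (holFn I p q P x₀ y) * holFn I p q P x₀ y = 1 := by
  have h := congrArg (fun f : SForm (chartDom I x₀) (Mat p q) => f.1 ⟨y, hy⟩ [])
    (gauge_mul ((projLoop hP hw x₀).isFrame_hol (locConvex_chartDom I x₀)))
  rw [star_holFn hP hw x₀ hy, holFn]
  simpa [ProjLoop.holForm, ProjLoop.baseForm] using h

theorem holFn_mul_star {y : E} (hy : y ∈ (extChartAt I x₀).target) :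
    holFn I p q P x₀ y * star (holFn I p q P x₀ y) = 1 := by
  have h := congrArg (fun f : SForm (chartDom I x₀) (Mat p q) => f.1 ⟨y, hy⟩ [])
    (gauge_mul ((projLoop hP hw x₀).isFrame_hol (locConvex_chartDom I x₀)).symm)
  rw [star_holFn hP hw x₀ hy, holFn]
  simpa [ProjLoop.holForm, ProjLoop.baseForm] using h

omit x₀ in
theorem hStar_mem_UWindow (x : M) : hStar P x ∈ UWindow p q := by
  have hy := mem_extChartAt_target (I := I) x
  have := hStar_symm hP hw x hy
  rw [extChartAt_to_inv] at this
  rw [this]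
  exact extOp_mem_UWindow (star_holFn_mul hP hw x hy) (holFn_mul_star hP hw x hy)

omit x₀ in
theorem smoothU_hStar : SmoothU I (hStar P) := by
  refine ⟨fun x => (hStar_mem_UWindow hP hw x).1, fun x => ?_, fun i j x₀ => ?_⟩
  · refine ⟨p.natAbs + q.natAbs, Eventually.of_forall fun y =>
      UWindow.mono ?_ ?_ (hStar_mem_UWindow hP hw y)⟩ <;> omega
  · refine (contMDiffOn_of_chart (x₀ := x₀)
      (Φ := fun y => entry (extOp 1 1 (holFn I p q P x₀ y)) i j) ?_
      fun y hy => by rw [hStar_symm hP hw x₀ hy]).contMDiffAt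
        ((isOpen_extChartAt_source x₀).mem_nhds (mem_extChartAt_source x₀))
    simp only [entry_extOp]
    split_ifs with h h' h''
    · have h1 : ContDiffOn ℝ ∞ (fun y => (entriesL p q).symm (holFn I p q P x₀ y))
          (extChartAt I x₀).target :=
        (entriesL p q).symm.contDiff.comp_contDiffOn (contDiffOn_holFn hP hw x₀)
      exact contDiffOn_pi.1 (contDiffOn_pi.1 h1 ⟨i, by assumption⟩) ⟨j, by assumption⟩
    all_goals exact contDiffOn_const

end Loop

end HolChern

namespace HolChern

open SForm

section Squares

variable {E : Type*} [NormedAddCommGroup E] [NormedSpace ℝ E] [FiniteDimensional ℝ E]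
  {H : Type*} [TopologicalSpace H] {I : ModelWithCorners ℝ E H}
  {M : Type*} [TopologicalSpace M] [ChartedSpace H M] [IsManifold I ∞ M]
  {P : M × Circle → Op} {p q : ℤ}
  (hP : SmoothBUZ (I.prod (𝓡 1)) P) (hw : ∀ y, P y ∈ BUZWindow p q) (x₀ : M)

include hP hw

theorem dFun_P₀_symm {y : E} (hy : y ∈ (extChartAt I x₀).target) (v : E) :
    dFun I (P₀ p q P) ((extChartAt I x₀).symm y) (symmD I x₀ y v) =
      fderivWithin ℝ (fun y => projFn I p q P x₀ (y, 0)) (chartDom I x₀).carrier y v :=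
  dFun_symmD (ProjLoop.contDiffOn_slice (projLoop hP hw x₀).smooth 0)
    (fun y _ => (projFn_zero x₀ y).symm) hy v

theorem perpForm_symm {y : E} (hy : y ∈ (extChartAt I x₀).target) (v : E) :
    perpForm I p q P ((extChartAt I x₀).symm y) (symmD I x₀ y v) =
      -((1 - projFn I p q P x₀ (y, 0)) *
        fderivWithin ℝ (fun y => projFn I p q P x₀ (y, 0)) (chartDom I x₀).carrier y v) := by
  have h := dFun_symmD (f := fun y => 1 - P₀ p q P y)
    (contDiffOn_const.sub (ProjLoop.contDiffOn_slice (projLoop hP hw x₀).smooth 0))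
    (fun y _ => by rw [projFn_zero]) hy v
  change (1 - P₀ p q P ((extChartAt I x₀).symm y)) *
    dFun I (fun y => 1 - P₀ p q P y) ((extChartAt I x₀).symm y) (symmD I x₀ y v) = _
  have hu : UniqueDiffWithinAt ℝ (extChartAt I x₀).target y := (chartDom I x₀).uniqueDiff y hy
  rw [h, fderivWithin_const_sub hu, projFn_zero, ← mul_neg]
  rfl

theorem sumForm_symm {y : E} (hy : y ∈ (extChartAt I x₀).target) (v : E) :
    sumForm I p q P ((extChartAt I x₀).symm y) (symmD I x₀ y v) =
      projFn I p q P x₀ (y, 0) *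
        fderivWithin ℝ (fun y => projFn I p q P x₀ (y, 0)) (chartDom I x₀).carrier y v -
      (1 - projFn I p q P x₀ (y, 0)) *
        fderivWithin ℝ (fun y => projFn I p q P x₀ (y, 0)) (chartDom I x₀).carrier y v := by
  change P₀ p q P ((extChartAt I x₀).symm y) *
    dFun I (P₀ p q P) ((extChartAt I x₀).symm y) (symmD I x₀ y v) +
    perpForm I p q P ((extChartAt I x₀).symm y) (symmD I x₀ y v) = _
  rw [dFun_P₀_symm hP hw x₀ hy, perpForm_symm hP hw x₀ hy, projFn_zero, ← sub_eq_add_neg]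

theorem pullForm_symm {y : E} (hy : y ∈ (extChartAt I x₀).target) (t : ℝ) (v : E) (b : ℝ) :
    pullForm I p q P t ((extChartAt I x₀).symm y) (symmD I x₀ y v) =
      star (frameFn (chartDom I x₀) (projFn I p q P x₀) (y, t)) *
        fderivWithin ℝ (frameFn (chartDom I x₀) (projFn I p q P x₀))
          ((chartDom I x₀).prodUniv ℝ).carrier (y, t) (v, b) -
      (1 - projFn I p q P x₀ (y, 0)) *
        fderivWithin ℝ (fun y => projFn I p q P x₀ (y, 0)) (chartDom I x₀).carrier y v := by
  have hL := projLoop hP hw x₀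
  have hc := locConvex_chartDom I x₀
  set S := chartDom I x₀
  set F := frameFn S (projFn I p q P x₀)
  have hF : ContDiffOn ℝ ∞ F (S.prodUniv ℝ).carrier := hL.contDiffOn_frameFn_prodUniv hc
  have hd := hL.hasDerivAt_frameFn hc hy
  have h0 := hL.frameFn_zero hy
  have hb : ∀ y ∈ (extChartAt I x₀).target,
      block p q (transport P ((extChartAt I x₀).symm y) t) = F (y, t) := fun y hy => by
    rw [transport_symm hP hw x₀ hy, block_extOp]
  have h1 : dFun I (fun x => block p q (transport P x t)) ((extChartAt I x₀).symm y)
      (symmD I x₀ y v) = fderivWithin ℝ F (S.prodUniv ℝ).carrier (y, t) (v, 0) := by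
    rw [dFun_symmD (Φ := fun y => F (y, t)) (ProjLoop.contDiffOn_slice hF t) hb hy]
    have := fderivWithin_comp_affMap (slice S t) (b := fun y => F (y, t)) hF
      (fun w => by simp [slice]) hy v
    refine this.trans ?_
    simp [slice]
  have h2 : star (F (y, t)) * fderivWithin ℝ F (S.prodUniv ℝ).carrier (y, t) (0, b) = 0 := by
    have e1 := (hF.differentiableOn (by simp) (y, t) ⟨hy, mem_univ _⟩).hasFDerivWithinAt
    have e2 : HasDerivAt (fun s => (y, s)) ((0 : E), (1 : ℝ)) t :=
      (hasDerivAt_const t y).prodMk (hasDerivAt_id t)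
    have e3 := (hasDerivWithinAt_univ.1 (e1.comp_hasDerivWithinAt t e2.hasDerivWithinAt
      fun s _ => Dom.mem_prodUniv hy s)).unique (hd t)
    have e4 : ((0 : E), b) = b • ((0 : E), (1 : ℝ)) := by simp
    rw [e4, map_smul, e3, mul_smul_comm,
      (hL.projPath hy).star_transport_mul_deriv hd h0, smul_zero]
  have h3 : star (F (y, t)) * projFn I p q P x₀ (y, t) = star (F (y, t)) := by
    have := congrArg star ((hL.projPath hy).mul_transport hd h0 t)
    rwa [star_mul, hL.star_eq y hy] at this
  have h4 : ((v, b) : E × ℝ) = (v, 0) + (0, b) := by simp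
  change (block p q (transport P ((extChartAt I x₀).symm y) t)).adj *
      block p q (P ((extChartAt I x₀).symm y, circlePt t)) *
    dFun I (fun x => block p q (transport P x t)) ((extChartAt I x₀).symm y) (symmD I x₀ y v) +
    perpForm I p q P ((extChartAt I x₀).symm y) (symmD I x₀ y v) = _
  rw [h1, perpForm_symm hP hw x₀ hy, hb y hy, h4, map_add, mul_add, h2, add_zero,
    ← sub_eq_add_neg]
  congr 2

theorem fderivWithin_base {y : E} (hy : y ∈ (extChartAt I x₀).target) (g : ℝ × ℝ)
    (v : E × (ℝ × ℝ)) :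
    fderivWithin ℝ (fun w => projFn I p q P x₀ ((projFst (chartDom I x₀) (ℝ × ℝ)).base +
        (projFst (chartDom I x₀) (ℝ × ℝ)).lin w, 0))
      ((chartDom I x₀).prodUniv (ℝ × ℝ)).carrier (y, g) v =
    fderivWithin ℝ (fun y => projFn I p q P x₀ (y, 0)) (chartDom I x₀).carrier y v.1 := by
  have := fderivWithin_comp_affMap (projFst (chartDom I x₀) (ℝ × ℝ))
    (a := fun y => projFn I p q P x₀ (y, 0))
    (ProjLoop.contDiffOn_slice (projLoop hP hw x₀).smooth 0) (fun w => rfl)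
    (Dom.mem_prodUniv hy g) v
  rw [this]
  simp [projFst]

theorem represents_squareOne :
    Represents ((chartDom I x₀).prodUniv (ℝ × ℝ)) (prodParam I x₀ id)
      (prodD I x₀ fun _ => ContinuousLinearMap.id ℝ (ℝ × ℝ)) (squareOne I p q P)
      (famOne (pull (projTime (chartDom I x₀))
          ((projLoop hP hw x₀).frameForm (locConvex_chartDom I x₀)))
        (pull (projTime (chartDom I x₀))
          (star ((projLoop hP hw x₀).frameForm (locConvex_chartDom I x₀))))
        (pull (projFst (chartDom I x₀) (ℝ × ℝ)) (projLoop hP hw x₀).baseForm)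
        (coordR (chartDom I x₀) (Mat p q))) := by
  rw [ProjLoop.frameForm, star_ofFun, pull_ofFun, pull_ofFun, ProjLoop.baseForm, pull_ofFun, coordR]
  refine (IsOneForm.famOne_ofFun _ _ _ _).represents ?_
  rintro ⟨y, r, t⟩ ⟨hy, -⟩ ⟨v, a, b⟩
  have hy' : y ∈ (extChartAt I x₀).target := hy
  have e := fderivWithin_comp_affMap (projTime (chartDom I x₀))
    (a := frameFn (chartDom I x₀) (projFn I p q P x₀))
    ((projLoop hP hw x₀).contDiffOn_frameFn_prodUniv (locConvex_chartDom I x₀)) (fun w => rfl)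
    (Dom.mem_prodUniv hy (r, t)) (v, (a, b))
  rw [e, fderivWithin_base hP hw x₀ hy']
  change _ = (1 - r) • sumForm I p q P ((extChartAt I x₀).symm y) (symmD I x₀ y v) +
    r • pullForm I p q P t ((extChartAt I x₀).symm y) (symmD I x₀ y v)
  rw [sumForm_symm hP hw x₀ hy', pullForm_symm hP hw x₀ hy' t v b]
  simp [projTime, projFst]

theorem represents_squareTwo :
    Represents ((chartDom I x₀).prodUniv (ℝ × ℝ)) (prodParam I x₀ id)
      (prodD I x₀ fun _ => ContinuousLinearMap.id ℝ (ℝ × ℝ)) (squareTwo I p q P)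
      (famTwo (pull (projFst (chartDom I x₀) (ℝ × ℝ))
          ((projLoop hP hw x₀).holForm (locConvex_chartDom I x₀)))
        (pull (projFst (chartDom I x₀) (ℝ × ℝ))
          (star ((projLoop hP hw x₀).holForm (locConvex_chartDom I x₀))))
        (pull (projFst (chartDom I x₀) (ℝ × ℝ)) (projLoop hP hw x₀).baseForm)
        (coordR (chartDom I x₀) (Mat p q)) (coordT (chartDom I x₀) (Mat p q))) := by
  rw [ProjLoop.holForm, star_ofFun, pull_ofFun, pull_ofFun, ProjLoop.baseForm, pull_ofFun, coordR,
    coordT]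
  refine (IsOneForm.famTwo_ofFun _ _ _ _ _).represents ?_
  rintro ⟨y, r, t⟩ ⟨hy, -⟩ ⟨v, a, b⟩
  have hy' : y ∈ (extChartAt I x₀).target := hy
  have hu := contDiffOn_holFn hP hw x₀
  have e := fderivWithin_comp_affMap (projFst (chartDom I x₀) (ℝ × ℝ)) hu (fun w => rfl)
    (Dom.mem_prodUniv hy (r, t)) (v, (a, b))
  have e1 : dFun I (fun x => block p q (hStar P x)) ((extChartAt I x₀).symm y) (symmD I x₀ y v) =
      fderivWithin ℝ (holFn I p q P x₀) (chartDom I x₀).carrier y v :=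
    dFun_symmD hu (fun y hy => block_hStar_symm hP hw x₀ hy) hy' v
  rw [fderivWithin_base hP hw x₀ hy']
  change (1 - r) • _ + (0 + r) • (_ * fderivWithin ℝ (fun w => holFn I p q P x₀
      ((projFst (chartDom I x₀) (ℝ × ℝ)).base + (projFst (chartDom I x₀) (ℝ × ℝ)).lin w))
      ((chartDom I x₀).prodUniv (ℝ × ℝ)).carrier (y, r, t) (v, a, b) + _) =
    (1 - r) • (t • sumForm I p q P ((extChartAt I x₀).symm y) (symmD I x₀ y v)) +
    r • ((block p q (hStar P ((extChartAt I x₀).symm y))).inv *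
        dFun I (fun x => block p q (hStar P x)) ((extChartAt I x₀).symm y) (symmD I x₀ y v) +
      (block p q (hStar P ((extChartAt I x₀).symm y))).inv *
        (t • sumForm I p q P ((extChartAt I x₀).symm y) (symmD I x₀ y v)) *
        block p q (hStar P ((extChartAt I x₀).symm y)))
  rw [sumForm_symm hP hw x₀ hy', e, e1, block_hStar_symm hP hw x₀ hy',
    Mat.inv_eq (holFn_mul_star hP hw x₀ hy'), star_holFn hP hw x₀ hy']
  simp [projFst, holFn]

omit x₀

theorem smoothForm_squareOne : SmoothForm (I.prod 𝓘(ℝ, ℝ × ℝ)) (squareOne I p q P) :=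
  smoothForm_of_prod (θ := squareOne I p q P) fun x₀ => ⟨_, represents_squareOne hP hw x₀⟩

theorem smoothForm_squareTwo : SmoothForm (I.prod 𝓘(ℝ, ℝ × ℝ)) (squareTwo I p q P) :=
  smoothForm_of_prod (θ := squareTwo I p q P) fun x₀ => ⟨_, represents_squareTwo hP hw x₀⟩

/-- The coefficient of the Chern form of degree `2n`. -/
def chernCoeff (n : ℕ) : ℂ := ((2 * Real.pi * Complex.I) ^ n * (n.factorial : ℂ))⁻¹

theorem represents_chernOne (x₀ : M) (n : ℕ) :
    Represents ((chartDom I x₀).prodUniv (ℝ × ℝ)) (prodParam I x₀ id)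
      (prodD I x₀ fun _ => ContinuousLinearMap.id ℝ (ℝ × ℝ))
      (chernConn (I.prod 𝓘(ℝ, ℝ × ℝ)) (fun z => P₀ p q P z.1) (squareOne I p q P) (n + 1))
      ((projLoop hP hw x₀).formOne (locConvex_chartDom I x₀) (chernCoeff (n + 1) • trL p q) n) := by
  have h := (represents_curvature_prod (smoothForm_squareOne hP hw)
    (represents_squareOne hP hw x₀)).wpow (n + 1)
  have hs : ContDiffOn ℝ ∞ (fun z : E × (ℝ × ℝ) => projFn I p q P x₀ (z.1, 0))
      ((chartDom I x₀).prodUniv (ℝ × ℝ)).carrier :=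
    (ProjLoop.contDiffOn_slice (projLoop hP hw x₀).smooth 0).comp contDiff_fst.contDiffOn
      fun z hz => hz.1
  have e : pull (projFst (chartDom I x₀) (ℝ × ℝ)) (projLoop hP hw x₀).baseForm = ofFun _ hs := by
    rw [ProjLoop.baseForm, pull_ofFun]
    exact ofFun_congr fun z _ => by simp [projFst]
  have h2 := Represents.traceForm_smul hs (Q := fun z : M × (ℝ × ℝ) => P₀ p q P z.1)
    (fun z _ => (projFn_zero x₀ z.1).symm) h (chernCoeff (n + 1))
  rw [← e] at h2
  exact h2

theorem represents_chernTwo (x₀ : M) (n : ℕ) :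
    Represents ((chartDom I x₀).prodUniv (ℝ × ℝ)) (prodParam I x₀ id)
      (prodD I x₀ fun _ => ContinuousLinearMap.id ℝ (ℝ × ℝ))
      (chernConn (I.prod 𝓘(ℝ, ℝ × ℝ)) (fun _ => 1) (squareTwo I p q P) (n + 1))
      ((projLoop hP hw x₀).formTwo (locConvex_chartDom I x₀) (chernCoeff (n + 1) • trL p q) n) := by
  have h := (represents_curvature_prod (smoothForm_squareTwo hP hw)
    (represents_squareTwo hP hw x₀)).wpow (n + 1)
  rw [ProjLoop.formTwo, omegaTwo, traceCurv, ← ofFun_one]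
  exact Represents.traceForm_smul _ (fun z _ => rfl) h _

end Squares

end HolChern

namespace HolChern

open SForm

theorem toL_sub {V B : Type*} [NormedAddCommGroup V] [NormedSpace ℝ V] [NormedAddCommGroup B]
    [NormedSpace ℝ B] {k : ℕ} (α β : V [⋀^Fin k]→L[ℝ] B) : toL (α - β) = toL α - toL β := by
  ext l
  by_cases hl : l.length = k
  · rw [LForm.sub_apply, toL_apply _ _ hl, toL_apply _ _ hl, toL_apply _ _ hl]; rfl
  · rw [LForm.sub_apply, toL_of_length_ne _ _ hl, toL_of_length_ne _ _ hl,
      toL_of_length_ne _ _ hl, sub_zero]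

theorem eq_of_pull_toL {V W B : Type*} [NormedAddCommGroup V] [NormedSpace ℝ V]
    [NormedAddCommGroup B] [NormedSpace ℝ B] {k : ℕ} {α β : V [⋀^Fin k]→L[ℝ] B} {D : W → V}
    (hD : Function.Surjective D) (h : LForm.pull D (toL α) = LForm.pull D (toL β)) : α = β := by
  ext v
  choose w hw using fun i => hD (v i)
  have := congrArg (fun φ => φ (List.ofFn w)) h
  simp only [LForm.pull_apply, List.map_ofFn, toL_ofFn] at this
  have e : (D ∘ w) = v := funext hw
  rwa [e] at this

section Main

variable {E : Type*} [NormedAddCommGroup E] [NormedSpace ℝ E] [FiniteDimensional ℝ E]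
  {H : Type*} [TopologicalSpace H] {I : ModelWithCorners ℝ E H}
  {M : Type*} [TopologicalSpace M] [ChartedSpace H M] [IsManifold I ∞ M]
  {P : M × Circle → Op} {p q : ℤ}
  (hP : SmoothBUZ (I.prod (𝓡 1)) P) (hw : ∀ y, P y ∈ BUZWindow p q) (x₀ : M)

/-- The expression of `η` in a chart. -/
def etaForm (n : ℕ) : SForm (chartDom I x₀) ℂ :=
  squareIntS (locConvex_chartDom I x₀) (contr (0, (1, 0)) (contr (0, (0, 1))
    ((projLoop hP hw x₀).formOne (locConvex_chartDom I x₀) (chernCoeff (n + 1) • trL p q) n))) -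
  squareIntS (locConvex_chartDom I x₀) (contr (0, (1, 0)) (contr (0, (0, 1))
    ((projLoop hP hw x₀).formTwo (locConvex_chartDom I x₀) (chernCoeff (n + 1) • trL p q) n)))

theorem represents_eta (n : ℕ) :
    Represents _ (extChartAt I x₀).symm (symmD I x₀) (eta I p q P n) (etaForm hP hw x₀ n) := by
  intro y
  have h1 := represents_squareInt (k := 2 * n) (represents_chernOne hP hw x₀ n) y
  have h2 := represents_squareInt (k := 2 * n) (represents_chernTwo hP hw x₀ n) y
  rw [etaForm, sub_val, ← h1, ← h2, eta, Pi.sub_apply, toL_sub]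
  rfl

include hP hw in
theorem smoothForm_eta (n : ℕ) : SmoothForm I (eta I p q P n) := fun x₀ =>
  contDiffOn_inChart (represents_eta hP hw x₀ n)

theorem represents_chernEven (n : ℕ) :
    Represents ((chartDom I x₀).prodUniv ℝ) (prodParam I x₀ circlePt) (prodD I x₀ circleD)
      (chernEven (I.prod (𝓡 1)) p q P (n + 1))
      (mapVal (chernCoeff (n + 1) • trL p q) ((projLoop hP hw x₀).projForm *
        (d (projLoop hP hw x₀).projForm * d (projLoop hP hw x₀).projForm) ^ (n + 1))) := by
  have h1 : Represents ((chartDom I x₀).prodUniv ℝ) (prodParam I x₀ circlePt) (prodD I x₀ circleD)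
      (fun x => oneForm (dFun (I.prod (𝓡 1)) (fun y => block p q (P y)) x))
      (d (projLoop hP hw x₀).projForm) :=
    Represents.dFun _ fun z hz v => dFun_block_prodD hP x₀ hz v
  exact Represents.traceForm_smul (Q := fun x => block p q (P x)) _ (fun z _ => rfl)
    ((h1.wedge h1).wpow (n + 1)) (chernCoeff (n + 1))

theorem represents_mcForm :
    Represents _ (extChartAt I x₀).symm (symmD I x₀)
      (fun x => oneForm (lmul (block p q (hStar P x)).inv
        (dFun I (fun y => block p q (hStar P y)) x)))
      ((projLoop hP hw x₀).mcForm (locConvex_chartDom I x₀)) := by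
  have hc := locConvex_chartDom I x₀
  have hu := contDiffOn_holFn hP hw x₀
  have e1 : (projLoop hP hw x₀).holForm hc + (1 - (projLoop hP hw x₀).baseForm) =
      ofFun (holFn I p q P x₀) hu := by
    rw [ProjLoop.holForm, ProjLoop.baseForm, ← ofFun_one, ofFun_sub, ofFun_add]
    rfl
  have e2 : star ((projLoop hP hw x₀).holForm hc) + (1 - (projLoop hP hw x₀).baseForm) =
      ofFun (fun y => star (holFn I p q P x₀ y)) (contDiffOn_star hu) := by
    rw [ProjLoop.holForm, ProjLoop.baseForm, ← ofFun_one, star_ofFun, ofFun_sub, ofFun_add]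
    exact ofFun_congr fun y hy => (star_holFn hP hw x₀ hy).symm
  rw [ProjLoop.mcForm, e1, e2]
  refine ((IsOneForm.d_ofFun hu).ofFun_mul _).represents fun y hy v => ?_
  have h := dFun_symmD (f := fun y => block p q (hStar P y)) hu
    (fun y hy => block_hStar_symm hP hw x₀ hy) hy v
  change _ = (block p q (hStar P ((extChartAt I x₀).symm y))).inv *
    dFun I (fun y => block p q (hStar P y)) ((extChartAt I x₀).symm y) (symmD I x₀ y v)
  rw [h, block_hStar_symm hP hw x₀ hy, Mat.inv_eq (holFn_mul_star hP hw x₀ hy)]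
  rfl

/-- The coefficient of the odd Chern form of degree `2n + 1`. -/
def chernOddCoeff (n : ℕ) : ℂ :=
  (-1) ^ n / (2 * Real.pi * Complex.I) ^ (n + 1) *
    ((n.factorial : ℂ) / ((2 * n + 1).factorial : ℂ))

theorem chernOddCoeff_eq (n : ℕ) : chernOddCoeff n =
    ((-1 : ℝ) ^ n * ((n + 1) * (n.factorial : ℝ) ^ 2 / (2 * n + 1).factorial)) •
      chernCoeff (n + 1) := by
  have h1 : (2 * Real.pi * Complex.I : ℂ) ≠ 0 := Complex.two_pi_I_ne_zero
  have h2 : (n.factorial : ℂ) ≠ 0 := by exact_mod_cast n.factorial_ne_zero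
  have h3 : ((2 * n + 1).factorial : ℂ) ≠ 0 := by exact_mod_cast (2 * n + 1).factorial_ne_zero
  have h4 : ((n : ℂ) + 1) ≠ 0 := by exact_mod_cast n.succ_ne_zero
  rw [chernOddCoeff, chernCoeff, Complex.real_smul, Nat.factorial_succ n]
  push_cast
  field_simp

theorem represents_chernOdd (n : ℕ) :
    Represents _ (extChartAt I x₀).symm (symmD I x₀) (chernOdd I p q (hStar P) n)
      (mapVal (chernOddCoeff n • trL p q)
        ((((projLoop hP hw x₀).mcForm (locConvex_chartDom I x₀)) *
          ((projLoop hP hw x₀).mcForm (locConvex_chartDom I x₀))) ^ n *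
          ((projLoop hP hw x₀).mcForm (locConvex_chartDom I x₀)))) := by
  have h := represents_mcForm hP hw x₀
  have h2 := Represents.traceForm_smul (Q := fun _ : M => (1 : Mat p q)) contDiffOn_const
    (fun z _ => rfl) (((h.wedge h).wpow n).wedge h) (chernOddCoeff n)
  rw [ofFun_one, one_mul] at h2
  exact h2

include hP hw in
theorem extD_eta (n : ℕ) : extD I (eta I p q P n) =
    circleInt (k := 2 * n + 1) (chernEven (I.prod (𝓡 1)) p q P (n + 1)) -
      chernOdd I p q (hStar P) n := by
  funext x
  have hc := locConvex_chartDom I x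
  let y : (chartDom I x).carrier := ⟨extChartAt I x x, mem_extChartAt_target x⟩
  have hx : (extChartAt I x).symm (y : E) = x := extChartAt_to_inv x
  have hD : Function.Surjective (symmD I x (y : E)) := fun v =>
    ⟨_, symmD_chartD_apply y.2 v⟩
  refine eq_of_pull_toL hD (LForm.ext fun l => ?_)
  have h1 := represents_extD (smoothForm_eta hP hw n) (represents_eta hP hw x n) y
  have h2 := represents_circleInt (k := 2 * n + 1) (represents_chernEven hP hw x n) y l
  have h3 := represents_chernOdd hP hw x n y
  rw [hx] at h1 h2 h3
  have h4 := (projLoop hP hw x).d_squareInt hc (chernCoeff (n + 1) • trL p q)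
    (fun a b => congrArg (chernCoeff (n + 1) * ·) (trL_mul_comm a b)) n y l
  rw [Pi.sub_apply, toL_sub, h1]
  rw [LForm.pull_apply] at h2
  have h5 := congrArg (fun φ : LForm E ℂ => φ l) h3
  simp only [LForm.pull_apply] at h5
  rw [LForm.pull_apply, LForm.sub_apply, h2, h5, etaForm, d_sub, sub_val, LForm.sub_apply, h4, mapVal_val, mapVal_val,
    LForm.mapVal_apply, LForm.mapVal_apply, chernOddCoeff_eq]
  congr 1
  exact (smul_mul_assoc _ _ _).symm

theorem star_chernCoeff_mul (n : ℕ) :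
    (-1 : ℂ) ^ (n + 1) * star (chernCoeff (n + 1)) = chernCoeff (n + 1) := by
  rw [chernCoeff, star_inv₀, star_mul', star_pow]
  have e : star (2 * Real.pi * Complex.I : ℂ) = (-1) * (2 * Real.pi * Complex.I) := by
    simp
  have e2 : star ((n + 1).factorial : ℂ) = ((n + 1).factorial : ℂ) := by simp
  rw [e, e2, mul_pow, mul_assoc, mul_inv ((-1) ^ (n + 1)), ← mul_assoc]
  have : (-1 : ℂ) ^ (n + 1) ≠ 0 := by simp
  rw [mul_inv_cancel₀ this, one_mul]

theorem formOne_smul (hc : LocConvex (chartDom I x₀).carrier) (hL : ProjLoop (chartDom I x₀)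
    (projFn I p q P x₀)) (c : ℂ) (n : ℕ) (z : ((chartDom I x₀).prodUniv (ℝ × ℝ)).carrier)
    (l : List (E × (ℝ × ℝ))) :
    (hL.formOne hc (c • trL p q) n).1 z l = c * (hL.formOne hc (trL p q) n).1 z l := rfl

theorem formTwo_smul (hc : LocConvex (chartDom I x₀).carrier) (hL : ProjLoop (chartDom I x₀)
    (projFn I p q P x₀)) (c : ℂ) (n : ℕ) (z : ((chartDom I x₀).prodUniv (ℝ × ℝ)).carrier)
    (l : List (E × (ℝ × ℝ))) :
    (hL.formTwo hc (c • trL p q) n).1 z l = c * (hL.formTwo hc (trL p q) n).1 z l := rfl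

theorem im_chernCoeff_mul_eq_zero {V : Type*} {n : ℕ} {φ : LForm V ℂ} (h : star φ = φ)
    {l : List V} (hl : l.length = 2 * (n + 1)) : (chernCoeff (n + 1) * φ l).im = 0 := by
  have h1 := congrArg (fun φ : LForm V ℂ => φ l) h
  have e1 : l.length * (l.length - 1) / 2 = (n + 1) * (2 * n + 1) := by
    rw [hl, mul_assoc, Nat.mul_div_cancel_left _ two_pos]
    rfl
  have e2 : (-1 : ℤ) ^ ((n + 1) * (2 * n + 1)) = (-1) ^ (n + 1) := by
    rw [mul_comm, pow_mul, Odd.neg_one_pow ⟨n, rfl⟩]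
  simp only [LForm.star_apply, e1, e2, zsmul_eq_mul] at h1
  push_cast at h1
  refine Complex.conj_eq_iff_im.1 ?_
  have hs : (-1 : ℂ) ^ (n + 1) * (-1) ^ (n + 1) = 1 := by rw [← mul_pow]; simp
  have hc := star_chernCoeff_mul n
  change star _ = _
  rw [star_mul']
  linear_combination -(star (chernCoeff (n + 1)) * star (φ l)) * hs +
    (-1) ^ (n + 1) * star (φ l) * hc + chernCoeff (n + 1) * h1

include hP hw in
theorem im_eta_eq_zero (n : ℕ) (x : M) (v : Fin (2 * n) → E) : (eta I p q P n x v).im = 0 := by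
  have hc := locConvex_chartDom I x
  let y : (chartDom I x).carrier := ⟨extChartAt I x x, mem_extChartAt_target x⟩
  have hx : (extChartAt I x).symm (y : E) = x := extChartAt_to_inv x
  have h1 := represents_eta hP hw x n y
  rw [hx] at h1
  have h2 := congrArg (fun φ : LForm E ℂ => φ (List.ofFn fun i => chartD I x x (v i))) h1
  have h3 : ∀ w, symmD I x (y : E) (chartD I x x w) = w := fun w => by
    have := symmD_chartD_apply (I := I) y.2 w
    rwa [hx] at this
  simp only [LForm.pull_apply, List.map_ofFn, toL_ofFn, Function.comp_def, h3] at h2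
  rw [h2, etaForm, sub_val, LForm.sub_apply, Complex.sub_im]
  have key : ∀ f : SForm ((chartDom I x).prodUniv (ℝ × ℝ)) ℂ,
      (∀ z l, l.length = 2 * (n + 1) → (f.1 z l).im = 0) →
      ((squareIntS (locConvex_chartDom I x) (contr (0, (1, 0)) (contr (0, (0, 1)) f))).1 y
        (List.ofFn fun i => chartD I x x (v i))).im = 0 := fun f hf => by
    let F : ℝ → ℝ → ℂ := fun r t => ev (contr (0, (1, 0)) (contr (0, (0, 1)) f))
      ((List.ofFn fun i => chartD I x x (v i)).map fun v => (v, 0)) ((y : E), (r, t))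
    have him : ∀ r t : ℝ, F r t = ((F r t).re : ℂ) := fun r t => by
      refine (Complex.conj_eq_iff_re.1 (Complex.conj_eq_iff_im.2 ?_)).symm
      simp only [F]
      rw [ev_of_mem _ _ (Dom.mem_prodUniv y.2 (r, t))]
      refine hf _ _ ?_
      simp
      ring
    have e : (∫ t in (0 : ℝ)..1, ∫ r in (0 : ℝ)..1, F r t) =
        ((∫ t in (0 : ℝ)..1, ∫ r in (0 : ℝ)..1, (F r t).re : ℝ) : ℂ) := by
      rw [← intervalIntegral.integral_ofReal]
      refine intervalIntegral.integral_congr fun t _ => ?_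
      rw [← intervalIntegral.integral_ofReal]
      exact intervalIntegral.integral_congr fun r _ => him r t
    rw [squareIntS_val]
    exact (congrArg Complex.im e).trans (Complex.ofReal_im _)
  rw [key _ fun z l hl => ?_, key _ fun z l hl => ?_, sub_zero]
  · rw [formTwo_smul]
    exact im_chernCoeff_mul_eq_zero
      ((projLoop hP hw x).star_formTwo hc (trL p q) trL_mul_comm trL_star n z) hl
  · rw [formOne_smul]
    exact im_chernCoeff_mul_eq_zero
      ((projLoop hP hw x).star_formOne hc (trL p q) trL_mul_comm trL_star n z) hl

end Main

end HolChern

end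

theorem mainTheorem7
    {E : Type*} [NormedAddCommGroup E] [NormedSpace ℝ E] [FiniteDimensional ℝ E]
    {H : Type*} [TopologicalSpace H] (I : ModelWithCorners ℝ E H)
    {M : Type*} [TopologicalSpace M] [ChartedSpace H M] [IsManifold I ∞ M]
    [CompactSpace M] [T2Space M]
    (P : M × Circle → HolChern.Op) (hP : HolChern.SmoothBUZ (I.prod (𝓡 1)) P) :
    HolChern.SmoothU I (HolChern.hStar P) ∧
    (∃ p q : ℤ, ∀ y, P y ∈ HolChern.BUZWindow p q) ∧
    ∀ p q : ℤ, (∀ y, P y ∈ HolChern.BUZWindow p q) →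
      (∀ x, HolChern.hStar P x ∈ HolChern.UWindow p q) ∧
      ∀ n : ℕ,
        HolChern.SmoothForm I (HolChern.eta I p q P n) ∧
        (∀ x v, (HolChern.eta I p q P n x v).im = 0) ∧
        HolChern.extD I (HolChern.eta I p q P n) =
          HolChern.circleInt (k := 2 * n + 1)
              (HolChern.chernEven (I.prod (𝓡 1)) p q P (n + 1)) -
            HolChern.chernOdd I p q (HolChern.hStar P) n := by
  obtain ⟨p, q, hw⟩ := HolChern.exists_window hP.2.1
  exact ⟨HolChern.smoothU_hStar hP hw, ⟨p, q, hw⟩, fun p q hw =>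
    ⟨HolChern.hStar_mem_UWindow hP hw, fun n => ⟨HolChern.smoothForm_eta hP hw n,
      HolChern.im_eta_eq_zero hP hw n, HolChern.extD_eta hP hw n⟩⟩⟩
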